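/- Theorem 1. \textsc{Terminal Monitoring Set} (TMS) is fixed-parameter tractable when parameterized by solution size plus distance to cluster. Here an instance of TMS consists of a finite simple undirected graph $G=(V,E)$, a set $\mathcal T$ of unordered terminal pairs $\{u,v\}$ with $u,v\in V$, and $k\in\mathbb N$. It is a YES instance if there is a set $S\subseteq V$ with $|S|\le k$ such that for every $\{u,v\}\in\mathcal T$ the distance $d(u,v)$ is finite and there is a $w\in S$ with $d(u,w)+d(w,v)=d(u,v)$. The distance to cluster $\mathrm{dc}(G)$ of $G$ is the smallest size of a set $X\subseteq V$ such that $G-X$ is a disjoint union of complete graphs. A parameterized problem is a set $L\subseteq\Sigma^*\times\mathbb N$ with $\Sigma$ a fixed finite alphabet, and it is fixed-parameter tractable if there are a computable function $f:\mathbb N\to\mathbb N$, a constant $c$ and an algorithm which, for every $I=(x,p)\in\Sigma^*\times\mathbb N$, correctly decides whether $I\in L$ in at most $f(p)\cdot|I|^{c}$ steps. The theorem states that the parameterized problem $$\{(x,p)\ :\ x \text{ encodes a YES instance } (G,\mathcal T,k) \text{ of TMS and } p=k+\mathrm{dc}(G)\}$$ is fixed-parameter tractable. -/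

import Mathlib

/-! ### Random access machines -/

namespace RAM

/-- Instructions of a random access machine with registers `R₀, R₁, …` and a memory `M`, whose
cells hold natural numbers. There is deliberately no multiplication: with unit cost per instruction
the bit length of the largest number grows by at most a constant per step, so that this machine is
polynomially equivalent to the (multitape) Turing machine. -/
inductive Instr where
  /-- `R_d := c` -/
  | const (d c : ℕ)
  /-- `R_d := R_a` -/
  | copy (d a : ℕ)
  /-- `R_d := R_a + R_b` -/
  | add (d a b : ℕ)
  /-- `R_d := max (R_a - R_b) 0` -/
  | sub (d a b : ℕ)
  /-- `R_d := M[R_a]` -/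
  | load (d a : ℕ)
  /-- `M[R_a] := R_b` -/
  | store (a b : ℕ)
  /-- continue with instruction number `l` -/
  | jump (l : ℕ)
  /-- if `R_a = 0`, continue with instruction number `l` -/
  | jumpZero (a l : ℕ)

/-- A program is a finite list of instructions, numbered from `0`. -/
abbrev Program := List Instr

/-- A configuration: program counter, registers, memory. -/
@[ext]
structure Config where
  pc : ℕ
  reg : ℕ → ℕ
  mem : ℕ → ℕ

/-- The effect of one instruction. -/
def Instr.exec (i : Instr) (c : Config) : Config :=
  match i with
  | .const d a => ⟨c.pc + 1, Function.update c.reg d a, c.mem⟩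
  | .copy d a => ⟨c.pc + 1, Function.update c.reg d (c.reg a), c.mem⟩
  | .add d a b => ⟨c.pc + 1, Function.update c.reg d (c.reg a + c.reg b), c.mem⟩
  | .sub d a b => ⟨c.pc + 1, Function.update c.reg d (c.reg a - c.reg b), c.mem⟩
  | .load d a => ⟨c.pc + 1, Function.update c.reg d (c.mem (c.reg a)), c.mem⟩
  | .store a b => ⟨c.pc + 1, c.reg, Function.update c.mem (c.reg a) (c.reg b)⟩
  | .jump l => ⟨l, c.reg, c.mem⟩
  | .jumpZero a l => ⟨if c.reg a = 0 then l else c.pc + 1, c.reg, c.mem⟩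

/-- A configuration is halted if the program counter has left the program. -/
def Halted (P : Program) (c : Config) : Prop := P.length ≤ c.pc

/-- One step of the machine; a halted configuration does not change any more. -/
def step (P : Program) (c : Config) : Config :=
  match P[c.pc]? with
  | some i => i.exec c
  | none => c

/-- The initial configuration on the input `(x, p)`: the letters of `x` stand in the memory cells
`0, …, |x| - 1`, the length of `x` in register `0`, the number `p` in register `1`, and all other
registers and cells hold `0`. -/
def initial (I : List Bool × ℕ) : Config where
  pc := 0
  reg := fun r => if r = 0 then I.1.length else if r = 1 then I.2 else 0
  mem := fun a => if I.1[a]? = some true then 1 else 0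

/-- On the input `I`, the program halts after at most `t` steps. -/
def HaltsWithin (P : Program) (I : List Bool × ℕ) (t : ℕ) : Prop :=
  Halted P ((step P)^[t] (initial I))

/-- On the input `I`, the program halts with `1` in register `0`. -/
def Accepts (P : Program) (I : List Bool × ℕ) : Prop :=
  ∃ t, Halted P ((step P)^[t] (initial I)) ∧ ((step P)^[t] (initial I)).reg 0 = 1

end RAM

/-! ### Fixed-parameter tractability -/

/-- A parameterized problem: a set of pairs (string over a fixed finite alphabet, parameter). -/
abbrev ParameterizedProblem := Set (List Bool × ℕ)

/-- The size of `(x, p)`: the length of `x` plus the parameter written in unary, with one further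
symbol to separate them (so that the size is never `0`). -/
def ParameterizedProblem.size (I : List Bool × ℕ) : ℕ := I.1.length + I.2 + 1

/-- A parameterized problem `L` is fixed-parameter tractable if for some computable function `f`,
constant `c` and algorithm `P`, the algorithm decides for every `I = (x, p)` whether `I ∈ L`, within
`f p * |I| ^ c` steps. -/
def ParameterizedProblem.IsFPT (L : ParameterizedProblem) : Prop :=
  ∃ (f : ℕ → ℕ) (c : ℕ) (P : RAM.Program), Computable f ∧
    ∀ I : List Bool × ℕ,
      RAM.HaltsWithin P I (f I.2 * ParameterizedProblem.size I ^ c) ∧ (RAM.Accepts P I ↔ I ∈ L)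

/-! ### Distance to cluster -/

/-- A cluster graph is a disjoint union of complete graphs: every component is complete. -/
def SimpleGraph.IsClusterGraph {V : Type*} (G : SimpleGraph V) : Prop :=
  ∀ u v : V, G.Reachable u v → u ≠ v → G.Adj u v

/-- `X` is a cluster deletion set of `G` if `G - X` is a cluster graph. -/
def SimpleGraph.IsClusterDeletionSet {V : Type*} (G : SimpleGraph V) (X : Finset V) : Prop :=
  (G.induce {v : V | v ∉ X}).IsClusterGraph

/-- The smallest size of a cluster deletion set. -/
noncomputable def SimpleGraph.distToCluster {V : Type*} (G : SimpleGraph V) : ℕ :=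
  sInf {m : ℕ | ∃ X : Finset V, G.IsClusterDeletionSet X ∧ X.card = m}

/-! ### Terminal monitoring sets -/

/-- `S` is a terminal monitoring set for the terminal pairs `T`: for every pair `{u, v}` of `T` there
is a `w ∈ S` with `d(u, w) + d(w, v) = d(u, v)`, where `d(u, v)` is finite (a pair without a connecting
path cannot be monitored). -/
def SimpleGraph.IsTerminalMonitoringSet {V : Type*} (G : SimpleGraph V) (T : Finset (Sym2 V))
    (S : Finset V) : Prop :=
  ∀ u v : V, s(u, v) ∈ T →
    G.edist u v ≠ ⊤ ∧ ∃ w ∈ S, G.edist u w + G.edist w v = G.edist u v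

/-- An instance `(G, T, k)`, with the vertices of `G` numbered. -/
structure TMSInstance where
  /-- number of vertices -/
  n : ℕ
  G : SimpleGraph (Fin n)
  /-- terminal pairs -/
  T : Finset (Sym2 (Fin n))
  /-- bound on the solution size -/
  k : ℕ

namespace TMSInstance

/-- The instance is a YES instance. -/
def IsYes (I : TMSInstance) : Prop :=
  ∃ S : Finset (Fin I.n), S.card ≤ I.k ∧ I.G.IsTerminalMonitoringSet I.T S

/-- The `n × n` matrix of a relation on `Fin n`, row by row. -/
def matrixBits {n : ℕ} (r : Fin n → Fin n → Bool) : List Bool :=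
  (List.finRange n).flatMap fun i => (List.finRange n).map fun j => r i j

open scoped Classical in
/-- The encoding of an instance: `n` in unary, closed by a `false`, then the adjacency matrix of `G`,
the matrix of the set of terminal pairs, and the binary digits of `k` (least significant first). -/
noncomputable def encode (I : TMSInstance) : List Bool :=
  List.replicate I.n true ++ [false] ++
    matrixBits (fun i j => decide (I.G.Adj i j)) ++
    matrixBits (fun i j => decide (s(i, j) ∈ I.T)) ++
    Nat.bits I.k

end TMSInstance

/-- Terminal monitoring set, parameterized by solution size plus distance to cluster. -/
def TMSBySolutionSizePlusDistToCluster : ParameterizedProblem :=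
  {J | ∃ I : TMSInstance, J = (I.encode, I.k + I.G.distToCluster) ∧ I.IsYes}

/-! The combinatorial core is an interplay between a cluster deletion set X and the distances from
the monitors to X. If w and w' have the same distances to all vertices of X but some u is strictly
closer to w than to w', then a shortest path from u to w avoids X, since a passage through X would
lead equally fast to w'. So u and w lie in one clique of G - X
(`IsClusterDeletionSet.edist_le_one`). Hence vertices with equal distance vectors to X are
interchangeable as monitors, except near the ends of the pair to be monitored.

This suggests the following search. Find X by branching on the three vertices of an induced path,
and guess for each of the k monitors its distance vector to X. This leaves a set of candidates for
each monitor. A pair is safe if some monitor has candidates and all of them monitor the pair. When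
all pairs are safe, any choice of candidates is a solution (`isYes_of_good`). Otherwise take the
first unsafe pair {u, v}. A solution monitors it by some s that fits the guesses, while another
candidate w fails; so s is closer than w to u or to v. That end is then in the clique of s, and the
monitor can be bound to the closed neighbourhood of that end. If the same monitor is bound again,
its candidates already lie in one clique, so the new end is s itself and the candidate becomes
unique. A monitor is thus bound at most twice, and 2k rounds suffice (`exists_refinement`,
`exists_refineRun`).

The guesses are few. Among three consecutive vertices of a shortest path one is in X, so finite
distances are at most 3|X| + 1 (`IsClusterDeletionSet.edist_le`), and distances cut off at 3p + 3
lose nothing when |X| ≤ p. All guesses together are p² + 5p digits in base 3p + 4. The parameter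
must be exactly k + dc(G): one branch has to find a deletion set with at most p - k vertices, and no
branch may find a smaller one. The latter test is complete because branching along a minimum set
deletes only vertices of that set (`exists_deleteRun`).

For the running time the algorithm is written in a small language whose loop lengths are fixed on
entry, and compiled to the random access machine with an exact step count (`Stmt.steps_compile`). If
all loop bounds are at most Q, the cost of a fixed statement is polynomial in Q (`Stmt.cost_le`,
`Stmt.polyBounded`). Here Q is a computable function of p times the square of the input size, so a
fixed power of Q has the form required by fixed-parameter tractability. -/

set_option linter.constructorNameAsVariable false
set_option linter.unusedSimpArgs false

/-! ### A structured language with bounded loops -/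

namespace Imp

/-- The variables of the structured language. -/
inductive Var where
  | L | p | n | nn | q | k | d | cap | B | M | N | p2 | ok | yes | early | res | t | s | m
  | a | b | c | r | i | j | u | v | w | y | z
  deriving DecidableEq

/-- The arrays of the structured language. -/
inductive Arr where
  | inp | g | xs | R | R2 | D | kd | cc
  deriving DecidableEq

/-- The register that holds a variable. -/
def Var.reg (x : Var) : ℕ := x.ctorIdx

/-- The residue class of memory cells that holds an array. -/
def Arr.idx (a : Arr) : ℕ := a.ctorIdx

theorem Var.reg_inj {x y : Var} (h : x.reg = y.reg) : x = y := by
  have key : ∀ x : Var, Var.ofNat x.reg = x := by intro x; cases x <;> rfl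
  rw [← key x, ← key y, h]

theorem Var.reg_lt (x : Var) : x.reg < 30 := by cases x <;> decide

theorem Arr.idx_inj {a b : Arr} (h : a.idx = b.idx) : a = b := by
  have key : ∀ x : Arr, Arr.ofNat x.idx = x := by intro x; cases x <;> rfl
  rw [← key a, ← key b, h]

theorem Arr.idx_lt (a : Arr) : a.idx < 8 := by cases a <;> decide

/-- The states of the structured language. -/
structure St where
  var : Var → ℕ
  arr : Arr → ℕ → ℕ

/-- Assignment to a variable. -/
def St.set (σ : St) (x : Var) (a : ℕ) : St := ⟨Function.update σ.var x a, σ.arr⟩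

/-- Assignment to an array cell. -/
def St.put (σ : St) (a : Arr) (i b : ℕ) : St :=
  ⟨σ.var, Function.update σ.arr a (Function.update (σ.arr a) i b)⟩

@[simp] theorem St.set_var (σ : St) (x y : Var) (a : ℕ) :
    (σ.set x a).var y = if y = x then a else σ.var y := by
  simp [St.set, Function.update_apply]

@[simp] theorem St.set_arr (σ : St) (x : Var) (a : ℕ) : (σ.set x a).arr = σ.arr := rfl

@[simp] theorem St.put_var (σ : St) (a : Arr) (i b : ℕ) : (σ.put a i b).var = σ.var := rfl

@[simp] theorem St.put_arr (σ : St) (a a' : Arr) (i b : ℕ) :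
    (σ.put a i b).arr a' = if a' = a then Function.update (σ.arr a) i b else σ.arr a' := by
  simp only [St.put, Function.update_apply]

/-- Expressions. Loops in expressions are sums whose bound is a variable. -/
inductive Expr where
  | const (c : ℕ)
  | var (x : Var)
  | get (a : Arr) (e : Expr)
  | add (e f : Expr)
  | sub (e f : Expr)
  | isz (e : Expr)
  | sum (x v : Var) (e : Expr)

/-- The value of an expression. -/
def Expr.eval : Expr → St → ℕ
  | .const c, _ => c
  | .var x, σ => σ.var x
  | .get a e, σ => σ.arr a (e.eval σ)
  | .add e f, σ => e.eval σ + f.eval σ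
  | .sub e f, σ => e.eval σ - f.eval σ
  | .isz e, σ => 1 - e.eval σ
  | .sum x v e, σ => ∑ i ∈ Finset.range (σ.var v), e.eval (σ.set x i)

/-- The number of machine steps for the evaluation of an expression. -/
def Expr.cost : Expr → St → ℕ
  | .const _, _ => 1
  | .var _, _ => 1
  | .get _ e, σ => e.cost σ + 7
  | .add e f, σ => e.cost σ + f.cost σ + 1
  | .sub e f, σ => e.cost σ + f.cost σ + 1
  | .isz e, σ => e.cost σ + 2
  | .sum x v e, σ => 4 + ∑ i ∈ Finset.range (σ.var v), (e.cost (σ.set x i) + 6) + 3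

/-- Statements. The number of iterations of a loop is fixed when the loop is entered. -/
inductive Stmt where
  | skip
  | assign (x : Var) (e : Expr)
  | put (a : Arr) (e f : Expr)
  | seq (s s' : Stmt)
  | ite (e : Expr) (s s' : Stmt)
  | loop (x v : Var) (s : Stmt)

/-- The effect of a statement. -/
def Stmt.run : Stmt → St → St
  | .skip, σ => σ
  | .assign x e, σ => σ.set x (e.eval σ)
  | .put a e f, σ => σ.put a (e.eval σ) (f.eval σ)
  | .seq s s', σ => s'.run (s.run σ)
  | .ite e s s', σ => if e.eval σ = 0 then s'.run σ else s.run σ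
  | .loop x v s, σ => Nat.rec σ (fun i τ => s.run (τ.set x i)) (σ.var v)

/-- The state in a loop after `i` iterations. -/
def Stmt.iter (x : Var) (s : Stmt) (σ : St) (i : ℕ) : St :=
  Nat.rec σ (fun i τ => s.run (τ.set x i)) i

@[simp] theorem Stmt.iter_zero (x : Var) (s : Stmt) (σ : St) : s.iter x σ 0 = σ := rfl

theorem Stmt.iter_succ (x : Var) (s : Stmt) (σ : St) (i : ℕ) :
    s.iter x σ (i + 1) = s.run ((s.iter x σ i).set x i) := rfl

theorem Stmt.run_loop (x v : Var) (s : Stmt) (σ : St) :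
    (Stmt.loop x v s).run σ = s.iter x σ (σ.var v) := rfl

/-- The number of machine steps for the execution of a statement. -/
def Stmt.cost : Stmt → St → ℕ
  | .skip, _ => 0
  | .assign _ e, σ => e.cost σ + 1
  | .put _ e f, σ => e.cost σ + 6 + f.cost σ + 1
  | .seq s s', σ => s.cost σ + s'.cost (s.run σ)
  | .ite e s s', σ => e.cost σ + 1 + if e.eval σ = 0 then s'.cost σ else s.cost σ + 1
  | .loop x v s, σ =>
    2 + ∑ i ∈ Finset.range (σ.var v), (5 + s.cost ((s.iter x σ i).set x i) + 1) + 2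

/-! ### Compilation -/

open RAM

attribute [local simp] Instr.exec

/-- The instructions that turn an index in register `t` into an address. Register `30` holds the first
memory cell used for arrays. -/
def addressCode (a : Arr) (t : ℕ) : List Instr :=
  -- Three doublings multiply the index by 8: the eight arrays are interleaved, one per residue
  -- class modulo 8 above the base, so none needs a length bound.
  [.add t t t, .add t t t, .add t t t, .add t t 30, .const (t + 1) a.idx, .add t t (t + 1)]

def Expr.len : Expr → ℕ
  | .const _ => 1
  | .var _ => 1
  | .get _ e => e.len + 7
  | .add e f => e.len + f.len + 1
  | .sub e f => e.len + f.len + 1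
  | .isz e => e.len + 2
  | .sum _ _ e => 6 + e.len + 5

/-- Code at address `o` that puts the value of an expression into register `t` and uses the registers
from `t` on. -/
def Expr.compile : Expr → ℕ → ℕ → List Instr
  | .const c, t, _ => [.const t c]
  | .var x, t, _ => [.copy t x.reg]
  | .get a e, t, o => e.compile t o ++ (addressCode a t ++ [.load t t])
  | .add e f, t, o => e.compile t o ++ (f.compile (t + 1) (o + e.len) ++ [.add t t (t + 1)])
  | .sub e f, t, o => e.compile t o ++ (f.compile (t + 1) (o + e.len) ++ [.sub t t (t + 1)])
  | .isz e, t, o => e.compile t o ++ [.const (t + 1) 1, .sub t (t + 1) t]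
  | .sum x v e, t, o =>
    -- Register `t` accumulates, `t + 1` keeps the bound, `t + 2` saves the old value of `x`, and
    -- the counter runs in the register of `x` itself. The final `copy` restores `x`, so that
    -- evaluation has no side effect.
    [.const t 0, .copy (t + 1) v.reg, .copy (t + 2) x.reg, .const x.reg 0] ++
    ([.sub (t + 3) (t + 1) x.reg, .jumpZero (t + 3) (o + 6 + e.len + 4)] ++
    (e.compile (t + 3) (o + 6) ++
    ([.add t t (t + 3), .const (t + 3) 1, .add x.reg x.reg (t + 3), .jump (o + 4)] ++
    [.copy x.reg (t + 2)])))

def Stmt.len : Stmt → ℕ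
  | .skip => 0
  | .assign _ e => e.len + 1
  | .put _ e f => e.len + 6 + f.len + 1
  | .seq s s' => s.len + s'.len
  | .ite e s s' => e.len + 1 + s.len + 1 + s'.len
  | .loop _ _ s => 7 + s.len + 1

/-- Code at address `o` for a statement that uses the registers from `t` on for intermediate
results. -/
def Stmt.compile : Stmt → ℕ → ℕ → List Instr
  | .skip, _, _ => []
  | .assign x e, t, o => e.compile t o ++ [.copy x.reg t]
  | .put a e f, t, o =>
    e.compile t o ++ (addressCode a t ++ (f.compile (t + 1) (o + e.len + 6) ++ [.store t (t + 1)]))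
  | .seq s s', t, o => s.compile t o ++ s'.compile t (o + s.len)
  | .ite e s s', t, o =>
    e.compile t o ++ ([.jumpZero t (o + e.len + 1 + s.len + 1)] ++
    (s.compile t (o + e.len + 1) ++ ([.jump (o + e.len + 1 + s.len + 1 + s'.len)] ++
    s'.compile t (o + e.len + 1 + s.len + 1))))
  | .loop x v s, t, o =>
    -- The counter lives in `t`, apart from `x`, and the bound in `t + 1`; so the body may overwrite
    -- both variables without changing the number of iterations.
    [.const t 0, .copy (t + 1) v.reg] ++
    ([.sub (t + 2) (t + 1) t, .jumpZero (t + 2) (o + 7 + s.len + 1), .copy x.reg t,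
      .const (t + 2) 1, .add t t (t + 2)] ++
    (s.compile (t + 2) (o + 7) ++ [.jump (o + 2)]))

@[simp] theorem Expr.length_compile (e : Expr) (t o : ℕ) : (e.compile t o).length = e.len := by
  induction e generalizing t o <;> simp_all [Expr.compile, Expr.len, addressCode] <;> omega

@[simp] theorem Stmt.length_compile (s : Stmt) (t o : ℕ) : (s.compile t o).length = s.len := by
  induction s generalizing t o <;> simp_all [Stmt.compile, Stmt.len, addressCode] <;> omega

/-- The program `P` contains the given instructions from address `o` on. -/
def CodeAt (P : Program) : ℕ → List Instr → Prop
  | _, [] => True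
  | o, i :: l => P[o]? = some i ∧ CodeAt P (o + 1) l

theorem codeAt_append {P : Program} {o : ℕ} {l l' : List Instr} :
    CodeAt P o (l ++ l') ↔ CodeAt P o l ∧ CodeAt P (o + l.length) l' := by
  induction l generalizing o with
  | nil => simp [CodeAt]
  | cons i l ih => simp [CodeAt, ih, and_assoc, Nat.add_assoc, Nat.add_comm 1]

theorem codeAt_self (A l B : List Instr) : CodeAt (A ++ l ++ B) A.length l := by
  induction l generalizing A with
  | nil => trivial
  | cons i l ih =>
    refine ⟨by simp, ?_⟩
    have := ih (A ++ [i])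
    simpa using this

/-- Instructions that do not jump. -/
def isStraight : Instr → Bool
  | .jump _ => false
  | .jumpZero _ _ => false
  | _ => true

/-! ### Execution of compiled code on the machine -/

theorem step_of_get {P : Program} {o : ℕ} {reg mem : ℕ → ℕ} {i : Instr} (h : P[o]? = some i) :
    (step P)^[1] ⟨o, reg, mem⟩ = i.exec ⟨o, reg, mem⟩ := by
  simp [step, h]

theorem steps_cast {P : Program} {c : Config} {n o o' : ℕ} {reg mem : ℕ → ℕ}
    (h : (step P)^[n] c = ⟨o, reg, mem⟩) (ho : o = o') : (step P)^[n] c = ⟨o', reg, mem⟩ :=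
  ho ▸ h

theorem pc_exec_of_isStraight {i : Instr} (h : isStraight i) (c : Config) :
    (i.exec c).pc = c.pc + 1 := by
  cases i <;> simp_all [isStraight, Instr.exec]

theorem steps_of_isStraight {P : Program} {l : List Instr} {c : Config} (hl : CodeAt P c.pc l)
    (hs : l.all isStraight) : (step P)^[l.length] c = l.foldl (fun c i => i.exec c) c := by
  induction l generalizing c with
  | nil => rfl
  | cons i l ih =>
    simp only [List.all_cons, Bool.and_eq_true] at hs
    have h1 : step P c = i.exec c := step_of_get hl.1
    rw [List.length_cons, Function.iterate_succ_apply, h1, List.foldl_cons]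
    refine ih ?_ hs.2
    rw [pc_exec_of_isStraight hs.1]
    exact hl.2

/-- The configuration `c` represents the state `σ`, with arrays stored from cell `L` on. -/
structure Rep (σ : St) (L : ℕ) (reg mem : ℕ → ℕ) : Prop where
  var : ∀ x : Var, reg x.reg = σ.var x
  base : reg 30 = L
  arr : ∀ (a : Arr) (i : ℕ), mem (L + 8 * i + a.idx) = σ.arr a i

/-- Only registers below 31 are constrained by the represented state; the rest is scratch space. -/
theorem Rep.mono {σ : St} {L : ℕ} {reg reg' mem : ℕ → ℕ} (h : Rep σ L reg mem)
    (hr : ∀ r < 31, reg' r = reg r) : Rep σ L reg' mem where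
  var x := by rw [hr _ (by have := x.reg_lt; omega), h.var]
  base := by rw [hr _ (by omega), h.base]
  arr := h.arr

theorem Rep.set {σ : St} {L : ℕ} {reg mem : ℕ → ℕ} (h : Rep σ L reg mem) (x : Var) {a : ℕ}
    {reg' : ℕ → ℕ} (hx : reg' x.reg = a) (hr : ∀ r < 31, r ≠ x.reg → reg' r = reg r) :
    Rep (σ.set x a) L reg' mem where
  var y := by
    by_cases hy : y = x
    · subst hy; simp [hx]
    · rw [hr _ (by have := y.reg_lt; omega) (fun h => hy (Var.reg_inj h)), h.var]; simp [hy]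
  base := by rw [hr _ (by omega) (by have := x.reg_lt; omega), h.base]
  arr := h.arr

/-- As `idx` is below 8, distinct pairs (array, index) have distinct addresses, so the write touches
no other array cell. -/
theorem Rep.put {σ : St} {L : ℕ} {reg mem : ℕ → ℕ} (h : Rep σ L reg mem) (a : Arr) (i b : ℕ) :
    Rep (σ.put a i b) L reg (Function.update mem (L + 8 * i + a.idx) b) where
  var := h.var
  base := h.base
  arr a' i' := by
    have h1 := a.idx_lt
    have h2 := a'.idx_lt
    by_cases ha : a' = a
    · subst ha
      simp only [St.put_arr, if_true, Function.update_apply, ← h.arr]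
      by_cases hi : i' = i
      · simp [hi]
      · rw [if_neg (by omega), if_neg hi]
    · have : a'.idx ≠ a.idx := fun h => ha (Arr.idx_inj h)
      simp only [St.put_arr, if_neg ha, Function.update_apply, ← h.arr]
      rw [if_neg (by omega)]

theorem foldl_addressCode (a : Arr) {t L : ℕ} (ht : 31 ≤ t) (c : Config)
    (hL : c.reg 30 = L) :
    ∃ reg', (addressCode a t).foldl (fun c i => i.exec c) c = ⟨c.pc + 6, reg', c.mem⟩ ∧
      reg' t = L + 8 * c.reg t + a.idx ∧ ∀ r < t, reg' r = c.reg r := by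
  refine ⟨_, rfl, ?_, ?_⟩
  · have : 30 ≠ t := by omega
    simp [Function.update_apply, this, hL]
    omega
  · intro r hr
    simp [Function.update_apply, show r ≠ t by omega, show r ≠ t + 1 by omega]

theorem steps_trans {P : Program} {c c' c'' : Config} {m n : ℕ} (h : (step P)^[m] c = c')
    (h' : (step P)^[n] c' = c'') : (step P)^[m + n] c = c'' := by
  rw [Nat.add_comm, Function.iterate_add_apply, h, h']

theorem steps_addressCode {P : Program} (a : Arr) {t L o : ℕ} (ht : 31 ≤ t) {reg mem : ℕ → ℕ}
    (hP : CodeAt P o (addressCode a t)) (hL : reg 30 = L) :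
    ∃ reg', (step P)^[6] ⟨o, reg, mem⟩ = ⟨o + 6, reg', mem⟩ ∧
      reg' t = L + 8 * reg t + a.idx ∧ ∀ r < t, reg' r = reg r := by
  obtain ⟨reg', h1, h2, h3⟩ := foldl_addressCode a ht ⟨o, reg, mem⟩ hL
  refine ⟨reg', ?_, h2, h3⟩
  rw [← h1, ← steps_of_isStraight (P := P) hP (by simp [addressCode, isStraight])]
  rfl

/-- Induction on the expression. Preservation of all registers below `t` is what carries the
induction: partial results of an enclosing expression are kept just there. -/
theorem Expr.steps_compile {P : Program} (e : Expr) {σ : St} {L t o : ℕ} {reg mem : ℕ → ℕ}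
    (ht : 31 ≤ t) (hP : CodeAt P o (e.compile t o)) (hσ : Rep σ L reg mem) :
    ∃ reg', (step P)^[e.cost σ] ⟨o, reg, mem⟩ = ⟨o + e.len, reg', mem⟩ ∧
      reg' t = e.eval σ ∧ ∀ r < t, reg' r = reg r := by
  induction e generalizing σ t o reg with
  | const c =>
    refine ⟨_, step_of_get (P := P) hP.1, by simp [Expr.eval], ?_⟩
    intro r hr
    simp [Function.update_apply, hr.ne]
  | var x =>
    refine ⟨_, step_of_get (P := P) hP.1, by simp [Expr.eval, hσ.var], ?_⟩
    intro r hr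
    simp [Function.update_apply, hr.ne]
  | get a e ih =>
    rw [Expr.compile, codeAt_append, codeAt_append, Expr.length_compile] at hP
    obtain ⟨r1, h1, h1t, h1r⟩ := ih ht hP.1 hσ
    obtain ⟨r2, h2, h2t, h2r⟩ := steps_addressCode (mem := mem) a ht hP.2.1
      (L := L) ((h1r _ (by omega)).trans hσ.base)
    have h3 := step_of_get (P := P) (o := o + e.len + 6) (reg := r2) (mem := mem) hP.2.2.1
    refine ⟨_, steps_trans (n := 7) h1 (steps_trans h2 (n := 1) h3), ?_, ?_⟩
    · simp [h2t, h1t, hσ.arr, Expr.eval]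
    · intro r hr
      simp [Function.update_apply, hr.ne, h1r r hr, h2r r hr]
  | add e f ihe ihf =>
    rw [Expr.compile, codeAt_append, codeAt_append, Expr.length_compile, Expr.length_compile] at hP
    obtain ⟨r1, h1, h1t, h1r⟩ := ihe ht hP.1 hσ
    obtain ⟨r2, h2, h2t, h2r⟩ := ihf (t := t + 1) (by omega) hP.2.1
      (hσ.mono fun r hr => h1r r (by omega))
    have h3 := step_of_get (P := P) (o := o + e.len + f.len) (reg := r2) (mem := mem) hP.2.2.1
    refine ⟨_, steps_cast (steps_trans (steps_trans h1 h2) (n := 1) h3) (by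
      simp only [Expr.len]; omega), ?_, ?_⟩
    · simp [h2t, h1t, h2r, Expr.eval]
    · intro r hr
      simp [Function.update_apply, hr.ne, h1r r hr, h2r r (by omega)]
  | sub e f ihe ihf =>
    rw [Expr.compile, codeAt_append, codeAt_append, Expr.length_compile, Expr.length_compile] at hP
    obtain ⟨r1, h1, h1t, h1r⟩ := ihe ht hP.1 hσ
    obtain ⟨r2, h2, h2t, h2r⟩ := ihf (t := t + 1) (by omega) hP.2.1
      (hσ.mono fun r hr => h1r r (by omega))
    have h3 := step_of_get (P := P) (o := o + e.len + f.len) (reg := r2) (mem := mem) hP.2.2.1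
    refine ⟨_, steps_cast (steps_trans (steps_trans h1 h2) (n := 1) h3) (by
      simp only [Expr.len]; omega), ?_, ?_⟩
    · simp [h2t, h1t, h2r, Expr.eval]
    · intro r hr
      simp [Function.update_apply, hr.ne, h1r r hr, h2r r (by omega)]
  | isz e ih =>
    rw [Expr.compile, codeAt_append, Expr.length_compile] at hP
    obtain ⟨r1, h1, h1t, h1r⟩ := ih ht hP.1 hσ
    have h2 := steps_of_isStraight (P := P) (c := ⟨o + e.len, r1, mem⟩) hP.2 (by simp [isStraight])
    refine ⟨_, steps_trans (n := 2) h1 h2, ?_, ?_⟩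
    · simp [Function.update_apply, h1t, Expr.eval]
    · intro r hr
      simp [Function.update_apply, h1r r hr, hr.ne, show r ≠ t + 1 by omega]
  | sum x v e ih =>
    rw [Expr.compile, codeAt_append, codeAt_append, codeAt_append, codeAt_append,
      Expr.length_compile] at hP
    obtain ⟨hP1, hP2, hP3, hP4, hP5⟩ := hP
    simp only [List.length_cons, List.length_nil, Nat.reduceAdd, Nat.add_assoc] at hP2 hP3 hP4 hP5
    have hx := x.reg_lt
    have hv := v.reg_lt
    -- Loop invariant at the test (address `o + 4`) after `i` rounds. The register of `x` is exempt
    -- from preservation because it holds the counter until the end of the loop.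
    have key : ∀ i ≤ σ.var v, ∃ reg', (step P)^[4 + ∑ j ∈ Finset.range i,
        (e.cost (σ.set x j) + 6)] ⟨o, reg, mem⟩ = ⟨o + 4, reg', mem⟩ ∧
        reg' t = ∑ j ∈ Finset.range i, e.eval (σ.set x j) ∧ reg' (t + 1) = σ.var v ∧
        reg' (t + 2) = σ.var x ∧ reg' x.reg = i ∧ ∀ r < t, r ≠ x.reg → reg' r = reg r := by
      intro i
      induction i with
      | zero =>
        intro _
        have h2 := steps_of_isStraight (P := P) (c := ⟨o, reg, mem⟩) hP1 (by simp [isStraight])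
        refine ⟨_, h2, ?_, ?_, ?_, ?_, ?_⟩
        · simp [Function.update_apply, show t ≠ x.reg by omega]
        · simp [Function.update_apply, show t + 1 ≠ x.reg by omega, show v.reg ≠ t by omega, hσ.var]
        · simp [Function.update_apply, show t + 2 ≠ x.reg by omega, show x.reg ≠ t by omega,
            show x.reg ≠ t + 1 by omega, hσ.var]
        · simp
        · intro r hr hrx
          simp [Function.update_apply, hr.ne, hrx, show r ≠ t + 1 by omega, show r ≠ t + 2 by omega]
      | succ i ih' =>
        intro hi
        obtain ⟨r1, h1, h1t, h1v, h1s, h1x, h1r⟩ := ih' (by omega)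
        have h2 : (step P)^[2] ⟨o + 4, r1, mem⟩ =
            ⟨o + 6, Function.update r1 (t + 3) (σ.var v - i), mem⟩ := by
          refine (steps_trans (m := 1) (step_of_get hP2.1) (step_of_get hP2.2.1)).trans ?_
          simp only [Instr.exec, h1v, h1x, Function.update_self]
          rw [if_neg (by omega)]
        obtain ⟨r3, h3, h3t, h3r⟩ := ih (σ := σ.set x i) (t := t + 3) (by omega)
          hP3 (hσ.set x (reg' := Function.update r1 (t + 3) (σ.var v - i))
            (by simp [Function.update_apply, show x.reg ≠ t + 3 by omega, h1x]) (by
              intro r hr hrx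
              rw [Function.update_of_ne (by omega), h1r r (by omega) hrx]))
        have hP4' : CodeAt P (o + 6 + e.len) [.add t t (t + 3), .const (t + 3) 1,
            .add x.reg x.reg (t + 3), .jump (o + 4)] := by rw [Nat.add_assoc]; exact hP4
        have h4 := steps_of_isStraight (P := P) (c := ⟨o + 6 + e.len, r3, mem⟩)
          (l := [.add t t (t + 3), .const (t + 3) 1, .add x.reg x.reg (t + 3)])
          ⟨hP4'.1, hP4'.2.1, hP4'.2.2.1, trivial⟩ (by simp [isStraight])
        have h5 := step_of_get (P := P) (o := o + 6 + e.len + 1 + 1 + 1)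
          (reg := (([.add t t (t + 3), .const (t + 3) 1, .add x.reg x.reg (t + 3)] :
            List Instr).foldl (fun (c : Config) i => i.exec c) ⟨o + 6 + e.len, r3, mem⟩).reg) (mem := mem)
          hP4'.2.2.2.1
        have h6 := steps_trans (n := 1) (steps_trans (steps_trans (steps_trans h1 h2) h3) h4) h5
        refine ⟨_, (Eq.trans (congrArg (fun m => (step P)^[m] _) ?_) h6), ?_, ?_, ?_, ?_, ?_⟩
        · rw [Finset.sum_range_succ]; simp; omega
        · simp [Function.update_apply, show t ≠ x.reg by omega, h3t, h3r, Finset.sum_range_succ, h1t]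
        · simp [Function.update_apply, show t + 1 ≠ x.reg by omega, h3r, h1v]
        · simp [Function.update_apply, show t + 2 ≠ x.reg by omega, h3r, h1s]
        · simp [Function.update_apply, show x.reg ≠ t + 3 by omega, h3r x.reg (by omega), h1x,
            show x.reg ≠ t by omega]
        · intro r hr hrx
          simp [Function.update_apply, hrx, hr.ne, show r ≠ t + 3 by omega, h3r r (by omega),
            h1r r hr hrx]
    obtain ⟨r1, h1, h1t, h1v, h1s, h1x, h1r⟩ := key _ le_rfl
    have h2 : (step P)^[2] ⟨o + 4, r1, mem⟩ =
        ⟨o + 6 + e.len + 4, Function.update r1 (t + 3) 0, mem⟩ := by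
      refine (steps_trans (m := 1) (step_of_get hP2.1) (step_of_get hP2.2.1)).trans ?_
      simp [Instr.exec, h1v, h1x, Nat.add_assoc]
    have h3 := step_of_get (P := P) (o := o + 6 + e.len + 4)
      (reg := Function.update r1 (t + 3) 0) (mem := mem)
      (by rw [Nat.add_assoc, Nat.add_assoc]; exact hP5.1)
    refine ⟨_, steps_cast (steps_trans (n := 3) h1 (steps_trans h2 (n := 1) h3))
      (by
      simp only [Expr.len]; omega), ?_, ?_⟩
    · simp [Function.update_apply, show t ≠ x.reg by omega, h1t, Expr.eval]
    · intro r hr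
      by_cases hrx : r = x.reg
      · simp [hrx, h1s, hσ.var]
      · simp [Function.update_apply, hrx, show r ≠ t + 3 by omega, h1r r hr hrx]

/-- Registers from 31 up to `t` must survive because they hold the counters and bounds of enclosing
loops; registers below 31 are accounted for by `Rep`. -/
theorem Stmt.steps_compile {P : Program} (s : Stmt) {σ : St} {L t o : ℕ} {reg mem : ℕ → ℕ}
    (ht : 31 ≤ t) (hP : CodeAt P o (s.compile t o)) (hσ : Rep σ L reg mem) :
    ∃ reg' mem', (step P)^[s.cost σ] ⟨o, reg, mem⟩ = ⟨o + s.len, reg', mem'⟩ ∧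
      Rep (s.run σ) L reg' mem' ∧ ∀ r < t, 31 ≤ r → reg' r = reg r := by
  induction s generalizing σ t o reg mem with
  | skip => exact ⟨reg, mem, rfl, hσ, fun _ _ _ => rfl⟩
  | assign x e =>
    have hx := x.reg_lt
    rw [Stmt.compile, codeAt_append, Expr.length_compile] at hP
    obtain ⟨r1, h1, h1t, h1r⟩ := e.steps_compile ht hP.1 hσ
    have h2 := step_of_get (P := P) (o := o + e.len) (reg := r1) (mem := mem) hP.2.1
    refine ⟨_, _, steps_trans (n := 1) h1 h2, hσ.set x (by simp [h1t]) ?_, ?_⟩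
    · intro r hr hrx
      simp [Function.update_of_ne hrx, h1r r (by omega)]
    · intro r hr hr'
      simp [Function.update_apply, show r ≠ x.reg by omega, h1r r hr]
  | put a e f =>
    rw [Stmt.compile, codeAt_append, codeAt_append, codeAt_append, Expr.length_compile,
      Expr.length_compile] at hP
    obtain ⟨r1, h1, h1t, h1r⟩ := e.steps_compile ht hP.1 hσ
    obtain ⟨r2, h2, h2t, h2r⟩ := steps_addressCode (mem := mem) a ht hP.2.1
      (L := L) ((h1r _ (by omega)).trans hσ.base)
    obtain ⟨r3, h3, h3t, h3r⟩ := f.steps_compile (t := t + 1) (by omega) hP.2.2.1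
      (hσ.mono fun r hr => (h2r r (by omega)).trans (h1r r (by omega)))
    have h4 := step_of_get (P := P) (o := o + e.len + 6 + f.len) (reg := r3) (mem := mem) hP.2.2.2.1
    refine ⟨_, _, steps_cast (steps_trans (n := 1) (steps_trans (steps_trans h1 h2) h3) h4)
      (by simp only [Stmt.len]; omega), ?_, ?_⟩
    · simp only [h3r t (by omega), h2t, h1t, h3t]
      exact (hσ.put a _ _).mono
        fun r hr => by rw [h3r r (by omega), h2r r (by omega), h1r r (by omega)]
    · intro r hr hr'
      simp [h3r r (by omega), h2r r (by omega), h1r r (by omega)]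
  | seq s s' ih ih' =>
    rw [Stmt.compile, codeAt_append, Stmt.length_compile] at hP
    obtain ⟨r1, m1, h1, h1t, h1r⟩ := ih ht hP.1 hσ
    obtain ⟨r2, m2, h2, h2t, h2r⟩ := ih' ht hP.2 h1t
    refine ⟨r2, m2, ?_, h2t, fun r hr hr' => by rw [h2r r hr hr', h1r r hr hr']⟩
    rw [Stmt.len, ← Nat.add_assoc]
    exact steps_trans h1 h2
  | ite e s s' ih ih' =>
    rw [Stmt.compile, codeAt_append, codeAt_append, codeAt_append, codeAt_append,
      Expr.length_compile, Stmt.length_compile] at hP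
    obtain ⟨hP1, hP2, hP3, hP4, hP5⟩ := hP
    simp only [List.length_cons, List.length_nil, Nat.zero_add] at hP3 hP4 hP5
    obtain ⟨r1, h1, h1t, h1r⟩ := e.steps_compile ht hP1 hσ
    have h2 := step_of_get (P := P) (o := o + e.len) (reg := r1) (mem := mem) hP2.1
    have hσ' : Rep σ L r1 mem := hσ.mono fun r hr => h1r r (by omega)
    have h12 := steps_trans (n := 1) h1 h2
    simp only [Instr.exec, h1t] at h12
    by_cases he : e.eval σ = 0
    · rw [if_pos he] at h12
      obtain ⟨r3, m3, h3, h3t, h3r⟩ := ih' ht hP5 hσ'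
      refine ⟨r3, m3, ?_, by simpa [Stmt.run, he] using h3t,
        fun r hr hr' => by rw [h3r r hr hr', h1r r hr]⟩
      simp only [Stmt.cost, if_pos he]
      rw [steps_trans h12 h3, Stmt.len]
      simp only [Nat.add_assoc]
    · rw [if_neg he] at h12
      obtain ⟨r3, m3, h3, h3t, h3r⟩ := ih ht hP3 hσ'
      have h4 := step_of_get (P := P) (o := o + e.len + 1 + s.len) (reg := r3) (mem := m3) hP4.1
      refine ⟨r3, m3, ?_, by simpa [Stmt.run, he] using h3t,
        fun r hr hr' => by rw [h3r r hr hr', h1r r hr]⟩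
      simp only [Stmt.cost, if_neg he]
      rw [← Nat.add_assoc, steps_trans (n := 1) (steps_trans h12 h3) h4, Stmt.len]
      simp only [Nat.add_assoc, Instr.exec]
  | loop x v s ih =>
    have hx := x.reg_lt
    have hv := v.reg_lt
    rw [Stmt.compile, codeAt_append, codeAt_append, codeAt_append, Stmt.length_compile] at hP
    obtain ⟨hP1, hP2, hP3, hP4⟩ := hP
    simp only [List.length_cons, List.length_nil, Nat.reduceAdd, Nat.add_assoc] at hP2 hP3 hP4
    have key : ∀ i ≤ σ.var v, ∃ reg' mem', (step P)^[2 + ∑ j ∈ Finset.range i,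
        (5 + s.cost ((s.iter x σ j).set x j) + 1)] ⟨o, reg, mem⟩ = ⟨o + 2, reg', mem'⟩ ∧
        reg' t = i ∧ reg' (t + 1) = σ.var v ∧ Rep (s.iter x σ i) L reg' mem' ∧
        ∀ r < t, 31 ≤ r → reg' r = reg r := by
      intro i
      induction i with
      | zero =>
        intro _
        have h2 := steps_of_isStraight (P := P) (c := ⟨o, reg, mem⟩) hP1 (by simp [isStraight])
        refine ⟨_, _, h2, ?_, ?_, ?_, ?_⟩
        · simp [Function.update_apply]
        · simp [Function.update_apply, show v.reg ≠ t by omega, hσ.var]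
        · refine hσ.mono fun r hr => ?_
          simp [Function.update_apply, show r ≠ t by omega, show r ≠ t + 1 by omega]
        · intro r hr hr'
          simp [Function.update_apply, show r ≠ t by omega, show r ≠ t + 1 by omega]
      | succ i ih' =>
        intro hi
        obtain ⟨r1, m1, h1, h1t, h1v, h1s, h1r⟩ := ih' (by omega)
        have h2 : (step P)^[2] ⟨o + 2, r1, m1⟩ =
            ⟨o + 4, Function.update r1 (t + 2) (σ.var v - i), m1⟩ := by
          refine (steps_trans (m := 1) (step_of_get hP2.1) (step_of_get hP2.2.1)).trans ?_
          simp only [Instr.exec, h1v, h1t, Function.update_self]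
          rw [if_neg (by omega)]
        have h3 := steps_of_isStraight (P := P)
          (c := ⟨o + 4, Function.update r1 (t + 2) (σ.var v - i), m1⟩)
          (l := [.copy x.reg t, .const (t + 2) 1, .add t t (t + 2)])
          ⟨hP2.2.2.1, hP2.2.2.2.1, hP2.2.2.2.2.1, trivial⟩ (by simp [isStraight])
        simp only [List.foldl, Instr.exec] at h3
        set r3 := Function.update (Function.update (Function.update (Function.update r1 (t + 2)
          (σ.var v - i)) x.reg (Function.update r1 (t + 2) (σ.var v - i) t)) (t + 2) 1) t
          (Function.update (Function.update (Function.update r1 (t + 2)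
          (σ.var v - i)) x.reg (Function.update r1 (t + 2) (σ.var v - i) t)) (t + 2) 1 t +
          Function.update (Function.update (Function.update r1 (t + 2)
          (σ.var v - i)) x.reg (Function.update r1 (t + 2) (σ.var v - i) t)) (t + 2) 1 (t + 2))
          with hr3
        have h3t : r3 t = i + 1 := by
          simp [hr3, Function.update_apply, show t ≠ x.reg by omega, h1t]
        have h3v : r3 (t + 1) = σ.var v := by
          simp [hr3, Function.update_apply, show t + 1 ≠ x.reg by omega, h1v]
        have h3x : r3 x.reg = i := by
          simp [hr3, Function.update_apply, show x.reg ≠ t by omega, show x.reg ≠ t + 2 by omega,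
            h1t]
        have h3r : ∀ r < t, r ≠ x.reg → r3 r = r1 r := by
          intro r hr hrx
          simp [hr3, Function.update_apply, show r ≠ t by omega, show r ≠ t + 2 by omega, hrx]
        obtain ⟨r4, m4, h4, h4t, h4r⟩ := ih (σ := (s.iter x σ i).set x i) (t := t + 2) (by omega)
          hP3
          (h1s.set x (reg' := r3) h3x fun r hr hrx => h3r r (by omega) hrx)
        have h5 := step_of_get (P := P) (o := o + 7 + s.len) (reg := r4) (mem := m4) (i := .jump (o + 2))
          (by rw [Nat.add_assoc]; exact hP4.1)
        have h6 := steps_trans (n := 1) (steps_trans (steps_trans (steps_trans h1 h2) h3) h4) h5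
        refine ⟨r4, m4, (Eq.trans (congrArg (fun m => (step P)^[m] _) ?_) h6), ?_, ?_, h4t, ?_⟩
        · rw [Finset.sum_range_succ]; simp; omega
        · rw [h4r t (by omega) ht, h3t]
        · rw [h4r _ (by omega) (by omega), h3v]
        · intro r hr hr'
          rw [h4r r (by omega) hr', h3r r hr (by omega), h1r r hr hr']
    obtain ⟨r1, m1, h1, h1t, h1v, h1s, h1r⟩ := key _ le_rfl
    have h2 : (step P)^[2] ⟨o + 2, r1, m1⟩ =
        ⟨o + 7 + s.len + 1, Function.update r1 (t + 2) 0, m1⟩ := by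
      refine (steps_trans (m := 1) (step_of_get hP2.1) (step_of_get hP2.2.1)).trans ?_
      simp [Instr.exec, h1v, h1t, Nat.add_assoc]
    refine ⟨_, _, steps_cast (steps_trans h1 h2) (by simp only [Stmt.len]; omega),
      h1s.mono fun r hr => ?_, fun r hr hr' => ?_⟩
    · rw [Function.update_of_ne (by omega)]
    · rw [Function.update_of_ne (by omega), h1r r hr hr']

end Imp

namespace Imp

/-! ### Frames and cost bounds -/

/-- The statement does not assign the variable. -/
def Stmt.keeps : Stmt → Var → Bool
  | .skip, _ => true
  | .assign x _, y => x != y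
  | .put _ _ _, _ => true
  | .seq s s', y => s.keeps y && s'.keeps y
  | .ite _ s s', y => s.keeps y && s'.keeps y
  | .loop x _ s, y => x != y && s.keeps y

/-- The statement does not write to the array. -/
def Stmt.keepsArr : Stmt → Arr → Bool
  | .skip, _ => true
  | .assign _ _, _ => true
  | .put a _ _, b => a != b
  | .seq s s', b => s.keepsArr b && s'.keepsArr b
  | .ite _ s s', b => s.keepsArr b && s'.keepsArr b
  | .loop _ _ s, b => s.keepsArr b

theorem Stmt.iter_var {s : Stmt} {x y : Var} (hxy : x ≠ y)
    (h : ∀ σ : St, (s.run σ).var y = σ.var y) (σ : St) (i : ℕ) :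
    (s.iter x σ i).var y = σ.var y := by
  induction i with
  | zero => rfl
  | succ i ih => rw [Stmt.iter_succ, h, St.set_var, if_neg hxy.symm, ih]

theorem Stmt.iter_arr {s : Stmt} {x : Var} {b : Arr}
    (h : ∀ σ : St, (s.run σ).arr b = σ.arr b) (σ : St) (i : ℕ) :
    (s.iter x σ i).arr b = σ.arr b := by
  induction i with
  | zero => rfl
  | succ i ih => rw [Stmt.iter_succ, h, St.set_arr, ih]

theorem Stmt.run_var {s : Stmt} {y : Var} (h : s.keeps y = true) (σ : St) :
    (s.run σ).var y = σ.var y := by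
  induction s generalizing σ with
  | skip => rfl
  | assign x e =>
    have : x ≠ y := by simpa [Stmt.keeps] using h
    simp [Stmt.run, this.symm]
  | put a e f => simp [Stmt.run]
  | seq s s' ih ih' =>
    simp only [Stmt.keeps, Bool.and_eq_true] at h
    rw [Stmt.run, ih' h.2, ih h.1]
  | ite e s s' ih ih' =>
    simp only [Stmt.keeps, Bool.and_eq_true] at h
    rw [Stmt.run]
    split_ifs
    · exact ih' h.2 σ
    · exact ih h.1 σ
  | loop x v s ih =>
    simp only [Stmt.keeps, Bool.and_eq_true, bne_iff_ne, ne_eq] at h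
    exact Stmt.iter_var h.1 (ih h.2) σ _

theorem Stmt.run_arr {s : Stmt} {b : Arr} (h : s.keepsArr b = true) (σ : St) :
    (s.run σ).arr b = σ.arr b := by
  induction s generalizing σ with
  | skip => rfl
  | assign x e => simp [Stmt.run]
  | put a e f =>
    have : a ≠ b := by simpa [Stmt.keepsArr] using h
    simp [Stmt.run, this.symm]
  | seq s s' ih ih' =>
    simp only [Stmt.keepsArr, Bool.and_eq_true] at h
    rw [Stmt.run, ih' h.2, ih h.1]
  | ite e s s' ih ih' =>
    simp only [Stmt.keepsArr, Bool.and_eq_true] at h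
    rw [Stmt.run]
    split_ifs
    · exact ih' h.2 σ
    · exact ih h.1 σ
  | loop x v s ih => exact Stmt.iter_arr (ih h) σ _

/-- All loop bounds lie in `b`, no loop variable does. -/
def Expr.wf (b : Var → Bool) : Expr → Bool
  | .const _ => true
  | .var _ => true
  | .get _ e => e.wf b
  | .add e f => e.wf b && f.wf b
  | .sub e f => e.wf b && f.wf b
  | .isz e => e.wf b
  | .sum x v e => b v && !b x && e.wf b

/-- All loop bounds lie in `b`, no assigned variable does. -/
def Stmt.wf (b : Var → Bool) : Stmt → Bool
  | .skip => true
  | .assign x e => !b x && e.wf b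
  | .put _ e f => e.wf b && f.wf b
  | .seq s s' => s.wf b && s'.wf b
  | .ite e s s' => e.wf b && s.wf b && s'.wf b
  | .loop x v s => b v && !b x && s.wf b

/-- A bound for the cost of an expression all whose loop bounds are at most `Q`. -/
def Expr.bound : Expr → ℕ → ℕ
  | .const _, _ => 1
  | .var _, _ => 1
  | .get _ e, Q => e.bound Q + 7
  | .add e f, Q => e.bound Q + f.bound Q + 1
  | .sub e f, Q => e.bound Q + f.bound Q + 1
  | .isz e, Q => e.bound Q + 2
  | .sum _ _ e, Q => 4 + Q * (e.bound Q + 6) + 3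

/-- A bound for the cost of a statement all whose loop bounds are at most `Q`. -/
def Stmt.bound : Stmt → ℕ → ℕ
  | .skip, _ => 0
  | .assign _ e, Q => e.bound Q + 1
  | .put _ e f, Q => e.bound Q + 6 + f.bound Q + 1
  | .seq s s', Q => s.bound Q + s'.bound Q
  | .ite e s s', Q => e.bound Q + 1 + (s'.bound Q + s.bound Q + 1)
  | .loop _ _ s, Q => 2 + Q * (5 + s.bound Q + 1) + 2

theorem Expr.cost_le {b : Var → Bool} {Q : ℕ} {e : Expr} (he : e.wf b = true) {σ : St}
    (hσ : ∀ v, b v = true → σ.var v ≤ Q) : e.cost σ ≤ e.bound Q := by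
  induction e generalizing σ with
  | const c => exact le_rfl
  | var x => exact le_rfl
  | get a e ih => exact Nat.add_le_add_right (ih he hσ) _
  | add e f ihe ihf =>
    simp only [Expr.wf, Bool.and_eq_true] at he
    exact Nat.add_le_add_right (Nat.add_le_add (ihe he.1 hσ) (ihf he.2 hσ)) _
  | sub e f ihe ihf =>
    simp only [Expr.wf, Bool.and_eq_true] at he
    exact Nat.add_le_add_right (Nat.add_le_add (ihe he.1 hσ) (ihf he.2 hσ)) _
  | isz e ih => exact Nat.add_le_add_right (ih he hσ) _
  | sum x v e ih =>
    simp only [Expr.wf, Bool.and_eq_true, Bool.not_eq_true'] at he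
    have h1 : ∑ i ∈ Finset.range (σ.var v), (e.cost (σ.set x i) + 6) ≤
        Q * (e.bound Q + 6) := by
      refine (Finset.sum_le_card_nsmul _ _ (e.bound Q + 6) fun i _ => ?_).trans ?_
      · refine Nat.add_le_add_right (ih he.2 fun w hw => ?_) _
        rw [St.set_var, if_neg]
        · exact hσ w hw
        · rintro rfl
          simp [he.1.2] at hw
      · rw [Finset.card_range, smul_eq_mul]
        exact Nat.mul_le_mul_right _ (hσ v he.1.1)
    simp only [Expr.cost, Expr.bound]
    omega

theorem Stmt.keeps_of_wf {b : Var → Bool} {s : Stmt} (h : s.wf b = true) {v : Var}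
    (hv : b v = true) : s.keeps v = true := by
  induction s with
  | skip => rfl
  | assign x e =>
    simp only [Stmt.wf, Bool.and_eq_true, Bool.not_eq_true'] at h
    simp only [Stmt.keeps, bne_iff_ne]
    rintro rfl
    simp [h.1] at hv
  | put a e f => rfl
  | seq s s' ih ih' =>
    simp only [Stmt.wf, Bool.and_eq_true] at h
    simp [Stmt.keeps, ih h.1, ih' h.2]
  | ite e s s' ih ih' =>
    simp only [Stmt.wf, Bool.and_eq_true] at h
    simp [Stmt.keeps, ih h.1.2, ih' h.2]
  | loop x w s ih =>
    simp only [Stmt.wf, Bool.and_eq_true, Bool.not_eq_true'] at h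
    simp only [Stmt.keeps, bne_iff_ne, Bool.and_eq_true]
    refine ⟨?_, ih h.2⟩
    rintro rfl
    simp [h.1.2] at hv

/-- Well-formedness forbids assignments to loop bounds, so the hypothesis `≤ Q` remains valid in
every intermediate state, and each nested loop contributes a factor of at most `Q`. -/
theorem Stmt.cost_le {b : Var → Bool} {Q : ℕ} {s : Stmt} (hs : s.wf b = true) {σ : St}
    (hσ : ∀ v, b v = true → σ.var v ≤ Q) : s.cost σ ≤ s.bound Q := by
  induction s generalizing σ with
  | skip => exact le_rfl
  | assign x e =>
    simp only [Stmt.wf, Bool.and_eq_true] at hs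
    exact Nat.add_le_add_right (Expr.cost_le hs.2 hσ) _
  | put a e f =>
    simp only [Stmt.wf, Bool.and_eq_true] at hs
    have := Expr.cost_le hs.1 hσ
    have := Expr.cost_le hs.2 hσ
    simp only [Stmt.cost, Stmt.bound]
    omega
  | seq s s' ih ih' =>
    simp only [Stmt.wf, Bool.and_eq_true] at hs
    refine Nat.add_le_add (ih hs.1 hσ) (ih' hs.2 fun v hv => ?_)
    rw [Stmt.run_var (Stmt.keeps_of_wf hs.1 hv)]
    exact hσ v hv
  | ite e s s' ih ih' =>
    simp only [Stmt.wf, Bool.and_eq_true] at hs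
    have := Expr.cost_le hs.1.1 hσ
    have := ih hs.1.2 hσ
    have := ih' hs.2 hσ
    simp only [Stmt.cost, Stmt.bound]
    split_ifs <;> omega
  | loop x v s ih =>
    simp only [Stmt.wf, Bool.and_eq_true, Bool.not_eq_true'] at hs
    have hne : ∀ w, b w = true → x ≠ w := by
      rintro w hw rfl
      simp [hs.1.2] at hw
    have h1 : ∑ i ∈ Finset.range (σ.var v), (5 + s.cost ((s.iter x σ i).set x i) + 1) ≤
        Q * (5 + s.bound Q + 1) := by
      refine (Finset.sum_le_card_nsmul _ _ (5 + s.bound Q + 1) fun i _ => ?_).trans ?_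
      · refine Nat.add_le_add_right (Nat.add_le_add_left (ih hs.2 fun w hw => ?_) _) _
        rw [St.set_var, if_neg (hne w hw).symm,
          Stmt.iter_var (hne w hw) (Stmt.run_var (Stmt.keeps_of_wf hs.2 hw))]
        exact hσ w hw
      · rw [Finset.card_range, smul_eq_mul]
        exact Nat.mul_le_mul_right _ (hσ v hs.1.1)
    simp only [Stmt.cost, Stmt.bound]
    omega

/-! ### Polynomial bounds for the cost of fixed statements -/

/-- Bounded by a monomial. -/
def PolyBounded (F : ℕ → ℕ) : Prop := ∃ C D : ℕ, ∀ Q, 1 ≤ Q → F Q ≤ C * Q ^ D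

theorem PolyBounded.const (c : ℕ) : PolyBounded fun _ => c := ⟨c, 0, by simp⟩

theorem PolyBounded.add {F G : ℕ → ℕ} (hF : PolyBounded F) (hG : PolyBounded G) :
    PolyBounded fun Q => F Q + G Q := by
  obtain ⟨C, D, h⟩ := hF
  obtain ⟨C', D', h'⟩ := hG
  refine ⟨C + C', D + D', fun Q hQ => ?_⟩
  have h1 : Q ^ D ≤ Q ^ (D + D') := Nat.pow_le_pow_right hQ (by omega)
  have h2 : Q ^ D' ≤ Q ^ (D + D') := Nat.pow_le_pow_right hQ (by omega)
  rw [add_mul]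
  exact add_le_add ((h Q hQ).trans (Nat.mul_le_mul_left _ h1))
    ((h' Q hQ).trans (Nat.mul_le_mul_left _ h2))

theorem PolyBounded.mul_self {F : ℕ → ℕ} (hF : PolyBounded F) : PolyBounded fun Q => Q * F Q := by
  obtain ⟨C, D, h⟩ := hF
  refine ⟨C, D + 1, fun Q hQ => (Nat.mul_le_mul_left _ (h Q hQ)).trans_eq ?_⟩
  ring

theorem Expr.polyBounded (e : Expr) : PolyBounded e.bound := by
  induction e with
  | const c => exact .const 1
  | var x => exact .const 1
  | get a e ih => exact ih.add (.const 7)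
  | add e f ihe ihf => exact (ihe.add ihf).add (.const 1)
  | sub e f ihe ihf => exact (ihe.add ihf).add (.const 1)
  | isz e ih => exact ih.add (.const 2)
  | sum x v e ih => exact ((PolyBounded.const 4).add (ih.add (.const 6)).mul_self).add (.const 3)

/-- The degree depends on the statement only, not on the input: this gives the constant exponent of
the final running time. -/
theorem Stmt.polyBounded (s : Stmt) : PolyBounded s.bound := by
  induction s with
  | skip => exact .const 0
  | assign x e => exact e.polyBounded.add (.const 1)
  | put a e f => exact ((e.polyBounded.add (.const 6)).add f.polyBounded).add (.const 1)
  | seq s s' ih ih' => exact ih.add ih'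
  | ite e s s' ih ih' =>
    exact (e.polyBounded.add (.const 1)).add ((ih'.add ih).add (.const 1))
  | loop x v s ih =>
    exact ((PolyBounded.const 2).add
      (((PolyBounded.const 5).add ih).add (.const 1)).mul_self).add (.const 2)

/-! ### From statements to machines -/

open RAM

attribute [local simp] Instr.exec

/-- The initial state of the structured language. -/
def initSt (I : List Bool × ℕ) : St where
  var x := if x = .L then I.1.length else if x = .p then I.2 else 0
  arr a i := if a = .inp ∧ I.1[i]? = some true then 1 else 0

/-- The code that copies the input to the place of the array `inp`. -/
def relocate : List Instr :=
  [.copy 30 0, .copy 31 0, .jumpZero 31 12, .const 32 1, .sub 31 31 32, .load 33 31, .add 34 31 31,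
    .add 34 34 34, .add 34 34 34, .add 34 34 30, .store 34 33, .jump 2]

/-- The memory while the last cells of the input have been copied, from number `j` on. -/
def relocMem (x : List Bool) (j a : ℕ) : ℕ :=
  if a < x.length then if x[a]? = some true then 1 else 0
  else if (a - x.length) % 8 = 0 ∧ j ≤ (a - x.length) / 8 ∧
    x[(a - x.length) / 8]? = some true then 1 else 0

theorem relocMem_length (x : List Bool) :
    relocMem x x.length = fun a => if x[a]? = some true then 1 else 0 := by
  funext a
  unfold relocMem
  split_ifs with h1 h2 h3 h4 h5 <;> try rfl
  · have := (List.getElem?_eq_some_iff.1 h3.2.2).1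
    omega
  · have := (List.getElem?_eq_some_iff.1 h5).1
    omega

/-- The target cell lies beyond the original input, so the letters still to be copied stay intact.
-/
theorem relocMem_update (x : List Bool) {j : ℕ} (hj : j < x.length) :
    Function.update (relocMem x (j + 1)) (x.length + 8 * j) (relocMem x (j + 1) j) =
      relocMem x j := by
  funext a
  by_cases ha : a = x.length + 8 * j
  · subst ha
    have h1 : relocMem x (j + 1) j = if x[j]? = some true then 1 else 0 := if_pos hj
    have h2 : relocMem x j (x.length + 8 * j) = if x[j]? = some true then 1 else 0 := by
      rw [relocMem, if_neg (by omega), Nat.add_sub_cancel_left]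
      simp
    rw [Function.update_self, h1, h2]
  · rw [Function.update_of_ne ha]
    unfold relocMem
    by_cases h : a < x.length
    · simp [h]
    · rw [if_neg h, if_neg h]
      congr 1
      refine propext ⟨fun h => ⟨h.1, by omega, h.2.2⟩, fun h => ⟨h.1, ?_, h.2.2⟩⟩
      have := h.1
      have := h.2.1
      omega

/-- The variables `L` and `p` have the register numbers 0 and 1, where the machine receives them,
and relocation uses only registers from 30 on. The time is 2 steps of preparation, 10 per letter and
one exit test. -/
theorem steps_relocate {P : Program} (hP : CodeAt P 0 relocate) (I : List Bool × ℕ) :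
    ∃ reg mem, (step P)^[2 + I.1.length * 10 + 1] (initial I) = ⟨12, reg, mem⟩ ∧
      Rep (initSt I) I.1.length reg mem := by
  have key : ∀ j ≤ I.1.length, ∃ reg, (step P)^[2 + j * 10] (initial I) =
      ⟨2, reg, relocMem I.1 (I.1.length - j)⟩ ∧ reg 30 = I.1.length ∧ reg 31 = I.1.length - j ∧
      ∀ r < 30, reg r = (initial I).reg r := by
    intro j
    induction j with
    | zero =>
      intro _
      have h := steps_of_isStraight (P := P) (c := initial I) (l := [.copy 30 0, .copy 31 0])
        ⟨hP.1, hP.2.1, trivial⟩ (by simp [isStraight])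
      rw [Nat.sub_zero, relocMem_length]
      refine ⟨_, h, ?_, ?_, ?_⟩
      · simp [initial]
      · simp [initial]
      · intro r hr
        simp [Function.update_apply, show r ≠ 31 by omega, show r ≠ 30 by omega]
    | succ j ih =>
      intro hj
      obtain ⟨reg, h1, h30, h31, hr⟩ := ih (by omega)
      have h2 := step_of_get (P := P) (reg := reg) (mem := relocMem I.1 (I.1.length - j)) hP.2.2.1
      simp only [Instr.exec, h31] at h2
      rw [if_neg (by omega)] at h2
      have h3 := steps_of_isStraight (P := P) (c := ⟨3, reg, relocMem I.1 (I.1.length - j)⟩)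
        (l := [.const 32 1, .sub 31 31 32, .load 33 31, .add 34 31 31, .add 34 34 34,
          .add 34 34 34, .add 34 34 30, .store 34 33])
        ⟨hP.2.2.2.1, hP.2.2.2.2.1, hP.2.2.2.2.2.1, hP.2.2.2.2.2.2.1, hP.2.2.2.2.2.2.2.1,
          hP.2.2.2.2.2.2.2.2.1, hP.2.2.2.2.2.2.2.2.2.1, hP.2.2.2.2.2.2.2.2.2.2.1, trivial⟩
        (by simp [isStraight])
      simp only [List.foldl, Instr.exec, List.length_cons, List.length_nil, Nat.reduceAdd] at h3
      have h4 := steps_trans (n := 1) (steps_trans (steps_trans h1 h2) h3)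
        (step_of_get hP.2.2.2.2.2.2.2.2.2.2.2.1)
      refine ⟨_, Eq.trans (congrArg (fun m => (step P)^[m] _) (by omega)) (h4.trans
        (Config.ext ?_ rfl ?_)), ?_, ?_, ?_⟩
      · rfl
      · have hj' : I.1.length - j = I.1.length - (j + 1) + 1 := by omega
        simp only [Instr.exec]
        rw [← relocMem_update I.1 (show I.1.length - (j + 1) < I.1.length by omega), ← hj']
        simp [Function.update_apply, h30, h31]
        congr 1
        omega
      · simp [Function.update_apply, h30]
      · simp [Function.update_apply, h31]; omega
      · intro r hr'
        simp [Function.update_apply, show r ≠ 31 by omega, show r ≠ 32 by omega,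
          show r ≠ 33 by omega, show r ≠ 34 by omega, hr r hr']
  obtain ⟨reg, h1, h30, h31, hr⟩ := key _ le_rfl
  have h2 := step_of_get (P := P) (reg := reg) (mem := relocMem I.1 (I.1.length - I.1.length))
    hP.2.2.1
  simp only [Instr.exec, h31, Nat.sub_self, if_true] at h2
  refine ⟨_, _, steps_trans (by rwa [Nat.sub_self] at h1) h2, ?_, h30, ?_⟩
  · intro x
    rw [hr _ x.reg_lt]
    simp only [initial, initSt]
    have hL : x.reg = 0 ↔ x = .L := ⟨fun h => Var.reg_inj (h.trans rfl), fun h => h ▸ rfl⟩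
    have hp : x.reg = 1 ↔ x = .p := ⟨fun h => Var.reg_inj (h.trans rfl), fun h => h ▸ rfl⟩
    simp only [hL, hp]
  · intro a i
    have ha := a.idx_lt
    have h0 : a.idx = 0 ↔ a = .inp := ⟨fun h => Arr.idx_inj (h.trans rfl), fun h => h ▸ rfl⟩
    simp only [initSt, relocMem]
    rw [if_neg (by omega)]
    by_cases hi : a = .inp
    · subst hi
      have : Arr.inp.idx = 0 := rfl
      simp only [this, true_and]
      rw [show (I.1.length + 8 * i + 0 - I.1.length) = 8 * i by omega]
      simp
    · have : a.idx ≠ 0 := fun h => hi (h0.1 h)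
      rw [if_neg (by omega), if_neg (by simp [hi])]

theorem step_iterate_of_halted {P : Program} {c : Config} (h : Halted P c) (n : ℕ) :
    (step P)^[n] c = c := by
  induction n with
  | zero => rfl
  | succ n ih =>
    rw [Function.iterate_succ_apply', ih]
    simp [step, List.getElem?_eq_none h]

theorem step_iterate_eq_of_le {P : Program} {c c' : Config} {m n : ℕ} (h : (step P)^[m] c = c')
    (hc : Halted P c') (hmn : m ≤ n) : (step P)^[n] c = c' := by
  obtain ⟨k, rfl⟩ := Nat.exists_eq_add_of_le hmn
  exact steps_trans h (step_iterate_of_halted hc k)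

/-- A problem that is decided by a statement within the time bound is fixed-parameter tractable. -/
theorem isFPT_of_stmt {A : ParameterizedProblem} (s : Stmt) {f : ℕ → ℕ} (hf : Computable f) (c : ℕ)
    (hcost : ∀ I, s.cost (initSt I) ≤ f I.2 * ParameterizedProblem.size I ^ c)
    (hrun : ∀ I, (s.run (initSt I)).var .res = 1 ↔ I ∈ A) : A.IsFPT := by
  set P : Program := relocate ++ (s.compile 31 12 ++ [.copy 0 Var.res.reg]) with hPdef
  have hP := codeAt_self [] P []
  rw [List.nil_append, List.append_nil, List.length_nil, hPdef, codeAt_append, codeAt_append,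
    ← hPdef, Stmt.length_compile] at hP
  obtain ⟨hP1, hP2, hP3⟩ := hP
  have hrel : relocate.length = 12 := rfl
  rw [hrel] at hP2 hP3
  have hlen : P.length = 12 + s.len + 1 := by simp [hPdef, hrel]; omega
  -- Relocation and the final copy cost 10|x| + 4 steps, at most 14 times the input size; this is
  -- absorbed by the summand 14 and one further power.
  refine ⟨fun p => f p + 14, c + 1, P, ?_, fun I => ?_⟩
  · exact (Primrec.nat_add.to_comp).comp hf (Computable.const 14)
  · obtain ⟨r1, m1, h1, hσ1⟩ := steps_relocate hP1 I
    obtain ⟨r2, m2, h2, hσ2, -⟩ := s.steps_compile le_rfl hP2 hσ1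
    have h3 := steps_trans (steps_trans h1 h2) (step_of_get hP3.1)
    set c' := (Instr.copy 0 Var.res.reg).exec ⟨0 + 12 + s.len, r2, m2⟩ with hc'
    have hhalt : Halted P c' := by
      simp [Halted, hc', hlen]
    have hres : c'.reg 0 = (s.run (initSt I)).var .res := by
      simp [hc', hσ2.var]
    have hsz : 1 ≤ ParameterizedProblem.size I := by simp [ParameterizedProblem.size]
    have hle : 2 + I.1.length * 10 + 1 + s.cost (initSt I) + 1 ≤
        (f I.2 + 14) * ParameterizedProblem.size I ^ (c + 1) := by
      have hS : I.1.length + 1 ≤ ParameterizedProblem.size I := by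
        simp only [ParameterizedProblem.size]; omega
      have hp : 1 ≤ ParameterizedProblem.size I ^ c := Nat.one_le_pow _ _ hsz
      have hp' : ParameterizedProblem.size I ≤ ParameterizedProblem.size I ^ (c + 1) := by
        rw [pow_succ]; exact Nat.le_mul_of_pos_left _ hp
      have hp'' : ParameterizedProblem.size I ^ c ≤ ParameterizedProblem.size I ^ (c + 1) :=
        Nat.pow_le_pow_right hsz (by omega)
      have h4 := (hcost I).trans (Nat.mul_le_mul_left _ hp'')
      rw [add_mul]
      omega
    refine ⟨?_, ?_⟩
    · rw [HaltsWithin, step_iterate_eq_of_le h3 hhalt hle]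
      exact hhalt
    · rw [← hrun, ← hres]
      refine ⟨fun ⟨t, ht, h⟩ => ?_, fun h => ⟨_, by rw [h3]; exact hhalt, by rw [h3]; exact h⟩⟩
      -- Halted configurations are fixed, so the two halting runs agree at the later of their two
      -- times.
      have h5 := step_iterate_eq_of_le h3 hhalt (le_max_left _ t)
      have h6 := step_iterate_eq_of_le rfl ht (le_max_right (2 + I.1.length * 10 + 1 +
        s.cost (initSt I) + 1) t)
      rw [← h5, h6]
      exact h

end Imp

/-! ### Distances and cluster deletion sets -/

namespace SimpleGraph

variable {V : Type*} {G : SimpleGraph V} {X : Finset V}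

/-- Cluster graphs are the graphs without induced path on three vertices: in the absence of such
paths, a walk is shortened to an edge by induction on its length. -/
theorem isClusterDeletionSet_iff : G.IsClusterDeletionSet X ↔
    ∀ a b c, a ∉ X → b ∉ X → c ∉ X → G.Adj a b → G.Adj b c → a ≠ c → G.Adj a c := by
  constructor
  · intro h a b c ha hb hc hab hbc hac
    have h1 : (G.induce {v : V | v ∉ X}).Adj ⟨a, ha⟩ ⟨b, hb⟩ := hab
    have h2 : (G.induce {v : V | v ∉ X}).Adj ⟨b, hb⟩ ⟨c, hc⟩ := hbc
    exact h ⟨a, ha⟩ ⟨c, hc⟩ (h1.reachable.trans h2.reachable) (by simpa using hac)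
  · rintro h u v ⟨q⟩ huv
    induction q with
    | nil => exact absurd rfl huv
    | @cons u w v hadj q ih =>
      by_cases hwv : w = v
      · exact hwv ▸ hadj
      · exact h u w v u.2 w.2 v.2 hadj (ih hwv) fun h => huv (Subtype.ext h)

theorem edist_le_one_iff {u v : V} : G.edist u v ≤ 1 ↔ u = v ∨ G.Adj u v := by
  constructor
  · intro h
    rcases h.lt_or_eq with h | h
    · exact .inl (edist_eq_zero_iff.1 (Order.lt_one_iff.1 h))
    · exact .inr (edist_eq_one_iff_adj.1 h)
  · rintro (rfl | h)
    · simp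
    · exact (edist_eq_one_iff_adj.2 h).le

/-- If `w` and `w'` have the same distances to a cluster deletion set, but `u` is closer to `w`, then
`u` and `w` lie in the same clique outside of the cluster deletion set. -/
theorem IsClusterDeletionSet.edist_le_one (hX : G.IsClusterDeletionSet X) {u w w' : V}
    (h : ∀ x ∈ X, G.edist w x = G.edist w' x) (hlt : G.edist u w < G.edist u w') :
    u ∉ X ∧ w ∉ X ∧ G.edist u w ≤ 1 := by
  classical
  obtain ⟨q, hq⟩ := (reachable_of_edist_ne_top hlt.ne_top).exists_walk_length_eq_edist
  -- If the shortest path met `X` in `x`, then replacing its part from `x` to `w` by a shortest path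
  -- from `x` to `w'` would give `d(u, w') ≤ d(u, w)`.
  have hq' : ∀ x ∈ q.support, x ∉ X := by
    intro x hx hxX
    refine absurd hlt (not_lt.2 ?_)
    calc G.edist u w' ≤ G.edist u x + G.edist x w' := G.edist_triangle
      _ = G.edist u x + G.edist x w := by rw [edist_comm (u := x), ← h x hxX, edist_comm (u := w)]
      _ ≤ (q.takeUntil x hx).length + (q.dropUntil x hx).length :=
        add_le_add (edist_le _) (edist_le _)
      _ = q.length := by
        rw [← Nat.cast_add, ← Walk.length_append, Walk.take_spec]
      _ = G.edist u w := hq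
  have hu := hq' u q.start_mem_support
  have hw := hq' w q.end_mem_support
  refine ⟨hu, hw, edist_le_one_iff.2 ?_⟩
  by_cases huw : u = w
  · exact .inl huw
  · exact .inr (hX ⟨u, hu⟩ ⟨w, hw⟩ ⟨q.induce {v : V | v ∉ X} hq'⟩ (by simpa using huw))

/-- If three consecutive vertices of a shortest path avoided `X`, the outer two would be equal or
adjacent and the path could be shortened. A path longer than 3|X| + 1 has |X| + 1 disjoint blocks of
three vertices, each meeting `X`, which is too many. -/
theorem IsClusterDeletionSet.edist_le (hX : G.IsClusterDeletionSet X) {u v : V}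
    (h : G.edist u v ≠ ⊤) : G.edist u v ≤ (3 * X.card + 1 : ℕ) := by
  obtain ⟨q, hq⟩ := (reachable_of_edist_ne_top h).exists_walk_length_eq_edist
  rw [← hq, Nat.cast_le]
  by_contra! hlen
  have hq1 : ∀ i, G.edist u (q.getVert i) ≤ i := fun i =>
    (SimpleGraph.edist_le (q.take i)).trans (by simp)
  have hq2 : ∀ i, G.edist (q.getVert i) v ≤ (q.length - i : ℕ) := fun i =>
    (SimpleGraph.edist_le (q.drop i)).trans (by simp)
  have hpath : q.IsPath := q.isPath_of_length_eq_dist (by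
    rw [dist, ← hq]; rfl)
  have key : ∀ t ∈ Finset.range (X.card + 1), ∃ i, 3 * t ≤ i ∧ i ≤ 3 * t + 2 ∧ q.getVert i ∈ X := by
    intro t ht
    rw [Finset.mem_range] at ht
    by_contra! hno
    have h1 := q.adj_getVert_succ (i := 3 * t) (by omega)
    have h2 := q.adj_getVert_succ (i := 3 * t + 1) (by omega)
    have h3 : G.edist (q.getVert (3 * t)) (q.getVert (3 * t + 2)) ≤ 1 := by
      refine edist_le_one_iff.2 ?_
      by_cases heq : q.getVert (3 * t) = q.getVert (3 * t + 2)
      · exact .inl heq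
      · exact .inr (isClusterDeletionSet_iff.1 hX _ _ _ (hno _ (by omega) (by omega))
          (hno _ (by omega) (by omega)) (hno _ (by omega) (by omega)) h1 h2 heq)
    have h4 : (q.length : ℕ∞) ≤ (3 * t + 1 + (q.length - (3 * t + 2)) : ℕ) := by
      rw [hq]
      calc G.edist u v ≤ G.edist u (q.getVert (3 * t + 2)) + G.edist (q.getVert (3 * t + 2)) v :=
            G.edist_triangle
        _ ≤ (G.edist u (q.getVert (3 * t)) +
              G.edist (q.getVert (3 * t)) (q.getVert (3 * t + 2))) +
              G.edist (q.getVert (3 * t + 2)) v := add_le_add_left G.edist_triangle _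
        _ ≤ ((3 * t : ℕ) + 1) + (q.length - (3 * t + 2) : ℕ) :=
            add_le_add (add_le_add (hq1 _) h3) (hq2 _)
        _ = _ := by push_cast; rfl
    rw [Nat.cast_le] at h4
    omega
  choose! f hf1 hf2 hf3 using key
  have := Finset.card_le_card_of_injOn (fun t => q.getVert (f t)) (s := Finset.range (X.card + 1))
    (t := X) hf3 (by
      intro a ha b hb hab
      have ha' := Finset.mem_range.1 (Finset.mem_coe.1 ha)
      have hb' := Finset.mem_range.1 (Finset.mem_coe.1 hb)
      have h1 := hf2 a ha
      have h2 := hf2 b hb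
      have h3 := hf1 a ha
      have h4 := hf1 b hb
      have := hpath.getVert_injOn (show f a ∈ {i | i ≤ q.length} from by
        simp only [Set.mem_ofPred_eq]; omega)
        (show f b ∈ {i | i ≤ q.length} from by simp only [Set.mem_ofPred_eq]; omega) hab
      omega)
  rw [Finset.card_range] at this
  omega

/-! ### Truncated distances and breadth-first search -/

/-- The distance, cut off at `c`. -/
noncomputable def cdist (G : SimpleGraph V) (c : ℕ) (u v : V) : ℕ := (min (G.edist u v) c).toNat

theorem coe_cdist (c : ℕ) (u v : V) : (G.cdist c u v : ℕ∞) = min (G.edist u v) c :=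
  ENat.natCast_toNat (ne_top_of_le_ne_top (ENat.natCast_ne_top c) (min_le_right _ _))

theorem cdist_le (c : ℕ) (u v : V) : G.cdist c u v ≤ c := by
  rw [← ENat.natCast_le_natCast, coe_cdist]
  exact min_le_right _ _

theorem cdist_comm (c : ℕ) (u v : V) : G.cdist c u v = G.cdist c v u := by
  rw [cdist, cdist, edist_comm]

theorem edist_eq_of_cdist_lt {c : ℕ} {u v : V} (h : G.cdist c u v < c) :
    G.edist u v = G.cdist c u v := by
  rw [← ENat.natCast_lt_natCast, coe_cdist] at h
  rw [coe_cdist, min_eq_left]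
  by_contra hc
  rw [min_eq_right (not_le.1 hc).le] at h
  exact lt_irrefl _ h

theorem le_edist_of_cdist_eq {c : ℕ} {u v : V} (h : G.cdist c u v = c) : (c : ℕ∞) ≤ G.edist u v := by
  rw [← ENat.natCast_inj, coe_cdist] at h
  exact min_eq_right_iff.1 h

/-- If one summand on the right has the maximal value `c`, nothing is to be shown; otherwise both
are true distances. -/
theorem cdist_triangle (c : ℕ) (u w v : V) :
    G.cdist c u v ≤ G.cdist c u w + G.cdist c w v := by
  rcases (cdist_le (G := G) c u w).lt_or_eq with h1 | h1
  · rcases (cdist_le (G := G) c w v).lt_or_eq with h2 | h2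
    · rw [← ENat.natCast_le_natCast, Nat.cast_add, ← edist_eq_of_cdist_lt h1, ← edist_eq_of_cdist_lt h2,
        coe_cdist]
      exact (min_le_left _ _).trans G.edist_triangle
    · have := cdist_le (G := G) c u v
      omega
  · have := cdist_le (G := G) c u v
    omega

theorem cdist_le_iff {c r : ℕ} (hr : r < c) {u v : V} : G.cdist c u v ≤ r ↔ G.edist u v ≤ r := by
  rw [← ENat.natCast_le_natCast, coe_cdist, min_le_iff, ENat.natCast_le_natCast]
  exact or_iff_left (by omega)

theorem cdist_eq_zero_iff {c : ℕ} (hc : 0 < c) {u v : V} : G.cdist c u v = 0 ↔ u = v := by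
  rw [← Nat.le_zero, cdist_le_iff hc]
  simp

open scoped Classical in
-- This allows a distance table to be built by counting: in each round of the breadth-first search,
-- add 1 for the pairs that have not been reached.
theorem cdist_succ (c : ℕ) (u v : V) :
    G.cdist (c + 1) u v = G.cdist c u v + if G.edist u v ≤ c then 0 else 1 := by
  rcases (cdist_le (G := G) (c + 1) u v).lt_or_eq with h | h
  · have h1 := edist_eq_of_cdist_lt h
    rw [if_pos (by rw [h1, ENat.natCast_le_natCast]; omega), ← ENat.natCast_inj, add_zero, coe_cdist c, h1,
      min_eq_left]
    rw [ENat.natCast_le_natCast]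
    omega
  · have h1 := le_edist_of_cdist_eq h
    have h2 : (c : ℕ∞) < G.edist u v := lt_of_lt_of_le (by norm_cast; omega) h1
    rw [if_neg (not_le.2 h2), h, Nat.add_right_cancel_iff, ← ENat.natCast_inj, coe_cdist,
      min_eq_right h2.le]

theorem edist_le_succ_iff {r : ℕ} {u v : V} :
    G.edist u v ≤ (r + 1 : ℕ) ↔ G.edist u v ≤ r ∨ ∃ w, G.edist u w ≤ r ∧ G.Adj w v := by
  constructor
  · intro h
    obtain ⟨q, hq⟩ := (reachable_of_edist_ne_top
      (ne_top_of_le_ne_top (ENat.natCast_ne_top _) h)).exists_walk_length_eq_edist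
    rw [← hq, ENat.natCast_le_natCast] at h
    by_cases hnil : q.Nil
    · left
      rw [← hq, Walk.length_eq_zero_iff.2 hnil]
      simp
    · right
      refine ⟨q.penultimate, (edist_le q.dropLast).trans ?_, q.adj_penultimate hnil⟩
      have : q.dropLast.length = q.length - 1 := by
        simp [Walk.dropLast]
      rw [this, ENat.natCast_le_natCast]
      omega
  · rintro (h | ⟨w, h, hadj⟩)
    · exact h.trans (by norm_cast; omega)
    · push_cast
      exact G.edist_triangle.trans (add_le_add h (edist_eq_one_iff_adj.2 hadj).le)

/-- Finite distances are at most 3|X| + 1 < `c`, so the cut-off value occurs only for disconnected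
pairs and truncation loses no information. -/
theorem IsClusterDeletionSet.edist_eq_top (hX : G.IsClusterDeletionSet X) {c : ℕ}
    (hc : 3 * X.card + 2 ≤ c) {u v : V} (h : G.cdist c u v = c) : G.edist u v = ⊤ := by
  by_contra htop
  have h1 := (le_edist_of_cdist_eq h).trans (hX.edist_le htop)
  rw [ENat.natCast_le_natCast] at h1
  omega

theorem IsClusterDeletionSet.edist_eq_of_cdist_eq (hX : G.IsClusterDeletionSet X) {c : ℕ}
    (hc : 3 * X.card + 2 ≤ c) {u v u' v' : V} (h : G.cdist c u v = G.cdist c u' v') :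
    G.edist u v = G.edist u' v' := by
  rcases (cdist_le (G := G) c u v).lt_or_eq with h1 | h1
  · rw [edist_eq_of_cdist_lt h1, edist_eq_of_cdist_lt (h ▸ h1), h]
  · rw [hX.edist_eq_top hc h1, hX.edist_eq_top hc (h ▸ h1)]

theorem edist_lt_of_cdist_lt {c : ℕ} {u v u' v' : V} (h : G.cdist c u v < G.cdist c u' v') :
    G.edist u v < G.edist u' v' := by
  by_contra! hle
  have : G.cdist c u' v' ≤ G.cdist c u v := by
    rw [← ENat.natCast_le_natCast, coe_cdist, coe_cdist]
    exact min_le_min_right _ hle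
  omega

theorem distToCluster_le (hX : G.IsClusterDeletionSet X) : G.distToCluster ≤ X.card :=
  Nat.sInf_le ⟨X, hX, rfl⟩

theorem exists_card_eq_distToCluster [Fintype V] (G : SimpleGraph V) :
    ∃ X : Finset V, G.IsClusterDeletionSet X ∧ X.card = G.distToCluster :=
  Nat.sInf_mem (s := {m : ℕ | ∃ X : Finset V, G.IsClusterDeletionSet X ∧ X.card = m})
    ⟨_, Finset.univ, isClusterDeletionSet_iff.2 fun a _ _ ha => absurd (Finset.mem_univ a) ha, rfl⟩

end SimpleGraph

/-! ### The branching algorithm on natural numbers -/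

namespace Branching

/-- The least `i < n` with `P i`, or `n` if there is none. -/
noncomputable def leastBelow (n : ℕ) (P : ℕ → Prop) : ℕ := sInf {i | i = n ∨ P i}

theorem leastBelow_le (n : ℕ) (P : ℕ → Prop) : leastBelow n P ≤ n := Nat.sInf_le (.inl rfl)

theorem leastBelow_mem (n : ℕ) (P : ℕ → Prop) : leastBelow n P = n ∨ P (leastBelow n P) :=
  Nat.sInf_mem (s := {i | i = n ∨ P i}) ⟨n, .inl rfl⟩

theorem not_of_lt_leastBelow {n : ℕ} {P : ℕ → Prop} {i : ℕ} (h : i < leastBelow n P) : ¬P i :=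
  fun hi => Nat.notMem_of_lt_sInf h (.inr hi)

theorem leastBelow_lt_iff {n : ℕ} {P : ℕ → Prop} : leastBelow n P < n ↔ ∃ i < n, P i := by
  constructor
  · intro h
    exact ⟨_, h, (leastBelow_mem n P).resolve_left h.ne⟩
  · rintro ⟨i, hi, h⟩
    exact (Nat.sInf_le (.inr h)).trans_lt hi

theorem leastBelow_spec {n : ℕ} {P : ℕ → Prop} (h : ∃ i < n, P i) : P (leastBelow n P) :=
  (leastBelow_mem n P).resolve_left (leastBelow_lt_iff.2 h).ne

/-- `a, b, c` is an induced path on three vertices that avoids the list `l`. -/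
def InducedPath (A : ℕ → ℕ → Prop) (l : List ℕ) (a b c : ℕ) : Prop :=
  a ∉ l ∧ b ∉ l ∧ c ∉ l ∧ A a b ∧ A b c ∧ ¬A a c ∧ a ≠ c

/-- No induced path on three vertices below `n` avoids the list `l`. -/
def IsDeletionList (A : ℕ → ℕ → Prop) (n : ℕ) (l : List ℕ) : Prop :=
  ¬∃ a < n, ∃ b < n, ∃ c < n, InducedPath A l a b c

open scoped Classical in
/-- Delete a vertex of the first induced path on three vertices, as told by `e`. -/
noncomputable def deleteStep (A : ℕ → ℕ → Prop) (n e : ℕ) (l : List ℕ) : List ℕ :=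
  let a := leastBelow n fun a => ∃ b < n, ∃ c < n, InducedPath A l a b c
  let b := leastBelow n fun b => ∃ c < n, InducedPath A l a b c
  let c := leastBelow n fun c => InducedPath A l a b c
  if a < n then l ++ [if e = 0 then a else if e = 1 then b else c] else l

/-- The deleted vertices after `r` rounds. -/
noncomputable def deleteRun (A : ℕ → ℕ → Prop) (n : ℕ) (g : ℕ → ℕ) (r : ℕ) : List ℕ :=
  Nat.rec [] (fun r l => deleteStep A n (g r) l) r

theorem deleteStep_of_isDeletionList {A : ℕ → ℕ → Prop} {n e : ℕ} {l : List ℕ}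
    (h : IsDeletionList A n l) : deleteStep A n e l = l :=
  if_neg (mt leastBelow_lt_iff.1 h)

/-- The path is determined by the list alone, as the lexicographically first one; the guess `e` only
selects which of its vertices to delete. -/
theorem exists_deleteStep_eq {A : ℕ → ℕ → Prop} {n : ℕ} {l : List ℕ}
    (h : ¬IsDeletionList A n l) : ∃ a < n, ∃ b < n, ∃ c < n, InducedPath A l a b c ∧
      ∀ e, deleteStep A n e l = l ++ [if e = 0 then a else if e = 1 then b else c] := by
  have h := not_not.1 h
  have h1 := leastBelow_spec h
  have h2 := leastBelow_spec h1
  exact ⟨_, leastBelow_lt_iff.2 h, _, leastBelow_lt_iff.2 h1, _, leastBelow_lt_iff.2 h2,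
    leastBelow_spec h2, fun e => if_pos (leastBelow_lt_iff.2 h)⟩

theorem deleteStep_spec (A : ℕ → ℕ → Prop) (n e : ℕ) (l : List ℕ) :
    deleteStep A n e l = l ∨ ∃ x < n, x ∉ l ∧ deleteStep A n e l = l ++ [x] := by
  by_cases h : IsDeletionList A n l
  · exact .inl (deleteStep_of_isDeletionList h)
  · obtain ⟨a, ha, b, hb, c, hc, hP, he⟩ := exists_deleteStep_eq h
    refine .inr ⟨_, ?_, ?_, he e⟩
    · split_ifs <;> assumption
    · split_ifs
      · exact hP.1
      · exact hP.2.1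
      · exact hP.2.2.1

theorem deleteRun_spec (A : ℕ → ℕ → Prop) (n : ℕ) (g : ℕ → ℕ) (r : ℕ) :
    (deleteRun A n g r).Nodup ∧ (deleteRun A n g r).length ≤ r ∧ ∀ x ∈ deleteRun A n g r, x < n := by
  induction r with
  | zero => simp [deleteRun]
  | succ r ih =>
    obtain ⟨h1, h2, h3⟩ := ih
    have hstep : deleteRun A n g (r + 1) = deleteStep A n (g r) (deleteRun A n g r) := rfl
    rcases deleteStep_spec A n (g r) (deleteRun A n g r) with h | ⟨x, hx, hxl, h⟩
    · rw [hstep, h]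
      exact ⟨h1, by omega, h3⟩
    · rw [hstep, h]
      refine ⟨?_, by simpa using h2, ?_⟩
      · rw [List.nodup_append]
        refine ⟨h1, List.nodup_singleton _, ?_⟩
        rintro a ha b hb rfl
        rw [List.mem_singleton] at hb
        exact hxl (hb ▸ ha)
      · intro y hy
        rcases List.mem_append.1 hy with hy | hy
        · exact h3 y hy
        · rw [List.mem_singleton] at hy
          exact hy ▸ hx

/-- Only the first `r` guesses are read. This permits the guesses of all phases to be stored in one
digit sequence. -/
theorem deleteRun_congr (A : ℕ → ℕ → Prop) (n : ℕ) {g g' : ℕ → ℕ} {r : ℕ}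
    (h : ∀ i < r, g i = g' i) : deleteRun A n g r = deleteRun A n g' r := by
  induction r with
  | zero => rfl
  | succ r ih =>
    change deleteStep A n (g r) (deleteRun A n g r) = deleteStep A n (g' r) (deleteRun A n g' r)
    rw [ih fun i hi => h i (by omega), h r (by omega)]

/-- An invariant that can be kept by a choice in every round can be kept by a sequence of choices. -/
theorem exists_choices {σ β : Type*} [Inhabited β] (step : β → σ → σ) (Inv : ℕ → σ → Prop)
    (p : β → Prop) {s₀ : σ} (h₀ : Inv 0 s₀)
    (hs : ∀ r s, Inv r s → ∃ b, p b ∧ Inv (r + 1) (step b s)) :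
    ∃ f : ℕ → β, (∀ r, p (f r)) ∧ ∀ r, Inv r (Nat.rec s₀ (fun r s => step (f r) s) r) := by
  -- The chosen value depends on round and state; following it along its own run leaves a sequence
  -- that depends on the round only.
  choose! c hc hc' using hs
  let S : ℕ → σ := fun r => Nat.rec s₀ (fun r s => step (c r s) s) r
  have hS : ∀ r, Inv r (S r) := by
    intro r
    induction r with
    | zero => exact h₀
    | succ r ih => exact hc' r _ ih
  refine ⟨fun r => c r (S r), fun r => hc r _ (hS r), fun r => ?_⟩
  have : (Nat.rec s₀ (fun r s => step (c r (S r)) s) r : σ) = S r := by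
    induction r with
    | zero => rfl
    | succ r ih => exact congrArg (step _) ih
  rw [this]
  exact hS r

/-- Some choices delete only vertices of a given hitting set of the induced paths. -/
theorem exists_deleteRun {A : ℕ → ℕ → Prop} {n : ℕ} (X : Finset ℕ) {d : ℕ} (hd : X.card ≤ d)
    (hX : ∀ a < n, ∀ b < n, ∀ c < n, InducedPath A [] a b c → a ∈ X ∨ b ∈ X ∨ c ∈ X) :
    ∃ f : ℕ → ℕ, (∀ r, f r ≤ 2) ∧ IsDeletionList A n (deleteRun A n f d) ∧
      (deleteRun A n f d).length ≤ X.card := by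
  -- Invariant: the list stays inside `X`, and it has either become a deletion list or grown in
  -- every round.
  obtain ⟨f, hf, h⟩ := exists_choices (deleteStep A n)
    (fun r l => (∀ x ∈ l, x ∈ X) ∧ (IsDeletionList A n l ∨ l.length = r)) (fun e => e ≤ 2)
    (s₀ := []) ⟨by simp, by simp⟩ (by
      rintro r l ⟨h1, h2⟩
      by_cases hl : IsDeletionList A n l
      · refine ⟨0, by omega, ?_⟩
        rw [deleteStep_of_isDeletionList hl]
        exact ⟨h1, .inl hl⟩
      · obtain ⟨a, ha, b, hb, c, hc, hP, he⟩ := exists_deleteStep_eq hl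
        have : ∃ e ≤ 2, (if e = 0 then a else if e = 1 then b else c) ∈ X := by
          rcases hX a ha b hb c hc ⟨by simp, by simp, by simp, hP.2.2.2⟩ with h | h | h
          · exact ⟨0, by omega, by simpa using h⟩
          · exact ⟨1, by omega, by simpa using h⟩
          · exact ⟨2, by omega, by simpa using h⟩
        obtain ⟨e, he2, heX⟩ := this
        refine ⟨e, he2, ?_⟩
        rw [he]
        refine ⟨fun x hx => ?_, .inr (by simp [h2.resolve_left hl])⟩
        rcases List.mem_append.1 hx with hx | hx
        · exact h1 x hx
        · rw [List.mem_singleton] at hx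
          exact hx ▸ heX)
  refine ⟨f, hf, ?_⟩
  obtain ⟨h1, h2⟩ := h d
  change (∀ x ∈ deleteRun A n f d, x ∈ X) at h1
  change IsDeletionList A n (deleteRun A n f d) ∨ (deleteRun A n f d).length = d at h2
  have hnd := (deleteRun_spec A n f d).1
  have hsub : (deleteRun A n f d).toFinset ⊆ X := fun x hx => h1 x (List.mem_toFinset.1 hx)
  have hcard := Finset.card_le_card hsub
  rw [List.toFinset_card_of_nodup hnd] at hcard
  refine ⟨h2.elim id fun h2 => ?_, hcard⟩
  -- A list that grew in all `d ≥ |X|` rounds without leaving `X` exhausts `X`, and `X` hits all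
  -- induced paths.
  have heq := Finset.eq_of_subset_of_card_le hsub
    (by rw [List.toFinset_card_of_nodup hnd]; omega)
  rintro ⟨a, ha, b, hb, c, hc, hP⟩
  have hmem : ∀ x, x ∈ X → x ∈ deleteRun A n f d := fun x hx => by
    rwa [← heq, List.mem_toFinset] at hx
  rcases hX a ha b hb c hc ⟨by simp, by simp, by simp, hP.2.2.2⟩ with h | h | h
  · exact hP.1 (hmem a h)
  · exact hP.2.1 (hmem b h)
  · exact hP.2.2.1 (hmem c h)

/-! ### Refinement of guessed monitors -/

/-- The data for the search for a monitoring set: vertices below `n`, `k` monitors, distances `D` cut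
off at `cap`, terminal pairs `T`, deleted vertices `l`, and the guessed distances `τ i j` of the
`i`-th monitor to the `j`-th deleted vertex. -/
structure Data where
  n : ℕ
  k : ℕ
  cap : ℕ
  D : ℕ → ℕ → ℕ
  T : ℕ → ℕ → Prop
  l : List ℕ
  τ : ℕ → ℕ → ℕ

namespace Data

/-- The vertex `w` monitors the pair `u, v`. -/
def Mon (S : Data) (u w v : ℕ) : Prop := S.D u v < S.cap ∧ S.D u w + S.D w v = S.D u v

/-- The vertex `w` is a candidate for the `i`-th monitor: it has the guessed distances to the deleted
vertices, and its distance to `q.2 i` is at most `1` or `0` if `q.1 i` is `1` or `2`. -/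
def Cand (S : Data) (q : (ℕ → ℕ) × (ℕ → ℕ)) (i w : ℕ) : Prop :=
  (∀ j < S.l.length, S.D w (S.l.getD j 0) = S.τ i j) ∧ (q.1 i = 0 ∨ S.D (q.2 i) w + q.1 i ≤ 2)

/-- The terminal pair `u, v` is not safely monitored. -/
def Bad (S : Data) (q : (ℕ → ℕ) × (ℕ → ℕ)) (u v : ℕ) : Prop :=
  S.T u v ∧ ∀ i < S.k, ¬((∃ w < S.n, S.Cand q i w) ∧ ∀ w < S.n, S.Cand q i w → S.Mon u w v)

/-- All terminal pairs are safely monitored. -/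
def Good (S : Data) (q : (ℕ → ℕ) × (ℕ → ℕ)) : Prop := ¬∃ u < S.n, ∃ v < S.n, S.Bad q u v

open scoped Classical in
/-- Bind the `e.1`-th monitor to an end of the first bad pair. -/
noncomputable def refineStep (S : Data) (e : ℕ × ℕ) (q : (ℕ → ℕ) × (ℕ → ℕ)) :
    (ℕ → ℕ) × (ℕ → ℕ) :=
  let u := leastBelow S.n fun u => ∃ v < S.n, S.Bad q u v
  let v := leastBelow S.n fun v => S.Bad q u v
  if u < S.n then
    (Function.update q.1 e.1 (q.1 e.1 + 1), Function.update q.2 e.1 (if e.2 = 0 then u else v))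
  else q

/-- The bindings of the monitors after `r` rounds. -/
noncomputable def refineRun (S : Data) (g : ℕ → ℕ × ℕ) (r : ℕ) : (ℕ → ℕ) × (ℕ → ℕ) :=
  Nat.rec (fun _ => 0, fun _ => 0) (fun r q => S.refineStep (g r) q) r

theorem refineRun_congr (S : Data) {g g' : ℕ → ℕ × ℕ} {r : ℕ} (h : ∀ i < r, g i = g' i) :
    S.refineRun g r = S.refineRun g' r := by
  induction r with
  | zero => rfl
  | succ r ih =>
    change S.refineStep (g r) (S.refineRun g r) = S.refineStep (g' r) (S.refineRun g' r)
    rw [ih fun i hi => h i (by omega), h r (by omega)]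

theorem refineStep_of_good {S : Data} {q : (ℕ → ℕ) × (ℕ → ℕ)} (h : S.Good q) (e : ℕ × ℕ) :
    S.refineStep e q = q :=
  if_neg (mt leastBelow_lt_iff.1 h)

theorem exists_refineStep_eq {S : Data} {q : (ℕ → ℕ) × (ℕ → ℕ)} (h : ¬S.Good q) :
    ∃ u < S.n, ∃ v < S.n, S.Bad q u v ∧ ∀ e : ℕ × ℕ, S.refineStep e q =
      (Function.update q.1 e.1 (q.1 e.1 + 1),
        Function.update q.2 e.1 (if e.2 = 0 then u else v)) := by
  have h := not_not.1 h
  have h1 := leastBelow_spec h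
  exact ⟨_, leastBelow_lt_iff.2 h, _, leastBelow_lt_iff.2 h1, leastBelow_spec h1,
    fun e => if_pos (leastBelow_lt_iff.2 h)⟩

theorem cand_congr {S : Data} {q q' : (ℕ → ℕ) × (ℕ → ℕ)} {i : ℕ} (h1 : q.1 i = q'.1 i)
    (h2 : q.2 i = q'.2 i) : S.Cand q i = S.Cand q' i := by
  funext w
  rw [Cand, Cand, h1, h2]

theorem bad_congr {S : Data} {q q' : (ℕ → ℕ) × (ℕ → ℕ)} (h1 : ∀ i < S.k, q.1 i = q'.1 i)
    (h2 : ∀ i < S.k, q.2 i = q'.2 i) : S.Bad q = S.Bad q' := by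
  funext u v
  refine propext (and_congr_right fun _ => forall₂_congr fun i hi => ?_)
  rw [cand_congr (h1 i hi) (h2 i hi)]

/-- The properties of distances in a graph with cluster deletion set `l`. -/
structure Metric (S : Data) : Prop where
  zero : ∀ u < S.n, ∀ v < S.n, (S.D u v = 0 ↔ u = v)
  comm : ∀ u < S.n, ∀ v < S.n, S.D u v = S.D v u
  triangle : ∀ u < S.n, ∀ w < S.n, ∀ v < S.n, S.D u v ≤ S.D u w + S.D w v
  closer : ∀ u < S.n, ∀ w < S.n, ∀ w' < S.n, (∀ x ∈ S.l, S.D w x = S.D w' x) →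
    S.D u w < S.D u w' → u ∉ S.l ∧ w ∉ S.l ∧ S.D u w ≤ 1
  clique : ∀ a < S.n, ∀ b < S.n, ∀ c < S.n, a ∉ S.l → b ∉ S.l → c ∉ S.l → S.D a b ≤ 1 →
    S.D b c ≤ 1 → S.D a c ≤ 1

/-- The bindings are compatible with the solution `s`. -/
def Compatible (S : Data) (s : ℕ → ℕ) (q : (ℕ → ℕ) × (ℕ → ℕ)) : Prop :=
  ∀ i < S.k, q.1 i ≤ 2 ∧
    (q.1 i = 0 ∨ q.2 i < S.n ∧ q.2 i ∉ S.l ∧ S.D (q.2 i) (s i) + q.1 i ≤ 2)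

/-- Both `s i` and `w` have the guessed distances, so `u` and `s i` share a clique outside the
deleted vertices, which justifies a first binding to `u`. Also `w` is not deleted, as otherwise
equal distances to `w` itself would force `s i = w`. If the monitor is already bound once, its
earlier centre puts `s i`, `w` and hence `u` into one clique, so `D u (s i) < D u w ≤ 1` gives `s i
= u`. Two earlier bindings would force `s i = w`. -/
theorem exists_refinement_of_closer {S : Data} (hS : S.Metric) {s : ℕ → ℕ}
    {q : (ℕ → ℕ) × (ℕ → ℕ)} (hq : S.Compatible s q) {i : ℕ} (hi : i < S.k) (hsi : s i < S.n)
    (hτ : ∀ j < S.l.length, S.D (s i) (S.l.getD j 0) = S.τ i j) {u w : ℕ} (hu : u < S.n)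
    (hw : w < S.n) (hcand : S.Cand q i w) (hlt : S.D u (s i) < S.D u w) :
    q.1 i + 1 ≤ 2 ∧ u ∉ S.l ∧ S.D u (s i) + (q.1 i + 1) ≤ 2 := by
  have htype : ∀ x ∈ S.l, S.D (s i) x = S.D w x := by
    intro x hx
    obtain ⟨j, hj, rfl⟩ := List.mem_iff_getElem.1 hx
    have h1 := hτ j hj
    have h2 := hcand.1 j hj
    rw [List.getD_eq_getElem _ _ hj] at h1 h2
    rw [h1, h2]
  obtain ⟨h1, h2, h3⟩ := hS.closer u hu _ hsi w hw htype hlt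
  have hne : s i ≠ w := by
    intro h
    rw [h] at hlt
    exact lt_irrefl _ hlt
  have hwl : w ∉ S.l := fun hwl => hne ((hS.zero _ hsi _ hw).1 (by
    rw [htype w hwl, (hS.zero w hw w hw).2 rfl]))
  obtain ⟨h4, h5⟩ := hq i hi
  rcases h5 with h5 | ⟨h5, h6, h7⟩
  · rw [h5]
    exact ⟨by omega, h1, by omega⟩
  · have h8 := hcand.2
    have h9 := (hS.zero _ h5 _ hsi).1
    have h10 := (hS.zero _ h5 _ hw).1
    by_cases hk0 : q.1 i = 0
    · rw [hk0]
      exact ⟨by omega, h1, by omega⟩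
    by_cases hk : q.1 i = 2
    · exact absurd ((h9 (by omega)).symm.trans (h10 (by omega))) hne
    · have h11 : S.D (s i) w ≤ 1 := hS.clique _ hsi _ h5 _ hw h2 h6 hwl
        (by rw [hS.comm _ hsi _ h5]; omega) (by omega)
      have h12 : S.D u w ≤ 1 := hS.clique _ hu _ hsi _ hw h1 h2 hwl h3 h11
      exact ⟨by omega, h1, by omega⟩

/-- The true monitor `s i` is itself a candidate, so a bad pair has another candidate `w` that
fails. If `w` were no farther than `s i` from both ends, the triangle inequality would make `w` a
monitor; so `s i` is strictly closer to one end, to which it can be bound. -/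
theorem exists_refinement {S : Data} (hS : S.Metric) {s : ℕ → ℕ} (hs : ∀ i < S.k, s i < S.n)
    (hτ : ∀ i < S.k, ∀ j < S.l.length, S.D (s i) (S.l.getD j 0) = S.τ i j)
    {q : (ℕ → ℕ) × (ℕ → ℕ)} (hq : S.Compatible s q) {u v : ℕ} (hu : u < S.n) (hv : v < S.n)
    (hsol : ∃ i < S.k, S.Mon u (s i) v) (hbad : S.Bad q u v) :
    ∃ i < S.k, ∃ e ≤ 1, S.Compatible s (Function.update q.1 i (q.1 i + 1),
      Function.update q.2 i (if e = 0 then u else v)) := by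
  obtain ⟨i, hi, hmon⟩ := hsol
  have hcand : S.Cand q i (s i) := by
    refine ⟨hτ i hi, ?_⟩
    rcases (hq i hi).2 with h | h
    · exact .inl h
    · exact .inr h.2.2
  obtain ⟨w, hw, hcw, hmw⟩ : ∃ w < S.n, S.Cand q i w ∧ ¬S.Mon u w v := by
    by_contra! hno
    exact hbad.2 i hi ⟨⟨_, hs i hi, hcand⟩, hno⟩
  have hupdate : ∀ e ≤ 1, (q.1 i + 1 ≤ 2 ∧ (if e = 0 then u else v) ∉ S.l ∧
      S.D (if e = 0 then u else v) (s i) + (q.1 i + 1) ≤ 2) →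
      S.Compatible s (Function.update q.1 i (q.1 i + 1),
        Function.update q.2 i (if e = 0 then u else v)) := by
    intro e _ h i' hi'
    by_cases hii : i' = i
    · subst hii
      simp only [Function.update_self]
      exact ⟨h.1, .inr ⟨by split_ifs <;> assumption, h.2⟩⟩
    · simp only [Function.update_of_ne hii]
      exact hq i' hi'
  have hsi := hs i hi
  have h1 := hS.triangle u hu w hw v hv
  have h2 : S.D u w + S.D w v ≠ S.D u v := fun h => hmw ⟨hmon.1, h⟩
  have h3 := hmon.2
  have h4 := hS.comm w hw v hv
  have h5 := hS.comm _ hsi v hv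
  rcases lt_or_ge (S.D u (s i)) (S.D u w) with hlt | hge
  · exact ⟨i, hi, 0, by omega, hupdate 0 (by omega)
      (exists_refinement_of_closer hS hq hi hsi (hτ i hi) hu hw hcw hlt)⟩
  · exact ⟨i, hi, 1, le_rfl, hupdate 1 le_rfl
      (exists_refinement_of_closer hS hq hi hsi (hτ i hi) hv hw hcw
        (show S.D v (s i) < S.D v w by omega))⟩

/-- If there is a solution with the guessed distances, then some choices make all pairs safe. -/
theorem exists_refineRun {S : Data} (hS : S.Metric) {s : ℕ → ℕ} (hs : ∀ i < S.k, s i < S.n)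
    (hτ : ∀ i < S.k, ∀ j < S.l.length, S.D (s i) (S.l.getD j 0) = S.τ i j)
    (hsol : ∀ u < S.n, ∀ v < S.n, S.T u v → ∃ i < S.k, S.Mon u (s i) v) {R : ℕ}
    (hR : 2 * S.k ≤ R) :
    ∃ f : ℕ → ℕ × ℕ, (∀ r, (f r).1 ≤ S.k ∧ (f r).2 ≤ 1) ∧ S.Good (S.refineRun f R) := by
  -- The total number of bindings serves as a potential: each round either starts with all pairs
  -- safe or raises it by 1.
  obtain ⟨f, hf, h⟩ := exists_choices S.refineStep
    (fun r q => S.Compatible s q ∧ (S.Good q ∨ ∑ i ∈ Finset.range S.k, q.1 i = r))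
    (fun e => e.1 ≤ S.k ∧ e.2 ≤ 1) (s₀ := (fun _ => 0, fun _ => 0))
    ⟨fun i _ => by simp, .inr (by simp)⟩ (by
      rintro r q ⟨h1, h2⟩
      by_cases hg : S.Good q
      · refine ⟨(0, 0), by simp, ?_⟩
        rw [refineStep_of_good hg]
        exact ⟨h1, .inl hg⟩
      · obtain ⟨u, hu, v, hv, hb, he⟩ := exists_refineStep_eq hg
        obtain ⟨i, hi, e, he1, hc⟩ := exists_refinement hS hs hτ h1 hu hv (hsol u hu v hv hb.1) hb
        refine ⟨(i, e), ⟨hi.le, he1⟩, ?_⟩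
        rw [he]
        refine ⟨hc, .inr ?_⟩
        rw [← h2.resolve_left hg, Finset.sum_update_of_mem (Finset.mem_range.2 hi),
          Finset.sum_eq_add_sum_sdiff_singleton_of_mem (Finset.mem_range.2 hi) q.1]
        dsimp only
        omega)
  refine ⟨f, hf, ?_⟩
  obtain ⟨h1, h2⟩ := h R
  change S.Compatible s (S.refineRun f R) at h1
  refine h2.elim id fun h2 => ?_
  change ∑ i ∈ Finset.range S.k, (S.refineRun f R).1 i = R at h2
  by_contra hg
  obtain ⟨u, hu, v, hv, hb, -⟩ := exists_refineStep_eq hg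
  obtain ⟨i, hi, e, he1, hc⟩ := exists_refinement hS hs hτ h1 hu hv (hsol u hu v hv hb.1) hb
  have h3 := (hc i hi).1
  simp only [Function.update_self] at h3
  -- A further refinement would need a monitor with fewer than two bindings, so the total would be
  -- below `2 * k ≤ R`.
  have h4 : ∑ j ∈ Finset.range S.k, (S.refineRun f R).1 j < ∑ j ∈ Finset.range S.k, 2 :=
    Finset.sum_lt_sum (fun j hj => (h1 j (Finset.mem_range.1 hj)).1)
      ⟨i, Finset.mem_range.2 hi, by omega⟩
  simp only [Finset.sum_const, Finset.card_range, smul_eq_mul] at h4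
  omega

end Data

end Branching

/-! ### Correctness of the branching algorithm -/

namespace TMSInstance

open Branching

variable (I : TMSInstance)

/-- Adjacency on natural numbers. -/
def AdjNat (u v : ℕ) : Prop := ∃ (hu : u < I.n) (hv : v < I.n), I.G.Adj ⟨u, hu⟩ ⟨v, hv⟩

/-- The terminal pairs as a relation on natural numbers. -/
def PairNat (u v : ℕ) : Prop := ∃ (hu : u < I.n) (hv : v < I.n), s(⟨u, hu⟩, ⟨v, hv⟩) ∈ I.T

open scoped Classical in
/-- The distance, cut off at `c`, on natural numbers. -/
noncomputable def distNat (c u v : ℕ) : ℕ :=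
  if h : u < I.n ∧ v < I.n then I.G.cdist c ⟨u, h.1⟩ ⟨v, h.2⟩ else 0

/-- The vertices on a list of natural numbers. -/
def listSet (l : List ℕ) : Finset (Fin I.n) := Finset.univ.filter fun v => (v : ℕ) ∈ l

variable {I}

theorem distNat_eq (c : ℕ) {u v : ℕ} (hu : u < I.n) (hv : v < I.n) :
    I.distNat c u v = I.G.cdist c ⟨u, hu⟩ ⟨v, hv⟩ := dif_pos ⟨hu, hv⟩

theorem distNat_le (c u v : ℕ) : I.distNat c u v ≤ c := by
  rw [distNat]
  split_ifs
  · exact SimpleGraph.cdist_le _ _ _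
  · exact Nat.zero_le _

theorem mem_listSet {l : List ℕ} {v : Fin I.n} : v ∈ I.listSet l ↔ (v : ℕ) ∈ l := by
  simp [listSet]

theorem card_listSet_le (l : List ℕ) : (I.listSet l).card ≤ l.length := by
  rw [← Finset.card_map Fin.valEmbedding]
  refine (Finset.card_le_card fun x hx => ?_).trans (List.toFinset_card_le l)
  obtain ⟨v, hv, rfl⟩ := Finset.mem_map.1 hx
  exact List.mem_toFinset.2 (mem_listSet.1 hv)

theorem isDeletionList_iff {l : List ℕ} :
    IsDeletionList I.AdjNat I.n l ↔ I.G.IsClusterDeletionSet (I.listSet l) := by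
  rw [SimpleGraph.isClusterDeletionSet_iff]
  constructor
  · intro h a b c ha hb hc hab hbc hac
    by_contra hadj
    rw [mem_listSet] at ha hb hc
    exact h ⟨a, a.2, b, b.2, c, c.2, ha, hb, hc, ⟨a.2, b.2, hab⟩, ⟨b.2, c.2, hbc⟩,
      fun ⟨_, _, h⟩ => hadj h, fun h => hac (Fin.ext h)⟩
  · rintro h ⟨a, ha, b, hb, c, hc, hal, hbl, hcl, ⟨_, _, hab⟩, ⟨_, _, hbc⟩, hadj, hac⟩
    exact hadj ⟨ha, hc, h _ _ _ (mt mem_listSet.1 hal) (mt mem_listSet.1 hbl)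
      (mt mem_listSet.1 hcl) hab hbc fun h => hac (congrArg Fin.val h)⟩

theorem exists_deleteRun_of_isClusterDeletionSet {X : Finset (Fin I.n)}
    (hX : I.G.IsClusterDeletionSet X) {d : ℕ} (hd : X.card ≤ d) :
    ∃ f : ℕ → ℕ, (∀ r, f r ≤ 2) ∧ IsDeletionList I.AdjNat I.n (deleteRun I.AdjNat I.n f d) ∧
      (deleteRun I.AdjNat I.n f d).length ≤ X.card := by
  rw [← Finset.card_map Fin.valEmbedding] at hd ⊢
  refine exists_deleteRun _ hd ?_
  rintro a ha b hb c hc ⟨-, -, -, ⟨_, _, hab⟩, ⟨_, _, hbc⟩, hadj, hac⟩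
  by_contra! hno
  have hmem : ∀ x (hx : x < I.n), x ∉ X.map Fin.valEmbedding → (⟨x, hx⟩ : Fin I.n) ∉ X :=
    fun x hx h h' => h (Finset.mem_map.2 ⟨_, h', rfl⟩)
  exact hadj ⟨ha, hc, SimpleGraph.isClusterDeletionSet_iff.1 hX _ _ _ (hmem a ha hno.1)
    (hmem b hb hno.2.1) (hmem c hc hno.2.2) hab hbc fun h => hac (congrArg Fin.val h)⟩

variable (I)

/-- The data for the search, with guessed digits `g` and parameter `p`. -/
noncomputable def data (p : ℕ) (l : List ℕ) (g : ℕ → ℕ) : Data where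
  n := I.n
  k := I.k
  cap := 3 * p + 3
  D := I.distNat (3 * p + 3)
  T := I.PairNat
  l := l
  -- Layout of the digits: p for the deletions, p² for the distances (row `i`, column `j`), 2p for
  -- the monitors to be bound, and 2p for the ends to which they are bound.
  τ i j := if i < p ∧ j < p then g (p + p * i + j) else 0

/-- The choices for the refinement rounds among the digits. -/
def choice (p : ℕ) (g : ℕ → ℕ) (r : ℕ) : ℕ × ℕ := (g (p + p * p + r), g (3 * p + p * p + r))

/-- The deleted vertices for the digits `g`. -/
noncomputable def deleted (p : ℕ) (g : ℕ → ℕ) : List ℕ := deleteRun I.AdjNat I.n g (p - I.k)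

/-- The digits lead to a cluster deletion set and a monitoring set. -/
def Succeeds (p : ℕ) (g : ℕ → ℕ) : Prop :=
  IsDeletionList I.AdjNat I.n (I.deleted p g) ∧
    (I.data p (I.deleted p g) g).Good ((I.data p (I.deleted p g) g).refineRun (choice p g) (2 * p))

/-- The digits lead to a cluster deletion set that is too small. -/
def SucceedsEarly (p : ℕ) (g : ℕ → ℕ) : Prop :=
  IsDeletionList I.AdjNat I.n (I.deleted p g) ∧ (I.deleted p g).length < p - I.k

/-- The vectors of digits that are tried. -/
def IsDigits (p : ℕ) (g : ℕ → ℕ) : Prop :=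
  (∀ j, g j < 3 * p + 4) ∧ ∀ j, p * p + 5 * p ≤ j → g j = 0

variable {I}

/-! ### Truncated graph distances as search data -/

/-- At most `p` deleted vertices keep all finite distances below the cap 3p + 3. So equal truncated
distances are equal true distances, as the comparison of distance vectors requires. -/
theorem data_metric {p : ℕ} {l : List ℕ} (g : ℕ → ℕ)
    (hlp : l.length ≤ p) (hdel : IsDeletionList I.AdjNat I.n l) : (I.data p l g).Metric := by
  have hX := isDeletionList_iff.1 hdel
  have hcap : 3 * (I.listSet l).card + 2 ≤ 3 * p + 3 := by
    have := I.card_listSet_le l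
    omega
  have hadj := SimpleGraph.isClusterDeletionSet_iff.1 hX
  constructor
  · intro u hu v hv
    change I.distNat _ u v = 0 ↔ _
    rw [distNat_eq _ hu hv, SimpleGraph.cdist_eq_zero_iff (by omega)]
    exact ⟨fun h => congrArg Fin.val h, fun h => Fin.ext h⟩
  · intro u hu v hv
    change I.distNat _ u v = I.distNat _ v u
    rw [distNat_eq _ hu hv, distNat_eq _ hv hu, SimpleGraph.cdist_comm]
  · intro u hu w hw v hv
    change I.distNat _ u v ≤ I.distNat _ u w + I.distNat _ w v
    rw [distNat_eq _ hu hv, distNat_eq _ hu hw, distNat_eq _ hw hv]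
    exact SimpleGraph.cdist_triangle _ _ _ _
  · intro u hu w hw w' hw' htype hlt
    change I.distNat _ u w < I.distNat _ u w' at hlt
    change u ∉ l ∧ w ∉ l ∧ I.distNat _ u w ≤ 1
    rw [distNat_eq _ hu hw, distNat_eq _ hu hw'] at hlt
    rw [distNat_eq _ hu hw]
    have htype' : ∀ x ∈ I.listSet l, I.G.edist ⟨w, hw⟩ x = I.G.edist ⟨w', hw'⟩ x := by
      intro x hx
      have := htype x (mem_listSet.1 hx)
      change I.distNat _ w x = I.distNat _ w' x at this
      rw [distNat_eq _ hw x.2, distNat_eq _ hw' x.2] at this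
      exact hX.edist_eq_of_cdist_eq hcap this
    obtain ⟨h1, h2, h3⟩ := hX.edist_le_one htype' (SimpleGraph.edist_lt_of_cdist_lt hlt)
    refine ⟨fun h => h1 (mem_listSet.2 h), fun h => h2 (mem_listSet.2 h), ?_⟩
    exact (SimpleGraph.cdist_le_iff (show 1 < 3 * p + 3 by omega)).2 (by exact_mod_cast h3)
  · intro a ha b hb c hc hal hbl hcl hab hbc
    change I.distNat _ a b ≤ 1 at hab
    change I.distNat _ b c ≤ 1 at hbc
    change I.distNat _ a c ≤ 1
    rw [distNat_eq _ ha hb, SimpleGraph.cdist_le_iff (by omega), Nat.cast_one,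
      SimpleGraph.edist_le_one_iff] at hab
    rw [distNat_eq _ hb hc, SimpleGraph.cdist_le_iff (by omega), Nat.cast_one,
      SimpleGraph.edist_le_one_iff] at hbc
    rw [distNat_eq _ ha hc, SimpleGraph.cdist_le_iff (by omega), Nat.cast_one,
      SimpleGraph.edist_le_one_iff]
    rcases hab with hab | hab
    · rwa [hab]
    rcases hbc with hbc | hbc
    · rw [← hbc]
      exact .inr hab
    · by_cases hac : (⟨a, ha⟩ : Fin I.n) = ⟨c, hc⟩
      · exact .inl hac
      · exact .inr (hadj _ _ _ (mt mem_listSet.1 hal) (mt mem_listSet.1 hbl) (mt mem_listSet.1 hcl)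
          hab hbc hac)

/-- The sum stays below the cap, so all three truncated distances are exact. No assumption on the
guesses or the deleted vertices enters here. -/
theorem edist_add_of_mon {p : ℕ} {l : List ℕ} {g : ℕ → ℕ} {u w v : Fin I.n}
    (h : (I.data p l g).Mon u w v) :
    I.G.edist u v ≠ ⊤ ∧ I.G.edist u w + I.G.edist w v = I.G.edist u v := by
  obtain ⟨h1, h2⟩ := h
  change I.distNat (3 * p + 3) u v < 3 * p + 3 at h1
  change I.distNat (3 * p + 3) u w + I.distNat (3 * p + 3) w v = I.distNat (3 * p + 3) u v at h2
  rw [distNat_eq _ u.2 v.2] at h1 h2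
  rw [distNat_eq _ u.2 w.2, distNat_eq _ w.2 v.2] at h2
  have e1 := SimpleGraph.edist_eq_of_cdist_lt h1
  have e2 := SimpleGraph.edist_eq_of_cdist_lt (show I.G.cdist (3 * p + 3) u w < 3 * p + 3 from
    (Nat.le_add_right _ _).trans_lt (h2.trans_lt h1))
  have e3 := SimpleGraph.edist_eq_of_cdist_lt (show I.G.cdist (3 * p + 3) w v < 3 * p + 3 from
    (Nat.le_add_left _ _).trans_lt (h2.trans_lt h1))
  refine ⟨by rw [e1]; exact ENat.natCast_ne_top _, ?_⟩
  rw [e1, e2, e3, ← Nat.cast_add]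
  exact congrArg _ h2

/-- Unlike the converse, this needs a deletion list of length at most `p`: only then are all finite
distances below the cap. -/
theorem mon_of_edist_add {p : ℕ} {l : List ℕ} (g : ℕ → ℕ) (hlp : l.length ≤ p)
    (hdel : IsDeletionList I.AdjNat I.n l) {u w v : Fin I.n} (htop : I.G.edist u v ≠ ⊤)
    (h : I.G.edist u w + I.G.edist w v = I.G.edist u v) : (I.data p l g).Mon u w v := by
  have hX := isDeletionList_iff.1 hdel
  have hcap : 3 * (I.listSet l).card + 2 ≤ 3 * p + 3 := by
    have := I.card_listSet_le l
    omega
  have hlt : ∀ x y : Fin I.n, I.G.edist x y ≠ ⊤ → I.G.cdist (3 * p + 3) x y < 3 * p + 3 :=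
    fun x y hxy => (SimpleGraph.cdist_le _ _ _).lt_of_ne fun h => hxy (hX.edist_eq_top hcap h)
  have h1 := hlt u v htop
  have h2 := hlt u w fun h' => htop (by rw [← h, h', top_add])
  have h3 := hlt w v fun h' => htop (by rw [← h, h', add_top])
  rw [SimpleGraph.edist_eq_of_cdist_lt h1, SimpleGraph.edist_eq_of_cdist_lt h2,
    SimpleGraph.edist_eq_of_cdist_lt h3, ← Nat.cast_add, ENat.natCast_inj] at h
  refine ⟨?_, ?_⟩
  · change I.distNat (3 * p + 3) u v < 3 * p + 3
    rwa [distNat_eq _ u.2 v.2]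
  · change I.distNat (3 * p + 3) u w + I.distNat (3 * p + 3) w v = I.distNat (3 * p + 3) u v
    rwa [distNat_eq _ u.2 v.2, distNat_eq _ u.2 w.2, distNat_eq _ w.2 v.2]

/-- Each safe pair is monitored by every candidate of one nonempty class, so one arbitrary candidate
per class gives a solution, whether or not the guesses were right. -/
theorem isYes_of_good {p : ℕ} {l : List ℕ} {g : ℕ → ℕ} {q : (ℕ → ℕ) × (ℕ → ℕ)}
    (h : (I.data p l g).Good q) : I.IsYes := by
  classical
  have hch : ∀ i, ∃ w, (∃ w < I.n, (I.data p l g).Cand q i w) →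
      w < I.n ∧ (I.data p l g).Cand q i w := by
    intro i
    by_cases hi : ∃ w < I.n, (I.data p l g).Cand q i w
    · obtain ⟨w, hw⟩ := hi
      exact ⟨w, fun _ => hw⟩
    · exact ⟨0, fun h => absurd h hi⟩
  choose c hc using hch
  refine ⟨Finset.univ.filter fun w => ∃ i < I.k, c i = (w : ℕ), ?_, ?_⟩
  · rw [← Finset.card_map Fin.valEmbedding]
    calc _ ≤ ((Finset.range I.k).image c).card := by
          refine Finset.card_le_card fun x hx => ?_
          obtain ⟨w, hw, rfl⟩ := Finset.mem_map.1 hx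
          obtain ⟨i, hi, hiw⟩ := (Finset.mem_filter.1 hw).2
          exact Finset.mem_image.2 ⟨i, Finset.mem_range.2 hi, hiw⟩
      _ ≤ (Finset.range I.k).card := Finset.card_image_le
      _ = I.k := Finset.card_range _
  · intro u v huv
    have hbad : ¬(I.data p l g).Bad q u v := fun hb => h ⟨u, u.2, v, v.2, hb⟩
    have : ∃ i < I.k, (∃ w < I.n, (I.data p l g).Cand q i w) ∧
        ∀ w < I.n, (I.data p l g).Cand q i w → (I.data p l g).Mon u w v := by
      by_contra! hno
      refine hbad ⟨⟨u.2, v.2, huv⟩, fun i hi hh => ?_⟩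
      obtain ⟨w, hw, hcw, hm⟩ := hno i hi hh.1
      exact hm (hh.2 w hw hcw)
    obtain ⟨i, hi, hex, hall⟩ := this
    obtain ⟨hc1, hc2⟩ := hc i hex
    obtain ⟨h1, h2⟩ := edist_add_of_mon (w := ⟨c i, hc1⟩) (hall _ hc1 hc2)
    exact ⟨h1, ⟨c i, hc1⟩, Finset.mem_filter.2 ⟨Finset.mem_univ _, i, hi, rfl⟩, h2⟩

/-- A minimum cluster deletion set fits into the `p - k` rounds, and the branch that follows it
deletes at most that many vertices. -/
theorem exists_succeedsEarly {p : ℕ} (h : I.G.distToCluster < p - I.k) :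
    ∃ g, IsDigits p g ∧ I.SucceedsEarly p g := by
  obtain ⟨X, hX, hcard⟩ := I.G.exists_card_eq_distToCluster
  obtain ⟨f, hf, h1, h2⟩ := exists_deleteRun_of_isClusterDeletionSet hX (hcard.trans_lt h).le
  have hrun : I.deleted p (fun j => if j < p then f j else 0) =
      deleteRun I.AdjNat I.n f (p - I.k) :=
    deleteRun_congr _ _ fun i hi => if_pos (by omega)
  refine ⟨fun j => if j < p then f j else 0, ⟨fun j => ?_, fun j hj => ?_⟩, ?_, ?_⟩
  · have := hf j
    dsimp only
    split_ifs <;> omega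
  · exact if_neg (by nlinarith)
  · rwa [hrun]
  · rw [hrun]
    omega

theorem not_succeedsEarly {p : ℕ} (h : p - I.k ≤ I.G.distToCluster) (g : ℕ → ℕ) :
    ¬I.SucceedsEarly p g := by
  rintro ⟨h1, h2⟩
  have := SimpleGraph.distToCluster_le (isDeletionList_iff.1 h1)
  have := I.card_listSet_le (I.deleted p g)
  omega

/-- The digits are read off from a minimum deletion set and a solution: the deletions along the set,
the distances of the solution to the deleted vertices, and the bindings that this solution dictates.
-/
theorem exists_succeeds (hyes : I.IsYes) {p : ℕ} (hp : p = I.k + I.G.distToCluster) :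
    ∃ g, IsDigits p g ∧ I.Succeeds p g := by
  obtain ⟨X, hX, hcard⟩ := I.G.exists_card_eq_distToCluster
  obtain ⟨f, hf, h1, h2⟩ := exists_deleteRun_of_isClusterDeletionSet hX
    (show X.card ≤ p - I.k by omega)
  obtain ⟨S, hScard, hS⟩ := hyes
  set l := deleteRun I.AdjNat I.n f (p - I.k) with hl
  have hlp : l.length ≤ p := by omega
  -- A solution with fewer than `k` vertices is padded with vertex 0, which is why the graph without
  -- vertices is treated separately below.
  set s : ℕ → ℕ := fun i => (S.toList.map Fin.val).getD i 0 with hs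
  have hslt : 0 < I.n → ∀ i, s i < I.n := by
    intro hn i
    rcases lt_or_ge i (S.toList.map Fin.val).length with hi | hi
    · have : s i = (S.toList.map Fin.val)[i] := List.getD_eq_getElem _ _ hi
      rw [this, List.getElem_map]
      exact Fin.is_lt _
    · have : s i = 0 := List.getD_eq_default _ _ hi
      rwa [this]
  have hsmem : ∀ w ∈ S, ∃ i < I.k, s i = w := by
    intro w hw
    obtain ⟨i, hi, hiw⟩ := List.mem_iff_getElem.1 (List.mem_map.2 ⟨w, Finset.mem_toList.2 hw, rfl⟩ :
      (w : ℕ) ∈ S.toList.map Fin.val)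
    refine ⟨i, ?_, ?_⟩
    · rw [List.length_map, Finset.length_toList] at hi
      omega
    · rw [← hiw]
      exact List.getD_eq_getElem _ _ hi
  -- Inverse of the row-by-row layout: digit `p + p * i + j` is decoded by quotient and remainder
  -- modulo `p`.
  set t : ℕ → ℕ := fun j => if j < p + p * p then
    I.distNat (3 * p + 3) (s ((j - p) / p)) (l.getD ((j - p) % p) 0) else 0 with ht
  have hmet := data_metric t hlp h1
  have hτ : ∀ i < p, ∀ j < p, (I.data p l t).τ i j =
      I.distNat (3 * p + 3) (s i) (l.getD j 0) := by
    intro i hi j hj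
    have e1 : (p + p * i + j - p) / p = i := by
      rw [Nat.add_assoc, Nat.add_sub_cancel_left, Nat.mul_add_div (by omega), Nat.div_eq_of_lt hj,
        Nat.add_zero]
    have e2 : (p + p * i + j - p) % p = j := by
      rw [Nat.add_assoc, Nat.add_sub_cancel_left, Nat.mul_add_mod, Nat.mod_eq_of_lt hj]
    have e3 : p + p * i + j < p + p * p := by
      have : p * (i + 1) ≤ p * p := Nat.mul_le_mul_left _ hi
      rw [Nat.mul_add] at this
      omega
    change (if i < p ∧ j < p then t (p + p * i + j) else 0) = _
    rw [if_pos ⟨hi, hj⟩, ht]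
    dsimp only
    rw [if_pos e3, e1, e2]
  obtain ⟨f', hf', hgood⟩ : ∃ f' : ℕ → ℕ × ℕ, (∀ r, (f' r).1 ≤ I.k ∧ (f' r).2 ≤ 1) ∧
      (I.data p l t).Good ((I.data p l t).refineRun f' (2 * p)) := by
    rcases Nat.eq_zero_or_pos I.n with hn | hn
    · refine ⟨fun _ => (0, 0), by simp, ?_⟩
      rintro ⟨u, hu, -⟩
      change u < I.n at hu
      omega
    · refine Data.exists_refineRun hmet (s := s) (fun i _ => hslt hn i) (fun i hi j hj => ?_) ?_
        (show 2 * I.k ≤ 2 * p by omega)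
      · have hi : i < I.k := hi
        have hj : j < l.length := hj
        rw [hτ i (by omega) j (by omega)]
        rfl
      · rintro u hu v hv ⟨_, _, huv⟩
        obtain ⟨htop, w, hw, hwe⟩ := hS _ _ huv
        obtain ⟨i, hi, hiw⟩ := hsmem w hw
        refine ⟨i, hi, ?_⟩
        rw [hiw]
        exact mon_of_edist_add t hlp h1 htop hwe
  set g : ℕ → ℕ := fun j => if j < p then f j else if j < p + p * p then t j else
    if j < 3 * p + p * p then (f' (j - (p + p * p))).1 else
    if j < 5 * p + p * p then (f' (j - (3 * p + p * p))).2 else 0 with hg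
  have hdel : I.deleted p g = l := deleteRun_congr _ _ fun i hi => if_pos (by omega)
  have hdata : I.data p l g = I.data p l t := by
    simp only [data, Data.mk.injEq, true_and]
    funext i j
    by_cases hij : i < p ∧ j < p
    · have e3 : p + p * i + j < p + p * p := by
        have : p * (i + 1) ≤ p * p := Nat.mul_le_mul_left _ hij.1
        rw [Nat.mul_add] at this
        omega
      rw [if_pos hij, if_pos hij, hg]
      dsimp only
      rw [if_neg (by omega), if_pos e3]
    · rw [if_neg hij, if_neg hij]
  have hchoice : ∀ r < 2 * p, choice p g r = f' r := by
    intro r hr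
    simp only [choice, hg]
    rw [if_neg (by omega), if_neg (by omega), if_pos (by omega), if_neg (by omega),
      if_neg (by omega), if_neg (by omega), if_pos (by omega), Nat.add_sub_cancel_left,
      Nat.add_sub_cancel_left]
  refine ⟨g, ⟨fun j => ?_, fun j hj => ?_⟩, by rwa [hdel], ?_⟩
  · have h3 := hf j
    have h4 := (hf' (j - (p + p * p))).1
    have h5 := (hf' (j - (3 * p + p * p))).2
    have h6 : t j ≤ 3 * p + 3 := by
      simp only [ht]
      split_ifs
      · exact distNat_le _ _ _
      · omega
    simp only [hg]
    split_ifs <;> omega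
  · simp only [hg]
    rw [if_neg (by omega), if_neg (by omega), if_neg (by omega), if_neg (by omega)]
  · rw [hdel, hdata, Data.refineRun_congr _ hchoice]
    exact hgood

/-- The algorithm is correct. -/
theorem exists_succeeds_and_not_exists_succeedsEarly_iff {p : ℕ} (hp : I.k ≤ p) :
    ((∃ g, IsDigits p g ∧ I.Succeeds p g) ∧ ¬∃ g, IsDigits p g ∧ I.SucceedsEarly p g) ↔
      I.IsYes ∧ p = I.k + I.G.distToCluster := by
  constructor
  · rintro ⟨⟨g, -, h1, h2⟩, h3⟩
    refine ⟨isYes_of_good h2, ?_⟩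
    -- The failure of all early successes bounds the distance to cluster from below by `p - k`; the
    -- deletion list of the successful branch bounds it from above.
    have h4 : ¬I.G.distToCluster < p - I.k := fun h => h3 (exists_succeedsEarly h)
    have h5 := SimpleGraph.distToCluster_le (isDeletionList_iff.1 h1)
    have h6 := I.card_listSet_le (I.deleted p g)
    have h7 := (deleteRun_spec I.AdjNat I.n g (p - I.k)).2.1
    change (I.deleted p g).length ≤ p - I.k at h7
    omega
  · rintro ⟨hyes, h⟩
    exact ⟨exists_succeeds hyes h, fun ⟨g, _, hg⟩ => not_succeedsEarly (by omega) g hg⟩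

end TMSInstance

/-! ### Encodings of instances -/

namespace TMSInstance

open Branching

/-- The letter number `i` is a `true`. -/
abbrev BitAt (x : List Bool) (i : ℕ) : Prop := x[i]? = some true

theorem getElem?_eq_some_decide {x : List Bool} {i : ℕ} (h : i < x.length) :
    x[i]? = some (decide (BitAt x i)) := by
  unfold BitAt
  rw [List.getElem?_eq_getElem h]
  cases x[i] <;> simp

theorem matrixBits_eq_ofFn {n : ℕ} (r : Fin n → Fin n → Bool) :
    matrixBits r = List.ofFn fun t : Fin (n * n) => r t.divNat t.modNat := by
  rw [List.ofFn_mul, matrixBits, List.flatMap_def, ← List.ofFn_eq_map]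
  congr 2
  funext i
  rw [← List.ofFn_eq_map]
  congr 1
  funext j
  have hj := j.2
  congr 1
  · ext
    simp only [Fin.divNat]
    rw [Nat.mul_comm, Nat.mul_add_div (by omega), Nat.div_eq_of_lt hj, Nat.add_zero]
  · ext
    simp only [Fin.modNat]
    rw [Nat.mul_comm, Nat.mul_add_mod, Nat.mod_eq_of_lt hj]

theorem length_matrixBits {n : ℕ} (r : Fin n → Fin n → Bool) :
    (matrixBits r).length = n * n := by
  rw [matrixBits_eq_ofFn, List.length_ofFn]

theorem getElem?_matrixBits {n : ℕ} (r : Fin n → Fin n → Bool) {u v : ℕ} (hu : u < n)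
    (hv : v < n) : (matrixBits r)[n * u + v]? = some (r ⟨u, hu⟩ ⟨v, hv⟩) := by
  have h : n * u + v < n * n := by
    have : n * (u + 1) ≤ n * n := Nat.mul_le_mul_left _ hu
    rw [Nat.mul_add] at this
    omega
  rw [matrixBits_eq_ofFn, List.getElem?_ofFn, dif_pos h]
  congr 2
  · ext
    simp only [Fin.divNat]
    rw [Nat.mul_add_div (by omega), Nat.div_eq_of_lt hv, Nat.add_zero]
  · ext
    simp only [Fin.modNat]
    rw [Nat.mul_add_mod, Nat.mod_eq_of_lt hv]

/-! ### Binary digits and the format of encodings -/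

/-- The number with the given binary digits, least significant first. -/
def ofBits (l : List Bool) : ℕ := l.foldr (fun b a => Nat.bit b a) 0

theorem ofBits_cons (b : Bool) (l : List Bool) : ofBits (b :: l) = Nat.bit b (ofBits l) := rfl

theorem ofBits_bits (k : ℕ) : ofBits k.bits = k := by
  induction k using Nat.binaryRec' with
  | zero => simp [ofBits]
  | bit b n h ih => rw [Nat.bits_append_bit n b h, ofBits_cons, ih]

theorem getLast?_bits (k : ℕ) : k.bits = [] ∨ k.bits.getLast? = some true := by
  induction k using Nat.binaryRec' with
  | zero => simp
  | bit b n h ih =>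
    right
    rw [Nat.bits_append_bit n b h]
    rcases ih with ih | ih
    · have : n = 0 := by rw [← ofBits_bits n, ih]; rfl
      rw [ih, h this]
      rfl
    · rw [List.getLast?_cons, ih]
      rfl

/-- The condition excludes leading zeros; without it several digit lists would denote the same
number. -/
theorem bits_ofBits {l : List Bool} (h : l = [] ∨ l.getLast? = some true) :
    (ofBits l).bits = l := by
  induction l with
  | nil => simp [ofBits]
  | cons b l ih =>
    have h := h.resolve_left (by simp)
    rw [ofBits_cons]
    by_cases hl : l = []
    · subst hl
      have : b = true := by simpa using h
      subst this
      simp [ofBits, Nat.bit]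
    · have h' : l.getLast? = some true := by
        rw [List.getLast?_cons, List.getLast?_eq_getLast_of_ne_nil hl] at h
        rw [List.getLast?_eq_getLast_of_ne_nil hl]
        simpa using h
      have ih := ih (.inr h')
      rw [Nat.bits_append_bit _ _ fun h0 => ?_, ih]
      rw [h0, Nat.zero_bits] at ih
      exact absurd ih.symm hl

/-- The position of the digits of `k`, if there are `n` vertices. -/
def digitPos (n : ℕ) : ℕ := n + 1 + n * n + n * n

/-- The format of encodings with `n` vertices. -/
structure IsFormat (x : List Bool) (n : ℕ) : Prop where
  ones : ∀ i < n, BitAt x i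
  zero : ¬BitAt x n
  len : digitPos n ≤ x.length
  -- The last letter is the most significant digit of `k`; it must be `true` unless there are no
  -- digits, since `Nat.bits` has no leading zeros.
  last : digitPos n = x.length ∨ BitAt x (x.length - 1)
  irrefl : ∀ u < n, ¬BitAt x (n + 1 + (n * u + u))
  adj_symm : ∀ u < n, ∀ v < n, BitAt x (n + 1 + (n * u + v)) → BitAt x (n + 1 + (n * v + u))
  pair_symm : ∀ u < n, ∀ v < n, BitAt x (n + 1 + n * n + (n * u + v)) →
    BitAt x (n + 1 + n * n + (n * v + u))

section

variable (I : TMSInstance)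

theorem length_encode : I.encode.length = digitPos I.n + I.k.bits.length := by
  simp only [encode, List.length_append, List.length_replicate, List.length_singleton,
    length_matrixBits, digitPos]

theorem encode_ones {i : ℕ} (hi : i < I.n) : I.encode[i]? = some true := by
  simp only [encode, List.append_assoc]
  rw [List.getElem?_append_left (by simpa using hi)]
  simp [hi]

theorem encode_zero : I.encode[I.n]? = some false := by
  simp only [encode, List.append_assoc]
  rw [List.getElem?_append_right (by simp)]
  simp

theorem bitAt_encode_adj {u v : ℕ} (hu : u < I.n) (hv : v < I.n) :
    BitAt I.encode (I.n + 1 + (I.n * u + v)) ↔ I.AdjNat u v := by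
  have h : I.n * u + v < I.n * I.n := by
    have : I.n * (u + 1) ≤ I.n * I.n := Nat.mul_le_mul_left _ hu
    rw [Nat.mul_add] at this
    omega
  rw [BitAt, encode, List.append_assoc, List.append_assoc, List.getElem?_append_right (by simp),
    List.getElem?_append_left (by rw [length_matrixBits]; simpa using h)]
  simp only [List.length_append, List.length_replicate, List.length_singleton,
    Nat.add_sub_cancel_left]
  rw [getElem?_matrixBits _ hu hv]
  simp [AdjNat, hu, hv]

theorem bitAt_encode_pair {u v : ℕ} (hu : u < I.n) (hv : v < I.n) :
    BitAt I.encode (I.n + 1 + I.n * I.n + (I.n * u + v)) ↔ I.PairNat u v := by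
  have h : I.n * u + v < I.n * I.n := by
    have : I.n * (u + 1) ≤ I.n * I.n := Nat.mul_le_mul_left _ hu
    rw [Nat.mul_add] at this
    omega
  rw [BitAt, encode, List.append_assoc, List.getElem?_append_right
    (by simp [length_matrixBits]; omega),
    List.getElem?_append_left (by simp [length_matrixBits]; omega)]
  simp only [List.length_append, List.length_replicate, List.length_singleton, length_matrixBits,
    Nat.add_sub_cancel_left]
  rw [getElem?_matrixBits _ hu hv]
  simp [PairNat, hu, hv]

theorem drop_encode : I.encode.drop (digitPos I.n) = I.k.bits := by
  rw [encode]
  refine List.drop_left' ?_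
  simp only [List.length_append, List.length_replicate, List.length_singleton,
    length_matrixBits, digitPos]

theorem isFormat_encode : IsFormat I.encode I.n where
  ones i hi := I.encode_ones hi
  zero := by rw [BitAt, encode_zero]; simp
  len := by rw [length_encode]; omega
  last := by
    rcases getLast?_bits I.k with h | h
    · left
      rw [length_encode, h]
      rfl
    · right
      rw [BitAt, ← List.getLast?_eq_getElem?, encode, List.getLast?_append, h]
      rfl
  irrefl u hu := by
    rw [bitAt_encode_adj _ hu hu]
    simp [AdjNat]
  adj_symm u hu v hv h := by
    rw [bitAt_encode_adj _ hu hv] at h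
    rw [bitAt_encode_adj _ hv hu]
    obtain ⟨hu, hv, h⟩ := h
    exact ⟨hv, hu, h.symm⟩
  pair_symm u hu v hv h := by
    rw [bitAt_encode_pair _ hu hv] at h
    rw [bitAt_encode_pair _ hv hu]
    obtain ⟨hu, hv, h⟩ := h
    exact ⟨hv, hu, Sym2.eq_swap ▸ h⟩

end

/-- The format conditions, which a program can test, characterise the range of `encode`; this is
what allows malformed inputs to be rejected. -/
theorem exists_eq_encode {x : List Bool} {n : ℕ} (h : IsFormat x n) :
    ∃ I : TMSInstance, x = I.encode ∧ I.n = n := by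
  classical
  let G : SimpleGraph (Fin n) :=
    { Adj := fun u v => BitAt x (n + 1 + (n * u + v))
      symm := ⟨fun u v huv => h.adj_symm u u.2 v v.2 huv⟩
      loopless := ⟨fun u hu => h.irrefl u u.2 hu⟩ }
  have hsym : Std.Symm fun u v : Fin n => BitAt x (n + 1 + n * n + (n * u + v)) :=
    ⟨fun u v huv => h.pair_symm u u.2 v v.2 huv⟩
  let T : Finset (Sym2 (Fin n)) := Finset.univ.filter fun z => z ∈ Sym2.fromRel hsym
  let I : TMSInstance := ⟨n, G, T, ofBits (x.drop (digitPos n))⟩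
  have hlast : x.drop (digitPos n) = [] ∨ (x.drop (digitPos n)).getLast? = some true := by
    rcases h.last with h1 | h1
    · left
      rw [h1, List.drop_length]
    · by_cases hq : digitPos n = x.length
      · left
        rw [hq, List.drop_length]
      · right
        have := h.len
        rw [List.getLast?_drop, if_neg (by omega), List.getLast?_eq_getElem?]
        exact h1
  have hlen : x.length = I.encode.length := by
    have := h.len
    rw [length_encode, show I.k.bits = x.drop (digitPos n) from bits_ofBits hlast,
      List.length_drop]
    change _ = digitPos n + _
    omega
  refine ⟨I, List.ext_getElem? fun i => ?_, rfl⟩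
  rcases lt_or_ge i (digitPos n) with hi | hi
  · refine (getElem?_eq_some_decide (hi.trans_le h.len)).trans (Eq.trans ?_
      (getElem?_eq_some_decide (hi.trans_le (h.len.trans_eq hlen))).symm)
    refine congrArg some (decide_eq_decide.2 ?_)
    rcases lt_trichotomy i n with h1 | h1 | h1
    · exact iff_of_true (h.ones i h1) (I.encode_ones h1)
    · rw [h1]
      exact iff_of_false h.zero I.isFormat_encode.zero
    · have key : ∀ j, j < n * n → ∃ u < n, ∃ v < n, j = n * u + v := by
        intro j hj
        have hn : 0 < n := Nat.pos_of_ne_zero fun h0 => by simp [h0] at hj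
        exact ⟨j / n, Nat.div_lt_of_lt_mul hj, j % n, Nat.mod_lt _ hn, (Nat.div_add_mod j n).symm⟩
      rcases lt_or_ge i (n + 1 + n * n) with h2 | h2
      · obtain ⟨u, hu, v, hv, huv⟩ := key (i - (n + 1)) (by omega)
        rw [show i = n + 1 + (n * u + v) by omega]
        refine Iff.trans ?_ (I.bitAt_encode_adj (u := u) (v := v) hu hv).symm
        exact ⟨fun h => ⟨hu, hv, h⟩, fun h => h.elim fun _ h => h.elim fun _ h => h⟩
      · obtain ⟨u, hu, v, hv, huv⟩ := key (i - (n + 1 + n * n)) (by unfold digitPos at hi; omega)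
        rw [show i = n + 1 + n * n + (n * u + v) by omega]
        refine Iff.trans ?_ (I.bitAt_encode_pair (u := u) (v := v) hu hv).symm
        exact ⟨fun h => ⟨hu, hv, Finset.mem_filter.2 ⟨Finset.mem_univ _, h⟩⟩,
          fun h => h.elim fun _ h => h.elim fun _ h => (Finset.mem_filter.1 h).2⟩
  · obtain ⟨j, rfl⟩ := Nat.exists_eq_add_of_le hi
    rw [← List.getElem?_drop, ← List.getElem?_drop, ← show I.k.bits = x.drop (digitPos n) from
      bits_ofBits hlast]
    exact congrArg (·[j]?) I.drop_encode.symm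

end TMSInstance

/-! ### Derived expressions -/

namespace Imp

open Branching

/-- The expression is true, i.e. not zero. -/
def Expr.T (e : Expr) (σ : St) : Prop := e.eval σ ≠ 0

def Expr.and (e f : Expr) : Expr := .isz (.add (.isz e) (.isz f))
def Expr.or (e f : Expr) : Expr := .add e f
def Expr.le (e f : Expr) : Expr := .isz (.sub e f)
def Expr.lt (e f : Expr) : Expr := .sub f e
def Expr.eq (e f : Expr) : Expr := .isz (.add (.sub e f) (.sub f e))
def Expr.ex (x v : Var) (e : Expr) : Expr := .sum x v e
def Expr.all (x v : Var) (e : Expr) : Expr := .isz (.sum x v (.isz e))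

/-- Product with a variable; the factor `e` must not depend on `z`. -/
def Expr.mul (e : Expr) (v : Var) : Expr := .sum .z v e

/-- The least `x < v` with `e`, or `v`; here `e` must not depend on `y`. -/
def Expr.find (x v : Var) (e : Expr) : Expr :=
  -- Counts the `y` such that no `x ≤ y` satisfies `e`; these are exactly the numbers below the
  -- least such `x`.
  .sum .y v (.all x v (.isz (.and (.le (.var x) (.var .y)) e)))

/-- Quotient by the variable `v`, if the quotient is at most `w`; here `e` must not depend on `y` and
`z`. -/
def Expr.div (e : Expr) (v w : Var) : Expr :=
  -- The machine cannot divide, so the quotient is computed as the number of `y < w` with `(y + 1) *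
  -- v ≤ e`.
  .sum .y w (.le (.mul (.add (.var .y) (.const 1)) v) e)

/-! ### Semantics of the derived expressions -/

@[simp] theorem T_isz (e : Expr) (σ : St) : (Expr.isz e).T σ ↔ ¬e.T σ := by
  simp only [Expr.T, Expr.eval]; omega

@[simp] theorem T_and (e f : Expr) (σ : St) : (e.and f).T σ ↔ e.T σ ∧ f.T σ := by
  simp only [Expr.T, Expr.eval, Expr.and]; omega

@[simp] theorem T_or (e f : Expr) (σ : St) : (e.or f).T σ ↔ e.T σ ∨ f.T σ := by
  simp only [Expr.T, Expr.eval, Expr.or]; omega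

@[simp] theorem T_le (e f : Expr) (σ : St) : (e.le f).T σ ↔ e.eval σ ≤ f.eval σ := by
  simp only [Expr.T, Expr.eval, Expr.le]; omega

@[simp] theorem T_lt (e f : Expr) (σ : St) : (e.lt f).T σ ↔ e.eval σ < f.eval σ := by
  simp only [Expr.T, Expr.eval, Expr.lt]; omega

@[simp] theorem T_eq (e f : Expr) (σ : St) : (e.eq f).T σ ↔ e.eval σ = f.eval σ := by
  simp only [Expr.T, Expr.eval, Expr.eq]; omega

@[simp] theorem T_ex (x v : Var) (e : Expr) (σ : St) :
    (Expr.ex x v e).T σ ↔ ∃ i < σ.var v, e.T (σ.set x i) := by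
  simp [Expr.T, Expr.ex, Expr.eval, Finset.sum_eq_zero_iff]

@[simp] theorem T_all (x v : Var) (e : Expr) (σ : St) :
    (Expr.all x v e).T σ ↔ ∀ i < σ.var v, e.T (σ.set x i) := by
  have h := T_ex x v (.isz e) σ
  rw [Expr.all, T_isz]
  rw [Expr.ex] at h
  simp [h]

@[simp] theorem T_get (a : Arr) (e : Expr) (σ : St) :
    (Expr.get a e).T σ ↔ σ.arr a (e.eval σ) ≠ 0 := Iff.rfl

@[simp] theorem T_var (x : Var) (σ : St) : (Expr.var x).T σ ↔ σ.var x ≠ 0 := Iff.rfl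

open scoped Classical in
theorem eval_isz (e : Expr) (σ : St) :
    (Expr.isz e).eval σ = if (Expr.isz e).T σ then 1 else 0 := by
  have h : (Expr.isz e).T σ ↔ (Expr.isz e).eval σ ≠ 0 := Iff.rfl
  rw [Expr.eval] at h ⊢
  split_ifs with hT <;> rw [h] at hT <;> omega

theorem eval_le (e f : Expr) (σ : St) :
    (e.le f).eval σ = if e.eval σ ≤ f.eval σ then 1 else 0 := by
  simp only [Expr.eval, Expr.le]
  split_ifs <;> omega

theorem eval_mul {e : Expr} {v : Var} {σ : St} {a : ℕ} (h : ∀ i, e.eval (σ.set .z i) = a) :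
    (e.mul v).eval σ = σ.var v * a := by
  simp [Expr.mul, Expr.eval, h]

theorem eval_and_eq_one {e f : Expr} {σ : St} : (e.and f).eval σ = 1 ↔ (e.and f).T σ := by
  simp only [Expr.T, Expr.eval, Expr.and]; omega

theorem eval_find {x v : Var} {e : Expr} {σ : St} {P : ℕ → Prop} (hx : x ≠ .y) (hv : v ≠ .y)
    (h : ∀ i < σ.var v, ∀ j, e.T ((σ.set .y j).set x i) ↔ P i) :
    (Expr.find x v e).eval σ = leastBelow (σ.var v) P := by
  classical
  have h1 : ∀ j ∈ Finset.range (σ.var v),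
      (Expr.all x v (.isz (.and (.le (.var x) (.var .y)) e))).eval (σ.set .y j) =
      if j < leastBelow (σ.var v) P then 1 else 0 := by
    intro j hj
    rw [Finset.mem_range] at hj
    rw [Expr.all, eval_isz]
    refine if_congr ?_ rfl rfl
    rw [← Expr.all, T_all]
    simp only [T_isz, T_and, T_le, Expr.eval, St.set_var, if_true, if_neg hv, if_neg hx.symm]
    constructor
    · intro hno
      by_contra hlt
      have h4 : leastBelow (σ.var v) P < σ.var v := by omega
      exact hno _ h4 ⟨by omega, (h _ h4 _).2 (leastBelow_spec (leastBelow_lt_iff.1 h4))⟩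
    · rintro hlt i hi ⟨hij, hP⟩
      rw [h i hi] at hP
      exact not_of_lt_leastBelow (n := σ.var v) (by omega) hP
  rw [Expr.find, Expr.eval, Finset.sum_congr rfl h1, ← Finset.sum_filter, Finset.sum_const,
    smul_eq_mul, mul_one]
  have : Finset.filter (fun j => j < leastBelow (σ.var v) P) (Finset.range (σ.var v)) =
      Finset.range (leastBelow (σ.var v) P) := by
    ext j
    have := leastBelow_le (σ.var v) P
    simp only [Finset.mem_filter, Finset.mem_range]
    omega
  rw [this, Finset.card_range]

theorem eval_div {e : Expr} {v w : Var} {σ : St} {a : ℕ} (hv : v ≠ .y)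
    (h0 : 0 < σ.var v) (h : ∀ j, e.eval (σ.set .y j) = a) (hle : a / σ.var v ≤ σ.var w) :
    (Expr.div e v w).eval σ = a / σ.var v := by
  simp only [Expr.div]
  rw [Expr.eval]
  have h1 : ∀ j, ((Expr.mul (.add (.var .y) (.const 1)) v).le e).eval (σ.set .y j) =
      if j < a / σ.var v then 1 else 0 := by
    intro j
    rw [eval_le, eval_mul (a := j + 1) (by simp [Expr.eval]), h, St.set_var, if_neg hv]
    refine if_congr ?_ rfl rfl
    rw [Nat.lt_iff_add_one_le, Nat.le_div_iff_mul_le h0, Nat.mul_comm]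
  simp only [h1]
  rw [← Finset.sum_filter, Finset.sum_const, smul_eq_mul, mul_one]
  have : Finset.filter (fun j => j < a / σ.var v) (Finset.range (σ.var w)) =
      Finset.range (a / σ.var v) := by
    ext j
    simp only [Finset.mem_filter, Finset.mem_range]
    omega
  rw [this, Finset.card_range]

end Imp

/-! ### The program: deletion and refinement -/

namespace Imp

open Branching

/-- The index of a pair of vertices. -/
def idxE (a b : Expr) : Expr := (a.mul .n).add b

def adjE (a b : Expr) : Expr := .get .inp (((Expr.var .n).add (.const 1)).add (idxE a b))

def pairE (a b : Expr) : Expr :=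
  .get .inp ((((Expr.var .n).add (.const 1)).add (.var .nn)).add (idxE a b))

def distE (a b : Expr) : Expr := .get .D (idxE a b)

def notDeletedE (x : Var) : Expr :=
  .all .j .p (.isz (.and (.lt (.var .j) (.var .m)) (.eq (.get .xs (.var .j)) (.var x))))

/-- `a, b, c` is an induced path that avoids the deleted vertices. -/
def pathE : Expr :=
  (notDeletedE .a).and ((notDeletedE .b).and ((notDeletedE .c).and
  ((adjE (.var .a) (.var .b)).and ((adjE (.var .b) (.var .c)).and
  ((Expr.isz (adjE (.var .a) (.var .c))).and (.isz (.eq (.var .a) (.var .c))))))))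

/-- One round of deletion; `r` is the number of the round. -/
def deleteS : Stmt :=
  .seq (.assign .a (.find .a .n (.ex .b .n (.ex .c .n pathE))))
  (.ite (.lt (.var .a) (.var .n))
    (.seq (.assign .b (.find .b .n (.ex .c .n pathE)))
    (.seq (.assign .c (.find .c .n pathE))
    (.seq (.ite (.get .g (.var .r))
      (.ite (.eq (.get .g (.var .r)) (.const 1)) (.put .xs (.var .m) (.var .b))
        (.put .xs (.var .m) (.var .c)))
      (.put .xs (.var .m) (.var .a)))
    (.assign .m (.add (.var .m) (.const 1)))))) .skip)

/-- `w` is a candidate for monitor `i`. -/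
def candE : Expr :=
  .and (.all .j .p (.or (.le (.var .m) (.var .j))
    (.eq (distE (.var .w) (.get .xs (.var .j)))
      (.get .g (((Expr.var .p).add ((Expr.var .i).mul .p)).add (.var .j))))))
  (.or (.isz (.get .kd (.var .i)))
    (.le (.add (distE (.get .cc (.var .i)) (.var .w)) (.get .kd (.var .i))) (.const 2)))

/-- `w` monitors `u, v`. -/
def monE : Expr :=
  .and (.lt (distE (.var .u) (.var .v)) (.var .cap))
    (.eq (.add (distE (.var .u) (.var .w)) (distE (.var .w) (.var .v)))
      (distE (.var .u) (.var .v)))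

/-- `u, v` is a terminal pair that is not safely monitored. -/
def badE : Expr :=
  .and (pairE (.var .u) (.var .v))
    (.all .i .k (.isz (.and (.ex .w .n candE) (.all .w .n (.or (.isz candE) monE)))))

/-- One round of refinement; `r` is the number of the round. -/
def refineS : Stmt :=
  .seq (.assign .u (.find .u .n (.ex .v .n badE)))
  (.ite (.lt (.var .u) (.var .n))
    (.seq (.assign .v (.find .v .n badE))
    (.seq (.assign .i (.get .g (((Expr.var .p).add ((Expr.var .p).mul .p)).add (.var .r))))
    (.seq (.ite (.get .g (((((Expr.var .p).add (.var .p)).add (.var .p)).add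
        ((Expr.var .p).mul .p)).add (.var .r)))
      (.put .cc (.var .i) (.var .v)) (.put .cc (.var .i) (.var .u)))
    (.put .kd (.var .i) (.add (.get .kd (.var .i)) (.const 1)))))) .skip)

/-- The variables that are fixed in the main part of the program. -/
def params : Var → Bool
  | .L | .p | .n | .nn | .k | .d | .cap | .B | .M | .N | .p2 => true
  | _ => false

/-- The state in which the instance has been located in the input. -/
structure Located (I : TMSInstance) (σ : St) : Prop where
  n : σ.var .n = I.n
  nn : σ.var .nn = I.n * I.n
  adj : ∀ u < I.n, ∀ v < I.n, (σ.arr .inp (I.n + 1 + (I.n * u + v)) ≠ 0 ↔ I.AdjNat u v)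
  pair : ∀ u < I.n, ∀ v < I.n,
    (σ.arr .inp (I.n + 1 + I.n * I.n + (I.n * u + v)) ≠ 0 ↔ I.PairNat u v)

/-- The state in which all tables have been computed. -/
structure Ready (I : TMSInstance) (p : ℕ) (σ : St) : Prop extends Located I σ where
  hp : σ.var .p = p
  k : σ.var .k = I.k
  k_le : I.k ≤ p
  d : σ.var .d = p - I.k
  cap : σ.var .cap = 3 * p + 3
  B : σ.var .B = 3 * p + 4
  M : σ.var .M = p * p + 5 * p
  N : σ.var .N = (3 * p + 4) ^ (p * p + 5 * p)
  p2 : σ.var .p2 = 2 * p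
  dist : ∀ u < I.n, ∀ v < I.n, σ.arr .D (I.n * u + v) = I.distNat (3 * p + 3) u v

variable {I : TMSInstance} {p : ℕ} {σ : St}

/-! ### Preservation of parameters and tables; meaning of the tests for induced paths -/

theorem Ready.congr (h : Ready I p σ) {σ' : St} (hv : ∀ x, params x = true → σ'.var x = σ.var x)
    (hi : σ'.arr .inp = σ.arr .inp) (hD : σ'.arr .D = σ.arr .D) : Ready I p σ' where
  n := (hv _ rfl).trans h.n
  nn := (hv _ rfl).trans h.nn
  hp := (hv _ rfl).trans h.hp
  k := (hv _ rfl).trans h.k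
  k_le := h.k_le
  d := (hv _ rfl).trans h.d
  cap := (hv _ rfl).trans h.cap
  B := (hv _ rfl).trans h.B
  M := (hv _ rfl).trans h.M
  N := (hv _ rfl).trans h.N
  p2 := (hv _ rfl).trans h.p2
  adj := hi ▸ h.adj
  pair := hi ▸ h.pair
  dist := hD ▸ h.dist

theorem Ready.set (h : Ready I p σ) {x : Var} (hx : params x = false) (a : ℕ) :
    Ready I p (σ.set x a) :=
  h.congr (fun y hy => by
    rw [St.set_var, if_neg]
    rintro rfl
    simp [hx] at hy) rfl rfl

theorem Ready.run (h : Ready I p σ) {s : Stmt} (hs : s.wf params = true)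
    (hi : s.keepsArr .inp = true) (hD : s.keepsArr .D = true) : Ready I p (s.run σ) :=
  h.congr (fun _ hx => Stmt.run_var (Stmt.keeps_of_wf hs hx) σ) (Stmt.run_arr hi σ)
    (Stmt.run_arr hD σ)

theorem Ready.iter (h : Ready I p σ) {s : Stmt} {x : Var} (hs : s.wf params = true)
    (hx : params x = false) (hi : s.keepsArr .inp = true) (hD : s.keepsArr .D = true) (r : ℕ) :
    Ready I p (s.iter x σ r) := by
  induction r with
  | zero => exact h
  | succ r ih => exact (ih.set hx r).run hs hi hD

/-- The deleted vertices. -/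
def deletedOf (σ : St) : List ℕ := (List.range (σ.var .m)).map (σ.arr .xs)

theorem length_deletedOf (σ : St) : (deletedOf σ).length = σ.var .m := by simp [deletedOf]

theorem deletedOf_set {x : Var} (hx : Var.m ≠ x) (a : ℕ) : deletedOf (σ.set x a) = deletedOf σ := by
  simp [deletedOf, hx]

theorem getD_deletedOf {j : ℕ} (hj : j < σ.var .m) : (deletedOf σ).getD j 0 = σ.arr .xs j := by
  rw [List.getD_eq_getElem _ _ (by rwa [length_deletedOf])]
  simp [deletedOf]

theorem T_adjE (h : Located I σ) {x y : Var} (hx : x ≠ .z) (hu : σ.var x < I.n)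
    (hv : σ.var y < I.n) :
    (adjE (.var x) (.var y)).T σ ↔ I.AdjNat (σ.var x) (σ.var y) := by
  rw [← h.adj _ hu _ hv, adjE, T_get]
  simp [idxE, Expr.mul, Expr.eval, h.n, hx]

theorem T_pairE (h : Located I σ) {x y : Var} (hx : x ≠ .z) (hu : σ.var x < I.n)
    (hv : σ.var y < I.n) :
    (pairE (.var x) (.var y)).T σ ↔ I.PairNat (σ.var x) (σ.var y) := by
  rw [← h.pair _ hu _ hv, pairE, T_get]
  simp [idxE, Expr.mul, Expr.eval, h.n, h.nn, hx]

theorem eval_distE (h : Ready I p σ) {a b : Expr} (ha : ∀ i, a.eval (σ.set .z i) = a.eval σ)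
    (hu : a.eval σ < I.n) (hv : b.eval σ < I.n) :
    (distE a b).eval σ = I.distNat (3 * p + 3) (a.eval σ) (b.eval σ) := by
  rw [← h.dist _ hu _ hv]
  simp [distE, idxE, Expr.mul, Expr.eval, h.n, ha]

theorem T_notDeletedE (h : Ready I p σ) (hm : σ.var .m ≤ p) {x : Var} (hx : x ≠ .j) :
    (notDeletedE x).T σ ↔ σ.var x ∉ deletedOf σ := by
  simp only [notDeletedE, T_all, T_isz, T_and, T_lt, T_eq, Expr.eval, St.set_var, St.set_arr,
    if_true, if_neg hx, h.hp, deletedOf, List.mem_map, List.mem_range, reduceCtorEq, if_false]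
  constructor
  · rintro h1 ⟨j, hj, he⟩
    exact h1 j (by omega) ⟨hj, he⟩
  · rintro h1 j _ ⟨hj, he⟩
    exact h1 ⟨j, hj, he⟩

theorem T_pathE (h : Ready I p σ) (hm : σ.var .m ≤ p) (ha : σ.var .a < I.n)
    (hb : σ.var .b < I.n) (hc : σ.var .c < I.n) :
    pathE.T σ ↔ InducedPath I.AdjNat (deletedOf σ) (σ.var .a) (σ.var .b) (σ.var .c) := by
  simp only [pathE, T_and, T_isz, T_eq, Expr.eval]
  rw [T_notDeletedE h hm (by decide), T_notDeletedE h hm (by decide),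
    T_notDeletedE h hm (by decide), T_adjE h.toLocated (by decide) ha hb,
    T_adjE h.toLocated (by decide) hb hc,
    T_adjE h.toLocated (by decide) ha hc]
  rfl

theorem T_ex_pathE (h : Ready I p σ) (hm : σ.var .m ≤ p) (ha : σ.var .a < I.n)
    (hb : σ.var .b < I.n) : (Expr.ex .c .n pathE).T σ ↔
      ∃ c < I.n, InducedPath I.AdjNat (deletedOf σ) (σ.var .a) (σ.var .b) c := by
  rw [T_ex, h.n]
  refine exists_congr fun c => and_congr_right fun hc => ?_
  rw [T_pathE (h.set rfl c) (by simpa using hm) (by simpa using ha) (by simpa using hb)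
    (by simpa using hc), deletedOf_set (by decide)]
  simp

theorem T_ex_ex_pathE (h : Ready I p σ) (hm : σ.var .m ≤ p) (ha : σ.var .a < I.n) :
    (Expr.ex .b .n (.ex .c .n pathE)).T σ ↔
      ∃ b < I.n, ∃ c < I.n, InducedPath I.AdjNat (deletedOf σ) (σ.var .a) b c := by
  rw [T_ex, h.n]
  refine exists_congr fun b => and_congr_right fun hb => ?_
  rw [T_ex_pathE (h.set rfl b) (by simpa using hm) (by simpa using ha) (by simpa using hb),
    deletedOf_set (by decide)]
  simp

theorem T_ex_ex_ex_pathE (h : Ready I p σ) (hm : σ.var .m ≤ p) :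
    (Expr.ex .a .n (.ex .b .n (.ex .c .n pathE))).T σ ↔
      ¬IsDeletionList I.AdjNat I.n (deletedOf σ) := by
  rw [T_ex, h.n, IsDeletionList, not_not]
  refine exists_congr fun a => and_congr_right fun ha => ?_
  rw [T_ex_ex_pathE (h.set rfl a) (by simpa using hm) (by simpa using ha),
    deletedOf_set (by decide)]
  simp

theorem eval_findA (h : Ready I p σ) (hm : σ.var .m ≤ p) :
    (Expr.find .a .n (.ex .b .n (.ex .c .n pathE))).eval σ =
      leastBelow I.n fun a => ∃ b < I.n, ∃ c < I.n, InducedPath I.AdjNat (deletedOf σ) a b c := by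
  rw [← h.n]
  refine eval_find (by decide) (by decide) fun i hi j => ?_
  rw [T_ex_ex_pathE ((h.set rfl j).set rfl i) (by simpa using hm) (by simpa [← h.n] using hi),
    deletedOf_set (by decide), deletedOf_set (by decide), h.n]
  simp

theorem eval_findB (h : Ready I p σ) (hm : σ.var .m ≤ p) (ha : σ.var .a < I.n) :
    (Expr.find .b .n (.ex .c .n pathE)).eval σ =
      leastBelow I.n fun b => ∃ c < I.n, InducedPath I.AdjNat (deletedOf σ) (σ.var .a) b c := by
  rw [← h.n]
  refine eval_find (by decide) (by decide) fun i hi j => ?_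
  rw [T_ex_pathE ((h.set rfl j).set rfl i) (by simpa using hm) (by simpa using ha)
    (by simpa [← h.n] using hi), deletedOf_set (by decide), deletedOf_set (by decide), h.n]
  simp

theorem eval_findC (h : Ready I p σ) (hm : σ.var .m ≤ p) (ha : σ.var .a < I.n)
    (hb : σ.var .b < I.n) : (Expr.find .c .n pathE).eval σ =
      leastBelow I.n fun c => InducedPath I.AdjNat (deletedOf σ) (σ.var .a) (σ.var .b) c := by
  rw [← h.n]
  refine eval_find (by decide) (by decide) fun i hi j => ?_
  rw [T_pathE ((h.set rfl j).set rfl i) (by simpa using hm) (by simpa using ha)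
    (by simpa using hb) (by simpa [← h.n] using hi), deletedOf_set (by decide),
    deletedOf_set (by decide)]
  simp

theorem deletedOf_push (σ : St) (a : ℕ) :
    deletedOf ((σ.put .xs (σ.var .m) a).set .m (σ.var .m + 1)) = deletedOf σ ++ [a] := by
  simp only [deletedOf, St.set_var, if_true, St.set_arr, St.put_arr, List.range_succ,
    List.map_append, List.map_cons, List.map_nil, Function.update_self]
  congr 1
  refine List.map_congr_left fun i hi => ?_
  rw [Function.update_of_ne (List.mem_range.1 hi).ne]

theorem deletedOf_run_deleteS (h : Ready I p σ) (hm : σ.var .m ≤ p) :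
    deletedOf (deleteS.run σ) =
      deleteStep I.AdjNat I.n (σ.arr .g (σ.var .r)) (deletedOf σ) := by
  have hlt : ∀ (σ : St) (e f : Expr), (e.lt f).eval σ = 0 ↔ ¬e.eval σ < f.eval σ := fun σ e f => by
    rw [← T_lt, Expr.T, not_not]
  rw [deleteS, Stmt.run, Stmt.run, Stmt.run, eval_findA h hm]
  set a := leastBelow I.n fun a => ∃ b < I.n, ∃ c < I.n,
    InducedPath I.AdjNat (deletedOf σ) a b c with ha
  have h1 : Ready I p (σ.set .a a) := h.set rfl a
  have hd1 : deletedOf (σ.set .a a) = deletedOf σ := deletedOf_set (by decide) a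
  simp only [hlt, Expr.eval, h1.n]
  by_cases han : a < I.n
  · rw [if_neg (by simpa using han), Stmt.run, Stmt.run,
      eval_findB h1 (by simpa using hm) (by simpa using han), hd1, St.set_var, if_pos rfl]
    set b := leastBelow I.n fun b => ∃ c < I.n, InducedPath I.AdjNat (deletedOf σ) a b c with hb
    have hbn : b < I.n := leastBelow_lt_iff.2 (leastBelow_spec (leastBelow_lt_iff.1 han))
    have h2 : Ready I p ((σ.set .a a).set .b b) := h1.set rfl b
    have hd2 : deletedOf ((σ.set .a a).set .b b) = deletedOf σ :=
      (deletedOf_set (by decide) b).trans hd1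
    rw [Stmt.run, Stmt.run, eval_findC h2 (by simpa using hm) (by simpa using han)
      (by simpa using hbn), hd2]
    simp only [St.set_var, reduceCtorEq, if_true, if_false]
    set c := leastBelow I.n fun c => InducedPath I.AdjNat (deletedOf σ) a b c with hc
    have hstep : deleteStep I.AdjNat I.n (σ.arr .g (σ.var .r)) (deletedOf σ) = deletedOf σ ++
        [if σ.arr .g (σ.var .r) = 0 then a else if σ.arr .g (σ.var .r) = 1 then b else c] :=
      if_pos han
    have heq : ∀ (σ : St) (e f : Expr), (e.eq f).eval σ = 0 ↔ ¬e.eval σ = f.eval σ :=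
      fun σ e f => by rw [← T_eq, Expr.T, not_not]
    set τ := ((σ.set .a a).set .b b).set .c c with hτ
    have hg : τ.arr .g (τ.var .r) = σ.arr .g (σ.var .r) := by simp [hτ]
    have hdτ : deletedOf τ = deletedOf σ := (deletedOf_set (by decide) c).trans hd2
    rw [hstep, ← hdτ, ← hg, Stmt.run]
    have hput : ∀ (x : Var) (τ' : St), τ' = (Stmt.put .xs (.var .m) (.var x)).run τ →
        deletedOf ((Stmt.assign .m (.add (.var .m) (.const 1))).run τ') =
          deletedOf τ ++ [τ.var x] := by
      rintro x _ rfl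
      exact deletedOf_push τ _
    have hta : τ.var .a = a := by simp [hτ]
    have htb : τ.var .b = b := by simp [hτ]
    have htc : τ.var .c = c := by simp [hτ]
    by_cases h0 : τ.arr .g (τ.var .r) = 0
    · rw [if_pos h0, ← hta]
      exact hput .a _ (if_pos h0)
    · rw [if_neg h0]
      by_cases h10 : τ.arr .g (τ.var .r) = 1
      · rw [if_pos h10, ← htb]
        exact hput .b _ ((if_neg h0).trans (if_neg (by rw [heq, not_not]; exact h10)))
      · rw [if_neg h10, ← htc]
        exact hput .c _ ((if_neg h0).trans (if_pos (by rw [heq]; exact h10)))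
  · rw [if_pos (by simpa using han), Stmt.run, hd1]
    exact (if_neg han).symm

theorem deletedOf_iter_deleteS (h : Ready I p σ) (hm : σ.var .m = 0) {r : ℕ} (hr : r ≤ p) :
    deletedOf (deleteS.iter .r σ r) = deleteRun I.AdjNat I.n (σ.arr .g) r := by
  induction r with
  | zero => simp [deletedOf, hm, deleteRun]
  | succ r ih =>
    have ih := ih (by omega)
    have h1 : Ready I p (deleteS.iter .r σ r) := h.iter rfl rfl rfl rfl r
    have hmr : (deleteS.iter .r σ r).var .m ≤ r := by
      rw [← length_deletedOf, ih]
      exact (deleteRun_spec _ _ _ _).2.1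
    have hg : (deleteS.iter .r σ r).arr .g = σ.arr .g :=
      Stmt.iter_arr (Stmt.run_arr rfl) σ r
    rw [Stmt.iter_succ, deletedOf_run_deleteS (h1.set rfl r) (by simp; omega),
      deletedOf_set (by decide), ih, St.set_arr, hg, St.set_var, if_pos rfl]
    rfl

end Imp

/-! ### The program: refinement -/

namespace Imp

open Branching

variable {I : TMSInstance} {p : ℕ} {σ : St}

theorem eval_add (e f : Expr) (σ : St) : (e.add f).eval σ = e.eval σ + f.eval σ := rfl

/-- The state during the refinement. -/
structure Refining (I : TMSInstance) (p : ℕ) (σ : St) : Prop where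
  ready : Ready I p σ
  m_le : σ.var .m ≤ p
  deleted_lt : ∀ x ∈ deletedOf σ, x < I.n
  -- A bound monitor has a genuine vertex as its centre, so the look-up in the distance table is
  -- meaningful; unbound centres are never evaluated semantically.
  cc_lt : ∀ i < I.k, σ.arr .kd i = 0 ∨ σ.arr .cc i < I.n

/-- The search data of the state. -/
noncomputable def dataOf (I : TMSInstance) (p : ℕ) (σ : St) : Data :=
  I.data p (deletedOf σ) (σ.arr .g)

/-- The bindings of the state. -/
def bindings (σ : St) : (ℕ → ℕ) × (ℕ → ℕ) := (σ.arr .kd, σ.arr .cc)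

theorem dataOf_set {x : Var} (hx : Var.m ≠ x) (a : ℕ) :
    dataOf I p (σ.set x a) = dataOf I p σ := by
  rw [dataOf, dataOf, deletedOf_set hx, St.set_arr]

theorem bindings_set (x : Var) (a : ℕ) : bindings (σ.set x a) = bindings σ := rfl

theorem Refining.set (h : Refining I p σ) {x : Var} (hx : params x = false) (hm : Var.m ≠ x)
    (a : ℕ) : Refining I p (σ.set x a) where
  ready := h.ready.set hx a
  m_le := by simpa [hm] using h.m_le
  deleted_lt := by rw [deletedOf_set hm]; exact h.deleted_lt
  cc_lt := h.cc_lt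

theorem T_candE (h : Refining I p σ) (hi : σ.var .i < I.k) (hw : σ.var .w < I.n) :
    candE.T σ ↔ (dataOf I p σ).Cand (bindings σ) (σ.var .i) (σ.var .w) := by
  have hm := h.m_le
  have hk := h.ready.k_le
  rw [candE, T_and, T_all, h.ready.hp, T_or, T_isz, T_get, not_not, T_le, Data.Cand]
  refine and_congr ?_ ?_
  · change _ ↔ ∀ j < (deletedOf σ).length, I.distNat (3 * p + 3) (σ.var .w)
      ((deletedOf σ).getD j 0) = if σ.var .i < p ∧ j < p then _ else 0
    rw [length_deletedOf]
    have hstep : ∀ j < σ.var .m, ((distE (.var .w) (.get .xs (.var .j))).eval (σ.set .j j) =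
        (Expr.get .g (((Expr.var .p).add ((Expr.var .i).mul .p)).add (.var .j))).eval (σ.set .j j) ↔
        I.distNat (3 * p + 3) (σ.var .w) ((deletedOf σ).getD j 0) =
          if σ.var .i < p ∧ j < p then σ.arr .g (p + p * σ.var .i + j) else 0) := by
      intro j hj
      have hx : σ.arr .xs j < I.n := h.deleted_lt _ (List.mem_map.2 ⟨j, List.mem_range.2 hj, rfl⟩)
      rw [eval_distE (h.ready.set rfl j) (by simp [Expr.eval]) (by simpa [Expr.eval] using hw)
        (by simpa [Expr.eval] using hx), getD_deletedOf hj, if_pos ⟨by omega, by omega⟩]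
      simp [Expr.eval, Expr.mul, h.ready.hp]
    constructor
    · intro h1 j hj
      rw [← hstep j hj]
      have h2 := h1 j (by omega)
      rw [T_or, T_le, T_eq] at h2
      refine h2.resolve_left ?_
      simp [Expr.eval]
      omega
    · intro h1 j _
      rw [T_or, T_le, T_eq]
      by_cases hj : j < σ.var .m
      · exact .inr ((hstep j hj).2 (h1 j hj))
      · refine .inl ?_
        simp [Expr.eval]
        omega
  · change (σ.arr .kd (σ.var .i) = 0 ∨ _) ↔ (σ.arr .kd (σ.var .i) = 0 ∨
      I.distNat (3 * p + 3) (σ.arr .cc (σ.var .i)) (σ.var .w) + σ.arr .kd (σ.var .i) ≤ 2)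
    by_cases h0 : σ.arr .kd (σ.var .i) = 0
    · simp [h0]
    · have hcc := (h.cc_lt _ hi).resolve_left h0
      rw [eval_add, eval_distE (a := .get .cc (.var .i)) (b := .var .w) h.ready
        (by simp [Expr.eval]) hcc hw]
      rfl

theorem T_monE (h : Ready I p σ) {l : List ℕ} {g : ℕ → ℕ} (hu : σ.var .u < I.n)
    (hv : σ.var .v < I.n) (hw : σ.var .w < I.n) :
    monE.T σ ↔ (I.data p l g).Mon (σ.var .u) (σ.var .w) (σ.var .v) := by
  rw [monE, T_and, T_lt, T_eq, eval_add, eval_distE (a := .var .u) (b := .var .v) h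
    (by simp [Expr.eval]) hu hv,
    eval_distE (a := .var .u) (b := .var .w) h (by simp [Expr.eval]) hu hw,
    eval_distE (a := .var .w) (b := .var .v) h (by simp [Expr.eval]) hw hv,
    show (Expr.var .cap).eval σ = _ from h.cap]
  rfl

theorem T_badE (h : Refining I p σ) (hu : σ.var .u < I.n) (hv : σ.var .v < I.n) :
    badE.T σ ↔ (dataOf I p σ).Bad (bindings σ) (σ.var .u) (σ.var .v) := by
  rw [badE, T_and, T_pairE h.ready.toLocated (by decide) hu hv, T_all, h.ready.k]
  refine and_congr_right fun _ => forall₂_congr fun i hi => ?_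
  have h1 := h.set (x := .i) rfl (by decide) i
  have hk : i < I.k := hi
  have hcand : ∀ w < I.n, (candE.T ((σ.set .i i).set .w w) ↔
      (dataOf I p σ).Cand (bindings σ) i w) := by
    intro w hw
    rw [T_candE (h1.set (x := .w) rfl (by decide) w) (by simpa using hk) (by simpa using hw),
      dataOf_set (by decide), dataOf_set (by decide)]
    simp [bindings_set]
  rw [T_isz, T_and, T_ex, T_all]
  have hn : (σ.set .i i).var .n = I.n := h1.ready.n
  rw [hn]
  refine not_congr (and_congr (exists_congr fun w => and_congr_right fun hw => hcand w hw)
    (forall₂_congr fun w hw => ?_))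
  rw [T_or, T_isz, hcand w hw, T_monE (l := deletedOf σ) (g := σ.arr .g)
    (h1.ready.set (x := .w) rfl w) (by simpa using hu) (by simpa using hv) (by simpa using hw)]
  simp only [St.set_var, reduceCtorEq, if_true, if_false]
  rw [imp_iff_not_or]
  rfl

theorem T_ex_badE (h : Refining I p σ) (hu : σ.var .u < I.n) :
    (Expr.ex .v .n badE).T σ ↔
      ∃ v < I.n, (dataOf I p σ).Bad (bindings σ) (σ.var .u) v := by
  rw [T_ex, h.ready.n]
  refine exists_congr fun v => and_congr_right fun hv => ?_
  rw [T_badE (h.set (x := .v) rfl (by decide) v) (by simpa using hu) (by simpa using hv),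
    dataOf_set (by decide)]
  simp [bindings_set]

theorem T_ex_ex_badE (h : Refining I p σ) :
    (Expr.ex .u .n (.ex .v .n badE)).T σ ↔ ¬(dataOf I p σ).Good (bindings σ) := by
  rw [T_ex, h.ready.n, Data.Good, not_not]
  refine exists_congr fun u => and_congr_right fun hu => ?_
  rw [T_ex_badE (h.set (x := .u) rfl (by decide) u) (by simpa using hu), dataOf_set (by decide)]
  simp [bindings_set]
  rfl

theorem eval_findU (h : Refining I p σ) :
    (Expr.find .u .n (.ex .v .n badE)).eval σ =
      leastBelow I.n fun u => ∃ v < I.n, (dataOf I p σ).Bad (bindings σ) u v := by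
  rw [← h.ready.n]
  refine eval_find (by decide) (by decide) fun i hi j => ?_
  rw [T_ex_badE ((h.set (x := .y) rfl (by decide) j).set (x := .u) rfl (by decide) i)
    (by simpa [← h.ready.n] using hi), dataOf_set (by decide), dataOf_set (by decide), h.ready.n]
  simp [bindings_set]

theorem eval_findV (h : Refining I p σ) (hu : σ.var .u < I.n) :
    (Expr.find .v .n badE).eval σ =
      leastBelow I.n fun v => (dataOf I p σ).Bad (bindings σ) (σ.var .u) v := by
  rw [← h.ready.n]
  refine eval_find (by decide) (by decide) fun i hi j => ?_
  rw [T_badE ((h.set (x := .y) rfl (by decide) j).set (x := .v) rfl (by decide) i)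
    (by simpa using hu) (by simpa [← h.ready.n] using hi), dataOf_set (by decide),
    dataOf_set (by decide)]
  simp [bindings_set]

/-- The bindings agree for the first `k` monitors. -/
def Agree (k : ℕ) (q q' : (ℕ → ℕ) × (ℕ → ℕ)) : Prop :=
  (∀ i < k, q.1 i = q'.1 i) ∧ ∀ i < k, q.2 i = q'.2 i

/-- Array entries from `k` on may be left over from earlier trials, and a digit may name a monitor
beyond `k`. Neither affects the candidates of the first `k` monitors. -/
theorem Agree.refineStep {S : Data} {q q' : (ℕ → ℕ) × (ℕ → ℕ)} (h : Agree S.k q q') (e : ℕ × ℕ) :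
    Agree S.k (S.refineStep e q) (S.refineStep e q') := by
  rw [Data.refineStep, Data.refineStep, Data.bad_congr h.1 h.2]
  split_ifs
  on_goal 3 => exact h
  all_goals
    refine ⟨fun i hi => ?_, fun i hi => ?_⟩
    · by_cases hie : i = e.1
      · subst hie
        simp [h.1 _ hi]
      · simp [Function.update_of_ne hie, h.1 _ hi]
    · by_cases hie : i = e.1
      · subst hie
        simp
      · simp [Function.update_of_ne hie, h.2 _ hi]

theorem good_congr {S : Data} {q q' : (ℕ → ℕ) × (ℕ → ℕ)} (h : Agree S.k q q') :
    S.Good q ↔ S.Good q' := by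
  rw [Data.Good, Data.Good, Data.bad_congr h.1 h.2]

theorem bindings_run_refineS (h : Refining I p σ) :
    bindings (refineS.run σ) = (dataOf I p σ).refineStep
      (TMSInstance.choice p (σ.arr .g) (σ.var .r)) (bindings σ) := by
  have hlt : ∀ (σ : St) (e f : Expr), (e.lt f).eval σ = 0 ↔ ¬e.eval σ < f.eval σ := fun σ e f => by
    rw [← T_lt, Expr.T, not_not]
  rw [refineS, Stmt.run, Stmt.run, Stmt.run, eval_findU h]
  set u := leastBelow I.n fun u => ∃ v < I.n, (dataOf I p σ).Bad (bindings σ) u v with hu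
  have h1 : Refining I p (σ.set .u u) := h.set rfl (by decide) u
  simp only [hlt, Expr.eval, h1.ready.n]
  by_cases hun : u < I.n
  · rw [if_neg (by simpa using hun), Stmt.run, Stmt.run,
      eval_findV h1 (by simpa using hun), dataOf_set (by decide), St.set_var, if_pos rfl,
      bindings_set]
    set v := leastBelow I.n fun v => (dataOf I p σ).Bad (bindings σ) u v with hv
    have hstep : (dataOf I p σ).refineStep (TMSInstance.choice p (σ.arr .g) (σ.var .r))
        (bindings σ) = (Function.update (σ.arr .kd) (σ.arr .g (p + p * p + σ.var .r))
          (σ.arr .kd (σ.arr .g (p + p * p + σ.var .r)) + 1),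
        Function.update (σ.arr .cc) (σ.arr .g (p + p * p + σ.var .r))
          (if σ.arr .g (3 * p + p * p + σ.var .r) = 0 then u else v)) := if_pos hun
    rw [hstep, Stmt.run]
    set i := σ.arr .g (p + p * p + σ.var .r) with hi
    have hi' : (Stmt.assign .i (.get .g (((Expr.var .p).add ((Expr.var .p).mul .p)).add
        (.var .r)))).run ((σ.set .u u).set .v v) = ((σ.set .u u).set .v v).set .i i := by
      rw [Stmt.run]
      congr 1
      simp [Expr.eval, Expr.mul, h.ready.hp, hi]
    rw [hi']
    have he : (Expr.get .g (((((Expr.var .p).add (.var .p)).add (.var .p)).add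
        ((Expr.var .p).mul .p)).add (.var .r))).eval (((σ.set .u u).set .v v).set .i i) =
        σ.arr .g (3 * p + p * p + σ.var .r) := by
      simp [Expr.eval, Expr.mul, h.ready.hp]
      congr 1
      ring
    rw [Stmt.run]
    by_cases h0 : σ.arr .g (3 * p + p * p + σ.var .r) = 0
    · rw [if_pos h0]
      have hs : (Stmt.ite (.get .g (((((Expr.var .p).add (.var .p)).add (.var .p)).add
        ((Expr.var .p).mul .p)).add (.var .r))) (.put .cc (.var .i) (.var .v))
        (.put .cc (.var .i) (.var .u))).run (((σ.set .u u).set .v v).set .i i) =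
        (((σ.set .u u).set .v v).set .i i).put .cc i u := if_pos (he.trans h0)
      rw [hs]
      simp [Stmt.run, bindings, Expr.eval]
    · rw [if_neg h0]
      have hs : (Stmt.ite (.get .g (((((Expr.var .p).add (.var .p)).add (.var .p)).add
        ((Expr.var .p).mul .p)).add (.var .r))) (.put .cc (.var .i) (.var .v))
        (.put .cc (.var .i) (.var .u))).run (((σ.set .u u).set .v v).set .i i) =
        (((σ.set .u u).set .v v).set .i i).put .cc i v := if_neg (by rw [he]; exact h0)
      rw [hs]
      simp [Stmt.run, bindings, Expr.eval]
  · rw [if_pos (by simpa using hun), Stmt.run, bindings_set]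
    exact (if_neg hun).symm

theorem deletedOf_congr {σ' : St} (hm : σ'.var .m = σ.var .m) (hx : σ'.arr .xs = σ.arr .xs) :
    deletedOf σ' = deletedOf σ := by
  rw [deletedOf, deletedOf, hm, hx]

theorem dataOf_run_refineS (σ : St) : dataOf I p (refineS.run σ) = dataOf I p σ := by
  rw [dataOf, dataOf, deletedOf_congr (Stmt.run_var rfl σ) (Stmt.run_arr rfl σ),
    Stmt.run_arr rfl σ]

theorem Refining.run_refineS (h : Refining I p σ) : Refining I p (refineS.run σ) where
  ready := h.ready.run rfl rfl rfl
  m_le := by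
    have : (refineS.run σ).var .m = σ.var .m := Stmt.run_var rfl σ
    rw [this]
    exact h.m_le
  deleted_lt := by
    rw [deletedOf_congr (Stmt.run_var rfl σ) (Stmt.run_arr rfl σ)]
    exact h.deleted_lt
  cc_lt := by
    change ∀ i < I.k, (bindings (refineS.run σ)).1 i = 0 ∨ (bindings (refineS.run σ)).2 i < I.n
    rw [bindings_run_refineS h]
    by_cases hg : (dataOf I p σ).Good (bindings σ)
    · rw [Data.refineStep_of_good hg]
      exact h.cc_lt
    · obtain ⟨u, hu, v, hv, -, he⟩ := Data.exists_refineStep_eq hg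
      rw [he]
      intro i hi
      by_cases hie : i = (TMSInstance.choice p (σ.arr .g) (σ.var .r)).1
      · subst hie
        simp only [Function.update_self]
        right
        split_ifs
        · exact hu
        · exact hv
      · simp only [Function.update_of_ne hie]
        exact h.cc_lt i hi

theorem refining_iter_refineS (h : Refining I p σ)
    (h0 : ∀ i < I.k, σ.arr .kd i = 0 ∧ σ.arr .cc i = 0)
    (r : ℕ) :
    Refining I p (refineS.iter .r σ r) ∧ dataOf I p (refineS.iter .r σ r) = dataOf I p σ ∧
      Agree I.k (bindings (refineS.iter .r σ r))
        ((dataOf I p σ).refineRun (TMSInstance.choice p (σ.arr .g)) r) := by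
  induction r with
  | zero => exact ⟨h, rfl, fun i hi => (h0 i hi).1, fun i hi => (h0 i hi).2⟩
  | succ r ih =>
    obtain ⟨h1, h2, h3⟩ := ih
    have hg : (refineS.iter .r σ r).arr .g = σ.arr .g := Stmt.iter_arr (Stmt.run_arr rfl) σ r
    have h4 := h1.set (x := .r) rfl (by decide) r
    rw [Stmt.iter_succ]
    refine ⟨h4.run_refineS, ?_, ?_⟩
    · rw [dataOf_run_refineS, dataOf_set (by decide), h2]
    · rw [bindings_run_refineS h4, dataOf_set (by decide), h2, bindings_set, St.set_arr, hg,
        St.set_var, if_pos rfl]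
      exact Agree.refineStep (S := dataOf I p σ) h3 _

end Imp

/-! ### The program: trying all choices -/

namespace Imp

open Branching

variable {I : TMSInstance} {p : ℕ} {σ : St}

/-- Write the digits of `s` in base `B` to the array `g`. -/
def digitS : Stmt :=
  .seq (.put .g (.var .j) (.sub (.var .s) ((Expr.div (.var .s) .B .N).mul .B)))
    (.assign .s (.div (.var .s) .B .N))

/-- Forget the bindings. -/
def clearS : Stmt := .seq (.put .kd (.var .i) (.const 0)) (.put .cc (.var .i) (.const 0))

def judgeS : Stmt :=
  .ite (.ex .a .n (.ex .b .n (.ex .c .n pathE))) .skip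
    (.seq (.ite (.ex .u .n (.ex .v .n badE)) .skip (.assign .yes (.const 1)))
      (.ite (.lt (.var .m) (.var .d)) (.assign .early (.const 1)) .skip))

/-- Try the choices given by the digits of `t`. -/
def tryS : Stmt :=
  .seq (.assign .s (.var .t)) (.seq (.loop .j .M digitS) (.seq (.assign .m (.const 0))
    (.seq (.loop .r .d deleteS) (.seq (.loop .i .p clearS) (.seq (.loop .r .p2 refineS) judgeS)))))

/-- The digits of `t` in base `B`. -/
def digits (B t j : ℕ) : ℕ := t / B ^ j % B

theorem isDigits_digits {p t : ℕ} (ht : t < (3 * p + 4) ^ (p * p + 5 * p)) :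
    TMSInstance.IsDigits p (digits (3 * p + 4) t) := by
  refine ⟨fun j => Nat.mod_lt _ (by omega), fun j hj => ?_⟩
  rw [digits, Nat.div_eq_of_lt, Nat.zero_mod]
  exact ht.trans_le (Nat.pow_le_pow_right (by omega) hj)

/-- Base-`B` expansion, built from the lowest digit: counting `t` up to `B ^ M` thus runs through
all digit vectors. -/
theorem exists_digits_eq {B : ℕ} (hB : 0 < B) (M : ℕ) {g : ℕ → ℕ} (h1 : ∀ j, g j < B)
    (h2 : ∀ j, M ≤ j → g j = 0) : ∃ t < B ^ M, digits B t = g := by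
  induction M generalizing g with
  | zero =>
    refine ⟨0, by simp, ?_⟩
    funext j
    simp [digits, h2 j (Nat.zero_le j)]
  | succ M ih =>
    obtain ⟨t, ht, hg⟩ := ih (g := fun j => g (j + 1)) (fun j => h1 _) fun j hj => h2 _ (by omega)
    refine ⟨g 0 + B * t, ?_, ?_⟩
    · have h3 : B * (t + 1) ≤ B * B ^ M := Nat.mul_le_mul_left _ ht
      have := h1 0
      rw [Nat.pow_succ', Nat.mul_add] at *
      omega
    · funext j
      cases j with
      | zero => simp [digits, Nat.mod_eq_of_lt (h1 0)]
      | succ j =>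
        rw [← congrFun hg j, digits, digits, Nat.pow_succ', ← Nat.div_div_eq_div_mul,
          Nat.add_mul_div_left _ _ hB, Nat.div_eq_of_lt (h1 0), Nat.zero_add]

/-- The remainder is obtained as `s - B * (s / B)`, and `N > s` is a sufficient loop bound for the
quotient. -/
theorem run_digitS (h : Ready I p σ) (hs : σ.var .s < σ.var .N) :
    digitS.run σ = (σ.put .g (σ.var .j) (σ.var .s % σ.var .B)).set .s (σ.var .s / σ.var .B) := by
  have hB : 0 < σ.var .B := by rw [h.B]; omega
  have hle : σ.var .s / σ.var .B ≤ σ.var .N := (Nat.div_le_self _ _).trans hs.le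
  have hd : ∀ τ : St, τ.var = σ.var →
      (Expr.div (.var .s) .B .N).eval τ = σ.var .s / σ.var .B := by
    intro τ hτ
    rw [← hτ] at hB hle ⊢
    exact eval_div (by decide) hB (by simp [Expr.eval]) hle
  have hm : ((Expr.div (.var .s) .B .N).mul .B).eval σ = σ.var .B * (σ.var .s / σ.var .B) := by
    refine eval_mul fun i => ?_
    exact (eval_div (σ := σ.set .z i) (a := σ.var .s) (by decide) (by simpa using hB)
      (by simp [Expr.eval])
      (by simpa using hle)).trans (by simp)
  rw [digitS, Stmt.run, Stmt.run, Stmt.run, hd (σ.put .g _ _) rfl]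
  congr 2
  rw [Expr.eval, hm]
  have := Nat.div_add_mod (σ.var .s) (σ.var .B)
  simp only [Expr.eval]
  omega

theorem iter_digitS (h : Ready I p σ) (hs : σ.var .s < σ.var .N) (j : ℕ) :
    (digitS.iter .j σ j).var .s = σ.var .s / σ.var .B ^ j ∧
      (digitS.iter .j σ j).arr .g =
        fun i => if i < j then digits (σ.var .B) (σ.var .s) i else σ.arr .g i := by
  induction j with
  | zero => simp
  | succ j ih =>
    have h1 : Ready I p (digitS.iter .j σ j) := h.iter rfl rfl rfl rfl j
    have hB : (digitS.iter .j σ j).var .B = σ.var .B := h1.B.trans h.B.symm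
    have hN : (digitS.iter .j σ j).var .N = σ.var .N := h1.N.trans h.N.symm
    rw [Stmt.iter_succ, run_digitS (h1.set rfl j)
      (by simpa [ih.1, hN] using (Nat.div_le_self _ _).trans_lt hs)]
    simp only [St.set_var, St.set_arr, St.put_arr, St.put_var, reduceCtorEq, if_true, if_false,
      ih.1, ih.2, hB]
    refine ⟨by rw [Nat.pow_succ, Nat.div_div_eq_div_mul], ?_⟩
    funext i
    rcases lt_trichotomy i j with hij | rfl | hij
    · rw [Function.update_of_ne hij.ne, if_pos hij, if_pos (by omega)]
    · rw [Function.update_self, if_pos (by omega), digits]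
    · rw [Function.update_of_ne hij.ne', if_neg (by omega), if_neg (by omega)]

theorem iter_clearS (σ : St) (j : ℕ) :
    ∀ i < j, (clearS.iter .i σ j).arr .kd i = 0 ∧ (clearS.iter .i σ j).arr .cc i = 0 := by
  induction j with
  | zero => simp
  | succ j ih =>
    intro i hi
    rw [Stmt.iter_succ]
    simp only [clearS, Stmt.run, Expr.eval, St.put_arr, St.put_var, St.set_var, St.set_arr,
      reduceCtorEq, if_true, if_false]
    by_cases hij : i = j
    · subst hij
      simp
    · rw [Function.update_of_ne hij, Function.update_of_ne hij]
      exact ih i (by omega)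

theorem run_judgeS (h : Refining I p σ) {yes early : Prop} (hy : σ.var .yes ≠ 0 ↔ yes)
    (he : σ.var .early ≠ 0 ↔ early) :
    ((judgeS.run σ).var .yes ≠ 0 ↔ yes ∨ IsDeletionList I.AdjNat I.n (deletedOf σ) ∧
        (dataOf I p σ).Good (bindings σ)) ∧
      ((judgeS.run σ).var .early ≠ 0 ↔ early ∨ IsDeletionList I.AdjNat I.n (deletedOf σ) ∧
        (deletedOf σ).length < p - I.k) := by
  have h1 := T_ex_ex_ex_pathE h.ready h.m_le
  have h2 := T_ex_ex_badE h
  rw [Expr.T] at h1 h2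
  rw [judgeS, Stmt.run]
  by_cases hd : IsDeletionList I.AdjNat I.n (deletedOf σ)
  · rw [if_pos (by simpa [hd] using h1), Stmt.run]
    have h3 : ∀ τ : St, τ.var .m = σ.var .m → τ.var .d = σ.var .d →
        ((Expr.lt (.var .m) (.var .d)).eval τ = 0 ↔ ¬(deletedOf σ).length < p - I.k) := by
      intro τ hm hd
      rw [length_deletedOf, ← hm, ← h.ready.d, ← hd, ← not_iff_not, not_not]
      exact T_lt _ _ _
    by_cases hg : (dataOf I p σ).Good (bindings σ)
    · have h4 : (Stmt.ite (.ex .u .n (.ex .v .n badE)) .skip (.assign .yes (.const 1))).run σ =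
        σ.set .yes 1 := if_pos (by simpa [hg] using h2)
      rw [h4, Stmt.run]
      by_cases hl : (deletedOf σ).length < p - I.k
      · rw [if_neg (by rw [h3 _ (by simp) (by simp), not_not]; exact hl)]
        simp [Stmt.run, Expr.eval, hd, hg, hl]
      · rw [if_pos ((h3 _ (by simp) (by simp)).2 hl)]
        simpa [Stmt.run, Expr.eval, hd, hg, hl] using he
    · have h4 : (Stmt.ite (.ex .u .n (.ex .v .n badE)) .skip (.assign .yes (.const 1))).run σ =
        σ := if_neg (by simpa [hg] using h2)
      rw [h4, Stmt.run]
      by_cases hl : (deletedOf σ).length < p - I.k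
      · rw [if_neg (by rw [h3 _ rfl rfl, not_not]; exact hl)]
        simpa [Stmt.run, Expr.eval, hd, hg, hl] using hy
      · rw [if_pos ((h3 _ rfl rfl).2 hl)]
        simpa [Stmt.run, Expr.eval, hd, hg, hl] using ⟨hy, he⟩
  · rw [if_neg (by simpa [hd] using h1)]
    simpa [Stmt.run, hd] using ⟨hy, he⟩

/-- The two flags only ever accumulate. That `g` vanishes from position `M` on is carried along
because each trial overwrites just the first `M` digits. -/
theorem run_tryS (h : Ready I p σ) (hg : ∀ j, p * p + 5 * p ≤ j → σ.arr .g j = 0)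
    (ht : σ.var .t < (3 * p + 4) ^ (p * p + 5 * p)) {yes early : Prop}
    (hy : σ.var .yes ≠ 0 ↔ yes) (he : σ.var .early ≠ 0 ↔ early) :
    (∀ j, p * p + 5 * p ≤ j → (tryS.run σ).arr .g j = 0) ∧
      ((tryS.run σ).var .yes ≠ 0 ↔ yes ∨ I.Succeeds p (digits (3 * p + 4) (σ.var .t))) ∧
      ((tryS.run σ).var .early ≠ 0 ↔
        early ∨ I.SucceedsEarly p (digits (3 * p + 4) (σ.var .t))) := by
  obtain ⟨σ₁, h₁⟩ : ∃ τ, τ = (Stmt.loop .j .M digitS).run (σ.set .s (σ.var .t)) := ⟨_, rfl⟩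
  obtain ⟨σ₃, h₃⟩ : ∃ τ, τ = (Stmt.loop .r .d deleteS).run (σ₁.set .m 0) := ⟨_, rfl⟩
  obtain ⟨σ₄, h₄⟩ : ∃ τ, τ = (Stmt.loop .i .p clearS).run σ₃ := ⟨_, rfl⟩
  obtain ⟨σ₅, h₅⟩ : ∃ τ, τ = (Stmt.loop .r .p2 refineS).run σ₄ := ⟨_, rfl⟩
  have hrun : tryS.run σ = judgeS.run σ₅ := by
    rw [h₅, h₄, h₃, h₁]
    rfl
  have r₀ : Ready I p (σ.set .s (σ.var .t)) := h.set rfl _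
  have r₁ : Ready I p σ₁ := h₁ ▸ r₀.run rfl rfl rfl
  have r₃ : Ready I p σ₃ := h₃ ▸ (r₁.set (x := .m) rfl 0).run rfl rfl rfl
  have r₄ : Ready I p σ₄ := h₄ ▸ r₃.run rfl rfl rfl
  set g := digits (3 * p + 4) (σ.var .t) with hgdef
  have g₁ : σ₁.arr .g = g := by
    rw [h₁, Stmt.run_loop, (iter_digitS r₀ (by simpa [h.N] using ht) _).2]
    have hB : (σ.set .s (σ.var .t)).var .B = 3 * p + 4 := r₀.B
    have hM : (σ.set .s (σ.var .t)).var .M = p * p + 5 * p := r₀.M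
    rw [hB, hM]
    funext i
    split_ifs with hi
    · simp [hgdef]
    · rw [hgdef, (isDigits_digits ht).2 i (by omega), St.set_arr, hg i (by omega)]
  have d₃ : deletedOf σ₃ = I.deleted p g := by
    have hd : (σ₁.set .m 0).var .d = p - I.k := (r₁.set (x := .m) rfl 0).d
    rw [h₃, Stmt.run_loop, deletedOf_iter_deleteS (r₁.set rfl 0) (by simp) (by rw [hd]; omega),
      hd, St.set_arr, g₁]
    rfl
  have g₃ : σ₃.arr .g = g := by rw [h₃, Stmt.run_arr rfl, St.set_arr, g₁]
  have d₄ : deletedOf σ₄ = I.deleted p g :=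
    (deletedOf_congr (by rw [h₄, Stmt.run_var rfl]) (by rw [h₄, Stmt.run_arr rfl])).trans d₃
  have g₄ : σ₄.arr .g = g := by rw [h₄, Stmt.run_arr rfl, g₃]
  have z₄ : ∀ i < p, σ₄.arr .kd i = 0 ∧ σ₄.arr .cc i = 0 := by
    rw [h₄, Stmt.run_loop, r₃.hp]
    exact iter_clearS σ₃ p
  have hk := h.k_le
  obtain ⟨-, e2, e3⟩ := deleteRun_spec I.AdjNat I.n g (p - I.k)
  have f₄ : Refining I p σ₄ :=
    ⟨r₄, by rw [← length_deletedOf, d₄]; exact e2.trans (by omega), by rw [d₄]; exact e3,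
      fun i hi => .inl (z₄ i (by omega)).1⟩
  obtain ⟨f₅, D₅, A₅⟩ := refining_iter_refineS f₄ (fun i hi => z₄ i (by omega)) (σ₄.var .p2)
  rw [← Stmt.run_loop, ← h₅] at f₅ D₅ A₅
  have d₅ : deletedOf σ₅ = I.deleted p g :=
    (deletedOf_congr (by rw [h₅, Stmt.run_var rfl]) (by rw [h₅, Stmt.run_arr rfl])).trans d₄
  have g₅ : σ₅.arr .g = g := by rw [h₅, Stmt.run_arr rfl, g₄]
  have hv : ∀ x : Var, (Stmt.loop .j .M digitS).keeps x = true →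
      (Stmt.loop .r .d deleteS).keeps x = true →
      (Stmt.loop .i .p clearS).keeps x = true → (Stmt.loop .r .p2 refineS).keeps x = true →
      x ≠ .s → x ≠ .m → σ₅.var x = σ.var x := by
    intro x a1 a2 a3 a4 a5 a6
    rw [h₅, Stmt.run_var a4, h₄, Stmt.run_var a3, h₃, Stmt.run_var a2, St.set_var, if_neg a6, h₁,
      Stmt.run_var a1, St.set_var, if_neg a5]
  obtain ⟨j1, j2⟩ := run_judgeS f₅ (yes := yes) (early := early)
    (by rw [hv _ rfl rfl rfl rfl (by decide) (by decide)]; exact hy)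
    (by rw [hv _ rfl rfl rfl rfl (by decide) (by decide)]; exact he)
  rw [hrun]
  refine ⟨?_, ?_, ?_⟩
  · rw [Stmt.run_arr rfl, g₅]
    exact (isDigits_digits ht).2
  · rw [j1, d₅]
    have : (dataOf I p σ₅).Good (bindings σ₅) ↔ (I.data p (I.deleted p g) g).Good
        ((I.data p (I.deleted p g) g).refineRun (TMSInstance.choice p g) (2 * p)) := by
      rw [D₅]
      rw [dataOf, d₄, g₄, r₄.p2] at *
      exact good_congr (S := I.data p (I.deleted p g) g) A₅
    rw [this]
    rfl
  · rw [j2, d₅]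
    rfl

theorem iter_tryS (h : Ready I p σ) (hg : ∀ j, p * p + 5 * p ≤ j → σ.arr .g j = 0)
    (hy : σ.var .yes = 0) (he : σ.var .early = 0) {t : ℕ}
    (ht : t ≤ (3 * p + 4) ^ (p * p + 5 * p)) :
    (∀ j, p * p + 5 * p ≤ j → (tryS.iter .t σ t).arr .g j = 0) ∧
      ((tryS.iter .t σ t).var .yes ≠ 0 ↔ ∃ i < t, I.Succeeds p (digits (3 * p + 4) i)) ∧
      ((tryS.iter .t σ t).var .early ≠ 0 ↔
        ∃ i < t, I.SucceedsEarly p (digits (3 * p + 4) i)) := by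
  induction t with
  | zero => exact ⟨hg, by simp [hy], by simp [he]⟩
  | succ t ih =>
    obtain ⟨h1, h2, h3⟩ := ih (by omega)
    have hr : Ready I p (tryS.iter .t σ t) := h.iter rfl rfl rfl rfl t
    obtain ⟨h4, h5, h6⟩ := run_tryS (σ := (tryS.iter .t σ t).set .t t) (hr.set rfl t) h1
      (by simpa using ht) (by simpa using h2) (by simpa using h3)
    have hs : ∀ P : ℕ → Prop, ((∃ i < t, P i) ∨ P t) ↔ ∃ i < t + 1, P i := by
      intro P
      simp only [Nat.lt_succ_iff_lt_or_eq, or_and_right, exists_or, exists_eq_left]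
    rw [Stmt.iter_succ]
    refine ⟨h4, h5.trans ?_, h6.trans ?_⟩
    · rw [St.set_var, if_pos rfl]
      exact hs _
    · rw [St.set_var, if_pos rfl]
      exact hs _

theorem run_loop_tryS (h : Ready I p σ) (hg : ∀ j, p * p + 5 * p ≤ j → σ.arr .g j = 0)
    (hy : σ.var .yes = 0) (he : σ.var .early = 0) :
    (((Stmt.loop .t .N tryS).run σ).var .yes ≠ 0 ↔ ∃ g, TMSInstance.IsDigits p g ∧ I.Succeeds p g) ∧
      (((Stmt.loop .t .N tryS).run σ).var .early ≠ 0 ↔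
        ∃ g, TMSInstance.IsDigits p g ∧ I.SucceedsEarly p g) := by
  have hs : ∀ P : (ℕ → ℕ) → Prop, (∃ t < (3 * p + 4) ^ (p * p + 5 * p), P (digits (3 * p + 4) t)) ↔
      ∃ g, TMSInstance.IsDigits p g ∧ P g := by
    intro P
    constructor
    · rintro ⟨t, ht, hP⟩
      exact ⟨_, isDigits_digits ht, hP⟩
    · rintro ⟨g, hg, hP⟩
      obtain ⟨t, ht, rfl⟩ := exists_digits_eq (by omega) _ hg.1 hg.2
      exact ⟨t, ht, hP⟩
  obtain ⟨-, h1, h2⟩ := iter_tryS h hg hy he le_rfl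
  rw [Stmt.run_loop, h.N]
  exact ⟨h1.trans (hs _), h2.trans (hs _)⟩

end Imp

/-! ### The program: distances -/

namespace TMSInstance

variable {I : TMSInstance}

/-- The distance of `u` and `v` is at most `r`. -/
def Near (I : TMSInstance) (r u v : ℕ) : Prop :=
  ∃ (hu : u < I.n) (hv : v < I.n), I.G.edist ⟨u, hu⟩ ⟨v, hv⟩ ≤ r

theorem near_zero {u v : ℕ} (hu : u < I.n) (hv : v < I.n) : I.Near 0 u v ↔ u = v := by
  simp [Near, hu, hv]

theorem near_succ {r u v : ℕ} (hu : u < I.n) (hv : v < I.n) :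
    I.Near (r + 1) u v ↔ I.Near r u v ∨ ∃ w < I.n, I.Near r u w ∧ I.AdjNat w v := by
  simp only [Near, hu, hv, exists_true_left, AdjNat]
  rw [SimpleGraph.edist_le_succ_iff]
  refine or_congr_right ⟨?_, ?_⟩
  · rintro ⟨w, h1, h2⟩
    exact ⟨w, w.2, ⟨w.2, h1⟩, w.2, h2⟩
  · rintro ⟨w, hw, ⟨_, h1⟩, _, h2⟩
    exact ⟨⟨w, hw⟩, h1, h2⟩

theorem distNat_zero (u v : ℕ) : I.distNat 0 u v = 0 := Nat.le_zero.1 (distNat_le _ _ _)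

open scoped Classical in
theorem distNat_succ {r u v : ℕ} (hu : u < I.n) (hv : v < I.n) :
    I.distNat (r + 1) u v = I.distNat r u v + if I.Near r u v then 0 else 1 := by
  rw [distNat_eq _ hu hv, distNat_eq _ hu hv, SimpleGraph.cdist_succ]
  simp only [Near, hu, hv, exists_true_left]

end TMSInstance

theorem Nat.mul_add_inj_of_lt {n u v u' v' : ℕ} (hv : v < n) (hv' : v' < n)
    (h : n * u + v = n * u' + v') : u = u' ∧ v = v' := by
  have h1 : (n * u + v) / n = u := by
    rw [Nat.mul_add_div (by omega), Nat.div_eq_of_lt hv, Nat.add_zero]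
  have h2 : (n * u' + v') / n = u' := by
    rw [Nat.mul_add_div (by omega), Nat.div_eq_of_lt hv', Nat.add_zero]
  have h3 : u = u' := by rw [← h1, h, h2]
  subst h3
  exact ⟨rfl, by omega⟩

theorem Nat.mul_add_lt_mul_self {n u v : ℕ} (hu : u < n) (hv : v < n) : n * u + v < n * n := by
  have : n * (u + 1) ≤ n * n := Nat.mul_le_mul_left _ hu
  rw [Nat.mul_add] at this
  omega

namespace Imp

variable {I : TMSInstance} {σ : St}

theorem Located.congr (h : Located I σ) {σ' : St} (hn : σ'.var .n = σ.var .n)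
    (hnn : σ'.var .nn = σ.var .nn) (hi : σ'.arr .inp = σ.arr .inp) : Located I σ' where
  n := hn.trans h.n
  nn := hnn.trans h.nn
  adj := hi ▸ h.adj
  pair := hi ▸ h.pair

theorem Located.run (h : Located I σ) {s : Stmt} (hn : s.keeps .n = true)
    (hnn : s.keeps .nn = true) (hi : s.keepsArr .inp = true) : Located I (s.run σ) :=
  h.congr (Stmt.run_var hn σ) (Stmt.run_var hnn σ) (Stmt.run_arr hi σ)

theorem Located.set (h : Located I σ) {x : Var} (hn : Var.n ≠ x) (hnn : Var.nn ≠ x) (a : ℕ) :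
    Located I (σ.set x a) :=
  h.congr (by simp [hn]) (by simp [hnn]) rfl

/-! ### Filling the tables of a breadth-first search -/

/-- Fill the array with the values of the expression. -/
def fillS (a : Arr) (e : Expr) : Stmt := .loop .y .nn (.put a (.var .y) e)

/-- When cell `i` is filled, cells of the same array from `i` on are still old. The hypothesis lets
`e` use them, which covers updates in place such as incrementing each cell. -/
theorem run_fillS {a : Arr} {e : Expr} {F : ℕ → ℕ}
    (h : ∀ i < σ.var .nn, ∀ τ : St, τ.var = (σ.set .y i).var → (∀ b ≠ a, τ.arr b = σ.arr b) →
      (∀ j, i ≤ j → τ.arr a j = σ.arr a j) → e.eval τ = F i) :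
    ∀ i < σ.var .nn, ((fillS a e).run σ).arr a i = F i := by
  rw [fillS, Stmt.run_loop]
  suffices H : ∀ m ≤ σ.var .nn,
      (∀ x ≠ .y, ((Stmt.put a (.var .y) e).iter .y σ m).var x = σ.var x) ∧
      (∀ b ≠ a, ((Stmt.put a (.var .y) e).iter .y σ m).arr b = σ.arr b) ∧
      ∀ i, (i < m → ((Stmt.put a (.var .y) e).iter .y σ m).arr a i = F i) ∧
        (m ≤ i → ((Stmt.put a (.var .y) e).iter .y σ m).arr a i = σ.arr a i) from
    fun i hi => ((H _ le_rfl).2.2 i).1 hi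
  intro m
  induction m with
  | zero => simp
  | succ m ih =>
    intro hm
    obtain ⟨h1, h2, h3⟩ := ih (by omega)
    set τ := (Stmt.put a (.var .y) e).iter .y σ m with hτ
    have he : e.eval (τ.set .y m) = F m := by
      refine h m (by omega) _ ?_ h2 fun j hj => (h3 j).2 hj
      funext x
      rw [St.set_var, St.set_var]
      split_ifs with hx
      · rfl
      · exact h1 x hx
    have hs : (Stmt.put a (.var .y) e).iter .y σ (m + 1) = (τ.set .y m).put a m (F m) := by
      rw [Stmt.iter_succ, ← hτ, Stmt.run, he]
      simp [Expr.eval]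
    rw [hs]
    refine ⟨fun x hx => ?_, fun b hb => ?_, fun i => ?_⟩
    · rw [St.put_var, St.set_var, if_neg hx, h1 x hx]
    · rw [St.put_arr, if_neg hb, St.set_arr, h2 b hb]
    · rw [St.put_arr, if_pos rfl, St.set_arr]
      by_cases him : i = m
      · subst him
        simp
      · rw [Function.update_of_ne him]
        exact ⟨fun hi => (h3 i).1 (by omega), fun hi => (h3 i).2 (by omega)⟩

theorem eval_idxE (σ : St) {x y : Var} (hx : x ≠ .z) :
    (idxE (.var x) (.var y)).eval σ = σ.var .n * σ.var x + σ.var y := by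
  simp [idxE, Expr.mul, Expr.eval, hx]

/-- `y` is the index of a pair of vertices of distance `0`. -/
def nearZeroE : Expr := .ex .u .n (.eq (idxE (.var .u) (.var .u)) (.var .y))

/-- `y` is the index of a pair of vertices that are linked in one more step. -/
def nearSuccE : Expr :=
  .ex .u .n (.ex .v .n (.and (.eq (idxE (.var .u) (.var .v)) (.var .y))
    (.or (.get .R (.var .y))
      (.ex .w .n (.and (.get .R (idxE (.var .u) (.var .w))) (adjE (.var .w) (.var .v)))))))

def roundS : Stmt :=
  -- The distances are raised first, with the reachability of the current round. The new
  -- reachability goes through the buffer `R2`, since `R` is still read at other indices while it is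
  -- computed.
  .seq (fillS .D (.add (.get .D (.var .y)) (.isz (.get .R (.var .y)))))
    (.seq (fillS .R2 nearSuccE) (fillS .R (.get .R2 (.var .y))))

def tableS : Stmt :=
  .seq (fillS .R nearZeroE) (.seq (fillS .D (.const 0)) (.loop .r .cap roundS))

theorem run_nearZero (h : Located I σ) :
    ∀ u < I.n, ∀ v < I.n, ((fillS .R nearZeroE).run σ).arr .R (I.n * u + v) ≠ 0 ↔ I.Near 0 u v := by
  intro u hu v hv
  rw [run_fillS (F := fun i => nearZeroE.eval (σ.set .y i)) _ _
    (by rw [h.nn]; exact Nat.mul_add_lt_mul_self hu hv)]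
  · change nearZeroE.T _ ↔ _
    rw [nearZeroE, T_ex, TMSInstance.near_zero hu hv]
    simp only [T_eq, eval_idxE _ (show Var.u ≠ .z by decide), Expr.eval, St.set_var, h.n,
      reduceCtorEq, if_true, if_false]
    constructor
    · rintro ⟨w, hw, h⟩
      obtain ⟨rfl, rfl⟩ := Nat.mul_add_inj_of_lt hw hv h
      rfl
    · rintro rfl
      exact ⟨u, hu, rfl⟩
  · intro i _ τ hτ _ _
    simp [nearZeroE, Expr.ex, Expr.eval, Expr.eq, idxE, Expr.mul, hτ]

/-- The tables after `r` rounds. -/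
def Table (I : TMSInstance) (r : ℕ) (σ : St) : Prop :=
  ∀ u < I.n, ∀ v < I.n, (σ.arr .R (I.n * u + v) ≠ 0 ↔ I.Near r u v) ∧
    σ.arr .D (I.n * u + v) = I.distNat r u v

/-- The pair is recovered from its index `y` by search; it is unique because the second coordinate
is below `n`. -/
theorem T_nearSuccE (h : Located I σ) {r : ℕ}
    (hR : ∀ u < I.n, ∀ v < I.n, σ.arr .R (I.n * u + v) ≠ 0 ↔ I.Near r u v) {u v : ℕ}
    (hu : u < I.n) (hv : v < I.n) (hy : σ.var .y = I.n * u + v) :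
    nearSuccE.T σ ↔ I.Near (r + 1) u v := by
  have key : ∀ u' < I.n, ∀ v' < I.n, ((Expr.ex .w .n (.and (.get .R (idxE (.var .u) (.var .w)))
      (adjE (.var .w) (.var .v)))).T ((σ.set .u u').set .v v') ↔
      ∃ w < I.n, I.Near r u' w ∧ I.AdjNat w v') := by
    intro u' hu' v' hv'
    rw [T_ex]
    simp only [St.set_var, reduceCtorEq, if_false, h.n]
    refine exists_congr fun w => and_congr_right fun hw => ?_
    rw [T_and, T_get, eval_idxE _ (by decide), T_adjE ((((h.set (x := .u) (by decide) (by decide)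
      u').set (x := .v) (by decide) (by decide) v').set (x := .w) (by decide) (by decide) w))
      (by decide) (by simpa using hw) (by simpa using hv')]
    simp only [St.set_var, St.set_arr, reduceCtorEq, if_true, if_false, h.n]
    rw [hR u' hu' w hw]
  rw [TMSInstance.near_succ hu hv, ← hR u hu v hv, nearSuccE, T_ex, h.n]
  constructor
  · rintro ⟨u', hu', h1⟩
    rw [T_ex] at h1
    simp only [St.set_var, reduceCtorEq, if_false, h.n] at h1
    obtain ⟨v', hv', h1⟩ := h1
    rw [T_and, T_or, key u' hu' v' hv', T_eq, eval_idxE _ (by decide)] at h1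
    simp only [Expr.eval, St.set_var, St.set_arr, T_get, reduceCtorEq, if_true, if_false, h.n,
      hy] at h1
    obtain ⟨rfl, rfl⟩ := Nat.mul_add_inj_of_lt hv' hv h1.1
    exact h1.2
  · intro h1
    refine ⟨u, hu, ?_⟩
    rw [T_ex]
    simp only [St.set_var, reduceCtorEq, if_false, h.n]
    refine ⟨v, hv, ?_⟩
    rw [T_and, T_or, key u hu v hv, T_eq, eval_idxE _ (by decide)]
    simp only [Expr.eval, St.set_var, St.set_arr, T_get, reduceCtorEq, if_true, if_false, h.n, hy]
    exact ⟨trivial, h1⟩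

theorem Table.run_roundS {r : ℕ} (hT : Table I r σ) (h : Located I σ) :
    Table I (r + 1) (roundS.run σ) := by
  classical
  obtain ⟨σ₁, h₁⟩ : ∃ τ, τ = (fillS .D (.add (.get .D (.var .y)) (.isz (.get .R (.var .y))))).run σ :=
    ⟨_, rfl⟩
  obtain ⟨σ₂, h₂⟩ : ∃ τ, τ = (fillS .R2 nearSuccE).run σ₁ := ⟨_, rfl⟩
  have hrun : roundS.run σ = (fillS .R (.get .R2 (.var .y))).run σ₂ := by
    rw [h₂, h₁]
    rfl
  have l₁ : Located I σ₁ := h₁ ▸ h.run rfl rfl rfl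
  have l₂ : Located I σ₂ := h₂ ▸ l₁.run rfl rfl rfl
  have R₁ : σ₁.arr .R = σ.arr .R := by rw [h₁, Stmt.run_arr rfl]
  have D₁ : ∀ i < σ.var .nn, σ₁.arr .D i = σ.arr .D i + if σ.arr .R i = 0 then 1 else 0 := by
    rw [h₁]
    refine run_fillS (F := fun i => σ.arr .D i + if σ.arr .R i = 0 then 1 else 0) ?_
    intro i hi τ h1 h2 h3
    simp only [Expr.eval, h1, St.set_var, if_true]
    rw [h3 i le_rfl, h2 .R (by decide)]
    split_ifs <;> omega
  have R₂ : ∀ i < σ₁.var .nn, σ₂.arr .R2 i = nearSuccE.eval (σ₁.set .y i) := by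
    rw [h₂]
    refine run_fillS (F := fun i => nearSuccE.eval (σ₁.set .y i)) ?_
    intro i hi τ h1 h2 h3
    simp [nearSuccE, Expr.ex, Expr.eval, Expr.eq, Expr.and, Expr.or, idxE, Expr.mul, adjE, h1,
      h2 .R (by decide), h2 .inp (by decide)]
  intro u hu v hv
  have hi := Nat.mul_add_lt_mul_self hu hv
  rw [hrun]
  constructor
  · rw [run_fillS (F := fun i => σ₂.arr .R2 i) _ _ (by rw [l₂.nn]; exact hi),
      R₂ _ (by rw [l₁.nn]; exact hi)]
    · refine T_nearSuccE (l₁.set (by decide) (by decide) _) (fun u hu v hv => ?_) hu hv (by simp)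
      rw [St.set_arr, R₁]
      exact (hT u hu v hv).1
    · intro i hi τ h1 h2 h3
      simp [Expr.eval, h1, h2 .R2 (by decide)]
  · rw [Stmt.run_arr rfl, h₂, Stmt.run_arr rfl, D₁ _ (by rw [h.nn]; exact hi),
      TMSInstance.distNat_succ hu hv, (hT u hu v hv).2, ← (hT u hu v hv).1]
    congr 1
    by_cases h0 : σ.arr .R (I.n * u + v) = 0 <;> simp [h0]

theorem run_tableS (h : Located I σ) : ∀ u < I.n, ∀ v < I.n,
    (tableS.run σ).arr .D (I.n * u + v) = I.distNat (σ.var .cap) u v := by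
  obtain ⟨σ₁, h₁⟩ : ∃ τ, τ = (fillS .R nearZeroE).run σ := ⟨_, rfl⟩
  obtain ⟨σ₂, h₂⟩ : ∃ τ, τ = (fillS .D (.const 0)).run σ₁ := ⟨_, rfl⟩
  have hrun : tableS.run σ = (Stmt.loop .r .cap roundS).run σ₂ := by
    rw [h₂, h₁]
    rfl
  have l₁ : Located I σ₁ := h₁ ▸ h.run rfl rfl rfl
  have l₂ : Located I σ₂ := h₂ ▸ l₁.run rfl rfl rfl
  have hc : σ₂.var .cap = σ.var .cap := by
    rw [h₂, Stmt.run_var rfl, h₁, Stmt.run_var rfl]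
  have T₂ : Table I 0 σ₂ := by
    intro u hu v hv
    constructor
    · rw [h₂, Stmt.run_arr rfl, h₁]
      exact run_nearZero h u hu v hv
    · rw [h₂, run_fillS (F := fun _ => 0) (fun _ _ _ _ _ _ => rfl) _
        (by rw [l₁.nn]; exact Nat.mul_add_lt_mul_self hu hv), TMSInstance.distNat_zero]
  have key : ∀ r, Located I (roundS.iter .r σ₂ r) ∧ Table I r (roundS.iter .r σ₂ r) := by
    intro r
    induction r with
    | zero => exact ⟨l₂, T₂⟩
    | succ r ih =>
      have l : Located I ((roundS.iter .r σ₂ r).set .r r) := ih.1.set (by decide) (by decide) r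
      rw [Stmt.iter_succ]
      exact ⟨l.run rfl rfl rfl, Table.run_roundS (σ := (roundS.iter .r σ₂ r).set .r r) ih.2 l⟩
  intro u hu v hv
  rw [hrun, Stmt.run_loop, hc]
  exact ((key _).2 u hu v hv).2

end Imp

/-! ### The program: reading the input -/

namespace Imp

open Branching TMSInstance

variable {I : TMSInstance} {σ : St} {J : List Bool × ℕ}

theorem initSt_inp (J : List Bool × ℕ) (i : ℕ) : (initSt J).arr .inp i ≠ 0 ↔ BitAt J.1 i := by
  simp [initSt]

/-- Find the number of vertices. -/
def countS : Stmt := .assign .n (.find .i .L (.isz (.get .inp (.var .i))))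

def squareS : Stmt :=
  .seq (.assign .nn ((Expr.var .n).mul .n))
    (.assign .q ((((Expr.var .n).add (.const 1)).add (.var .nn)).add (.var .nn)))

/-- Read the binary digits of `k`. -/
def readS : Stmt :=
  .loop .i .L (.ite (.lt (.add (.var .q) (.var .i)) (.var .L))
    (.assign .k (.add (.add (.var .k) (.var .k))
      (.get .inp (.sub (.var .L) (.add (.const 1) (.var .i)))))) .skip)

/-- The input has the format of an encoding, and `k` is at most the parameter. -/
def formatE : Expr :=
  (Expr.le (.var .q) (.var .L)).and
  ((Expr.or (.eq (.var .q) (.var .L)) (.get .inp (.sub (.var .L) (.const 1)))).and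
  ((Expr.le (.var .k) (.var .p)).and
  ((Expr.all .u .n (.isz (adjE (.var .u) (.var .u)))).and
  ((Expr.all .u .n (.all .v .n (.or (.isz (adjE (.var .u) (.var .v))) (adjE (.var .v) (.var .u))))).and
  (Expr.all .u .n (.all .v .n
    (.or (.isz (pairE (.var .u) (.var .v))) (pairE (.var .v) (.var .u)))))))))

def paramS : Stmt :=
  -- Replaces `k` by the minimum of `k` and `p`: read in binary, `k` can be exponential in the input
  -- length, and it becomes a loop bound later. The test `k ≤ p` has been made before.
  .seq (.assign .k (.sub (.var .k) (.sub (.var .k) (.var .p))))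
  (.seq (.assign .d (.sub (.var .p) (.var .k)))
  (.seq (.assign .cap (.add (.add (.add (.var .p) (.var .p)) (.var .p)) (.const 3)))
  (.seq (.assign .B (.add (.var .cap) (.const 1)))
  (.seq (.assign .p2 (.add (.var .p) (.var .p)))
  (.seq (.assign .M (.add ((Expr.var .p).mul .p) (.add (.add (.var .p2) (.var .p2)) (.var .p))))
  (.assign .N (.const 1)))))))

/-- Compute the number of vectors of digits. -/
def powS : Stmt := .loop .i .M (.assign .N ((Expr.var .N).mul .B))

def resultS : Stmt :=
  .assign .res ((Expr.var .ok).and ((Expr.var .yes).and (.isz (.var .early))))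

/-- The number of letters `true` at the beginning. -/
noncomputable def onesCount (x : List Bool) : ℕ := leastBelow x.length fun i => ¬BitAt x i

/-- The number whose digits follow the matrices. -/
noncomputable def tailNumber (x : List Bool) : ℕ :=
  ofBits (x.drop (x.length - (x.length - digitPos (onesCount x))))

theorem onesCount_le (x : List Bool) : onesCount x ≤ x.length := leastBelow_le _ _

theorem onesCount_encode (I : TMSInstance) : onesCount I.encode = I.n := by
  have h := I.isFormat_encode
  have hlen := h.len
  have hn : I.n < I.encode.length := by
    rw [digitPos] at hlen
    omega
  have h1 : onesCount I.encode < I.encode.length := leastBelow_lt_iff.2 ⟨_, hn, h.zero⟩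
  rcases lt_trichotomy (onesCount I.encode) I.n with h2 | h2 | h2
  · exact absurd (h.ones _ h2) (leastBelow_spec (leastBelow_lt_iff.1 h1))
  · exact h2
  · exact absurd h.zero (not_of_lt_leastBelow h2)

theorem tailNumber_encode (I : TMSInstance) : tailNumber I.encode = I.k := by
  have hlen := I.isFormat_encode.len
  rw [tailNumber, onesCount_encode, Nat.sub_sub_self hlen, drop_encode, ofBits_bits]

theorem run_countS (J : List Bool × ℕ) :
    countS.run (initSt J) = (initSt J).set .n (onesCount J.1) := by
  rw [countS, Stmt.run]
  congr 1
  refine (eval_find (P := fun i => ¬BitAt J.1 i) (by decide) (by decide) fun i _ j => ?_).trans rfl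
  rw [T_isz, T_get]
  simp only [Expr.eval, St.set_var, St.set_arr, if_true]
  rw [initSt_inp]

theorem run_squareS (σ : St) : squareS.run σ =
    (σ.set .nn (σ.var .n * σ.var .n)).set .q (digitPos (σ.var .n)) := by
  simp [squareS, Stmt.run, Expr.mul, Expr.eval, digitPos]

/-- Horner's rule from the last letter backwards, as the most significant digit stands last. After
`r` rounds `k` is the value of the last `r` letters, but never reaches back before position `q`. -/
theorem run_readS (J : List Bool × ℕ) (hL : σ.var .L = J.1.length)
    (hq : σ.var .q = digitPos (onesCount J.1)) (hk : σ.var .k = 0)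
    (hi : σ.arr .inp = (initSt J).arr .inp) : (readS.run σ).var .k = tailNumber J.1 := by
  set q := digitPos (onesCount J.1) with hqdef
  rw [readS, Stmt.run_loop, hL]
  set s : Stmt := .ite (.lt (.add (.var .q) (.var .i)) (.var .L))
    (.assign .k (.add (.add (.var .k) (.var .k))
      (.get .inp (.sub (.var .L) (.add (.const 1) (.var .i)))))) .skip with hs
  have key : ∀ r, (s.iter .i σ r).var .k =
      ofBits (J.1.drop (J.1.length - min r (J.1.length - q))) := by
    intro r
    induction r with
    | zero => simp [hk, ofBits]
    | succ r ih =>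
      have h1 : (s.iter .i σ r).var .L = J.1.length :=
        (Stmt.iter_var (by decide) (Stmt.run_var rfl) σ r).trans hL
      have h2 : (s.iter .i σ r).var .q = q :=
        (Stmt.iter_var (by decide) (Stmt.run_var rfl) σ r).trans hq
      have h3 : (s.iter .i σ r).arr .inp = (initSt J).arr .inp :=
        (Stmt.iter_arr (Stmt.run_arr rfl) σ r).trans hi
      set τ := s.iter .i σ r with hτ
      rw [Stmt.iter_succ, ← hτ, hs, Stmt.run]
      have hc : (Expr.lt (.add (.var .q) (.var .i)) (.var .L)).eval (τ.set .i r) = 0 ↔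
          ¬q + r < J.1.length := by
        rw [← not_iff_not, not_not]
        refine (T_lt _ _ _).trans ?_
        simp [Expr.eval, h1, h2]
      by_cases hr : q + r < J.1.length
      · rw [if_neg (by rw [hc, not_not]; exact hr)]
        rw [min_eq_left (by omega)] at ih ⊢
        have hlt : J.1.length - (r + 1) < J.1.length := by omega
        have hd := List.drop_eq_getElem_cons hlt
        rw [show J.1.length - (r + 1) + 1 = J.1.length - r by omega] at hd
        rw [hd, ofBits_cons, ← ih]
        simp only [Stmt.run, Expr.eval, St.set_var, St.set_arr, if_true, reduceCtorEq, if_false, h1,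
          h3, initSt, true_and]
        rw [Nat.add_comm 1 r, List.getElem?_eq_getElem hlt]
        cases J.1[J.1.length - (r + 1)] <;> simp [Nat.bit] <;> omega
      · rw [if_pos (hc.2 hr), Stmt.run, St.set_var, if_neg (by decide), ih]
        congr 3
        omega
  rw [key, tailNumber, min_eq_right (by omega)]

theorem T_adjE_iff (σ : St) {x y : Var} (hx : x ≠ .z) : (adjE (.var x) (.var y)).T σ ↔
    σ.arr .inp (σ.var .n + 1 + (σ.var .n * σ.var x + σ.var y)) ≠ 0 := by
  simp [adjE, T_get, idxE, Expr.mul, Expr.eval, hx]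

theorem T_pairE_iff (σ : St) {x y : Var} (hx : x ≠ .z) : (pairE (.var x) (.var y)).T σ ↔
    σ.arr .inp (σ.var .n + 1 + σ.var .nn + (σ.var .n * σ.var x + σ.var y)) ≠ 0 := by
  simp [pairE, T_get, idxE, Expr.mul, Expr.eval, hx]

/-- The initial block of ones needs no test: it comes from the minimality in `onesCount`. An input
with ones only, which lacks the closing `false`, fails the length condition. -/
theorem T_formatE (J : List Bool × ℕ) (hL : σ.var .L = J.1.length) (hn : σ.var .n = onesCount J.1)
    (hnn : σ.var .nn = onesCount J.1 * onesCount J.1) (hq : σ.var .q = digitPos (onesCount J.1))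
    (hi : σ.arr .inp = (initSt J).arr .inp) :
    formatE.T σ ↔ IsFormat J.1 (onesCount J.1) ∧ σ.var .k ≤ σ.var .p := by
  simp only [formatE, T_and, T_le, T_or, T_eq, T_get, T_all, T_isz,
    T_adjE_iff _ (show Var.u ≠ .z by decide), T_adjE_iff _ (show Var.v ≠ .z by decide),
    T_pairE_iff _ (show Var.u ≠ .z by decide), T_pairE_iff _ (show Var.v ≠ .z by decide),
    Expr.eval, St.set_var, St.set_arr, reduceCtorEq, if_true, if_false, hL, hn, hnn, hq, hi,
    initSt_inp, ← imp_iff_not_or]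
  constructor
  · rintro ⟨h1, h2, h3, h4, h5, h6⟩
    refine ⟨⟨fun i hi => not_not.1 (not_of_lt_leastBelow hi), ?_, h1, h2, h4, h5, h6⟩, h3⟩
    refine (leastBelow_mem J.1.length fun i => ¬BitAt J.1 i).resolve_left ?_
    change onesCount J.1 ≠ _
    rw [digitPos] at h1
    omega
  · rintro ⟨h, h3⟩
    exact ⟨h.len, h.last, h3, h.irrefl, h.adj_symm, h.pair_symm⟩

/-- The values of the variables after `paramS`. -/
structure HasParams (p k : ℕ) (σ : St) : Prop where
  hp : σ.var .p = p
  hk : σ.var .k = k - (k - p)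
  d : σ.var .d = p - (k - (k - p))
  cap : σ.var .cap = 3 * p + 3
  B : σ.var .B = 3 * p + 4
  M : σ.var .M = p * p + 5 * p
  p2 : σ.var .p2 = 2 * p

theorem hasParams_run_paramS (σ : St) : HasParams (σ.var .p) (σ.var .k) (paramS.run σ) := by
  constructor <;> simp [paramS, Stmt.run, Expr.eval, Expr.mul] <;> ring

theorem HasParams.run_powS {p k : ℕ} (h : HasParams p k σ) : HasParams p k (powS.run σ) := by
  have hv : ∀ x, powS.keeps x = true → (powS.run σ).var x = σ.var x := fun x hx =>
    Stmt.run_var hx σ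
  constructor
  · exact (hv _ rfl).trans h.hp
  · exact (hv _ rfl).trans h.hk
  · exact (hv _ rfl).trans h.d
  · exact (hv _ rfl).trans h.cap
  · exact (hv _ rfl).trans h.B
  · exact (hv _ rfl).trans h.M
  · exact (hv _ rfl).trans h.p2

theorem run_powS (hN : σ.var .N = 1) : (powS.run σ).var .N = σ.var .B ^ σ.var .M := by
  rw [powS, Stmt.run_loop]
  set s : Stmt := .assign .N ((Expr.var .N).mul .B) with hs
  have key : ∀ r, (s.iter .i σ r).var .N = σ.var .B ^ r := by
    intro r
    induction r with
    | zero => simpa using hN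
    | succ r ih =>
      have hB : (s.iter .i σ r).var .B = σ.var .B :=
        Stmt.iter_var (by decide) (Stmt.run_var rfl) σ r
      set τ := s.iter .i σ r with hτ
      rw [Stmt.iter_succ, ← hτ, hs, Stmt.run, St.set_var, if_pos rfl,
        eval_mul (a := τ.var .N) (by simp [Expr.eval]), ih]
      simp [hB, Nat.pow_succ']
  exact key _

end Imp

/-! ### The whole program -/

namespace Imp

open Branching TMSInstance

variable {I : TMSInstance} {σ : St} {J : List Bool × ℕ}

def setupS : Stmt :=
  .seq countS (.seq squareS (.seq readS (.seq (.assign .ok formatE) (.seq paramS powS))))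

def mainS : Stmt := .seq setupS (.seq tableS (.seq (.loop .t .N tryS) resultS))

/-- The state after `setupS`. -/
structure Prepared (J : List Bool × ℕ) (σ : St) : Prop
    extends HasParams J.2 (tailNumber J.1) σ where
  n : σ.var .n = onesCount J.1
  nn : σ.var .nn = onesCount J.1 * onesCount J.1
  L : σ.var .L = J.1.length
  N : σ.var .N = (3 * J.2 + 4) ^ (J.2 * J.2 + 5 * J.2)
  ok : σ.var .ok ≠ 0 ↔ IsFormat J.1 (onesCount J.1) ∧ tailNumber J.1 ≤ J.2
  yes : σ.var .yes = 0
  early : σ.var .early = 0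
  inp : σ.arr .inp = (initSt J).arr .inp
  g : σ.arr .g = 0

/-- A number that bounds all loop bounds. -/
def loopBound (p : ℕ) : ℕ := (3 * p + 4) ^ (p * p + 5 * p + 2)

theorem Stmt.cost_seq_le {s s' : Stmt} {Q : ℕ} (h : s.cost σ ≤ s.bound Q)
    (h' : s'.cost (s.run σ) ≤ s'.bound Q) : (Stmt.seq s s').cost σ ≤ (Stmt.seq s s').bound Q :=
  Nat.add_le_add h h'

theorem cost_le_of_list {s : Stmt} (l : List Var) {Q : ℕ}
    (hs : s.wf (fun v => decide (v ∈ l)) = true) (h : ∀ v ∈ l, σ.var v ≤ Q) :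
    s.cost σ ≤ s.bound Q :=
  Stmt.cost_le hs fun v hv => h v (of_decide_eq_true hv)

/-- The cost is estimated stage by stage, because some loop bounds (`n`, `M`, `B`) are themselves
assigned during the set-up. -/
theorem prepared_run_setupS (J : List Bool × ℕ) : Prepared J (setupS.run (initSt J)) ∧
    ∀ Q, J.1.length ≤ Q → 3 * J.2 + 4 ≤ Q → J.2 * J.2 + 5 * J.2 ≤ Q →
      setupS.cost (initSt J) ≤ setupS.bound Q := by
  have r₁ := run_countS J
  obtain ⟨σ₁, h₁⟩ : ∃ τ, τ = countS.run (initSt J) := ⟨_, rfl⟩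
  obtain ⟨σ₂, h₂⟩ : ∃ τ, τ = squareS.run σ₁ := ⟨_, rfl⟩
  obtain ⟨σ₃, h₃⟩ : ∃ τ, τ = readS.run σ₂ := ⟨_, rfl⟩
  obtain ⟨σ₄, h₄⟩ : ∃ τ, τ = (Stmt.assign .ok formatE).run σ₃ := ⟨_, rfl⟩
  obtain ⟨σ₅, h₅⟩ : ∃ τ, τ = paramS.run σ₄ := ⟨_, rfl⟩
  have hrun : setupS.run (initSt J) = powS.run σ₅ := by
    rw [h₅, h₄, h₃, h₂, h₁]
    rfl
  have L₁ : σ₁.var .L = J.1.length := by rw [h₁, r₁]; rfl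
  have n₁ : σ₁.var .n = onesCount J.1 := by rw [h₁, r₁]; rfl
  have e₂ := run_squareS σ₁
  rw [n₁, ← h₂] at e₂
  have L₂ : σ₂.var .L = J.1.length := by rw [e₂]; exact L₁
  have n₂ : σ₂.var .n = onesCount J.1 := by rw [e₂]; exact n₁
  have nn₂ : σ₂.var .nn = onesCount J.1 * onesCount J.1 := by rw [e₂]; rfl
  have q₂ : σ₂.var .q = digitPos (onesCount J.1) := by rw [e₂]; rfl
  have i₂ : σ₂.arr .inp = (initSt J).arr .inp := by rw [e₂, h₁, r₁]; rfl
  have k₂ : σ₂.var .k = 0 := by rw [e₂, h₁, r₁]; rfl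
  have p₂ : σ₂.var .p = J.2 := by rw [e₂, h₁, r₁]; rfl
  have k₃ := run_readS J L₂ q₂ k₂ i₂
  rw [← h₃] at k₃
  have v₃ : ∀ x, readS.keeps x = true → σ₃.var x = σ₂.var x := fun x hx => by
    rw [h₃, Stmt.run_var hx]
  have i₃ : σ₃.arr .inp = (initSt J).arr .inp := by rw [h₃, Stmt.run_arr rfl, i₂]
  have n₃ := (v₃ .n rfl).trans n₂
  have p₃ := (v₃ .p rfl).trans p₂
  have f₃ := T_formatE J ((v₃ .L rfl).trans L₂) n₃ ((v₃ .nn rfl).trans nn₂)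
    ((v₃ .q rfl).trans q₂) i₃
  rw [k₃, p₃] at f₃
  have ok₄ : σ₄.var .ok ≠ 0 ↔ IsFormat J.1 (onesCount J.1) ∧ tailNumber J.1 ≤ J.2 := by
    rw [h₄]
    exact f₃
  have P₅ := hasParams_run_paramS σ₄
  have k₄ : σ₄.var .k = tailNumber J.1 := by rw [h₄, Stmt.run_var rfl, k₃]
  have p₄ : σ₄.var .p = J.2 := by rw [h₄, Stmt.run_var rfl, p₃]
  rw [k₄, p₄, ← h₅] at P₅
  have N₅ : σ₅.var .N = 1 := by rw [h₅]; rfl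
  have v₅ : ∀ x, (Stmt.seq squareS (.seq readS (.seq (.assign .ok formatE) paramS))).keeps x = true →
      σ₅.var x = σ₁.var x := fun x hx => by
    rw [h₅, h₄, h₃, h₂]
    exact Stmt.run_var hx σ₁
  have a₆ : ∀ b, setupS.keepsArr b = true → (powS.run σ₅).arr b = (initSt J).arr b := fun b hb => by
    rw [← hrun, Stmt.run_arr hb]
  have v₆ : ∀ x, setupS.keeps x = true → (powS.run σ₅).var x = (initSt J).var x := fun x hx => by
    rw [← hrun, Stmt.run_var hx]
  constructor
  · rw [hrun]
    refine ⟨P₅.run_powS, ?_, ?_, ?_, ?_, ?_, ?_, ?_, ?_, ?_⟩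
    · rw [Stmt.run_var rfl, v₅ _ rfl, n₁]
    · rw [Stmt.run_var rfl, h₅, Stmt.run_var rfl, h₄, Stmt.run_var rfl, v₃ _ rfl, nn₂]
    · exact v₆ _ rfl
    · rw [run_powS N₅, P₅.B, P₅.M]
    · rw [Stmt.run_var rfl, h₅, Stmt.run_var rfl]
      exact ok₄
    · exact v₆ _ rfl
    · exact v₆ _ rfl
    · exact a₆ _ rfl
    · rw [a₆ _ rfl]
      funext i
      simp [initSt]
  · intro Q hL hB hM
    have hn := onesCount_le J.1
    refine Stmt.cost_seq_le (cost_le_of_list [.L] rfl ?_) ?_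
    · simpa [initSt] using hL
    rw [← h₁]
    refine Stmt.cost_seq_le (cost_le_of_list [.L, .n] rfl ?_) ?_
    · simp only [List.forall_mem_cons, List.not_mem_nil, false_imp_iff, implies_true, and_true, L₁,
        n₁]
      omega
    rw [← h₂]
    refine Stmt.cost_seq_le (cost_le_of_list [.L] rfl (by simpa [L₂] using hL)) ?_
    rw [← h₃]
    refine Stmt.cost_seq_le (cost_le_of_list [.n, .p] rfl ?_) ?_
    · simp only [List.forall_mem_cons, List.not_mem_nil, false_imp_iff, implies_true, and_true, n₃,
        p₃]
      omega
    rw [← h₄]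
    refine Stmt.cost_seq_le (cost_le_of_list [.p] rfl ?_) ?_
    · simp only [List.forall_mem_cons, List.not_mem_nil, false_imp_iff, implies_true, and_true, p₄]
      omega
    rw [← h₅]
    refine cost_le_of_list [.M, .B] rfl ?_
    simp only [List.forall_mem_cons, List.not_mem_nil, false_imp_iff, implies_true, and_true, P₅.M,
      P₅.B]
    omega

/-- The square of the input size covers `n * n`; the extra exponent 2 in `loopBound` makes room for
the quadratic quantities such as `M`, even for small `p`. -/
theorem params_le {p k S n : ℕ} {σ : St} (h : HasParams p k σ) (hL : σ.var .L ≤ S)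
    (hn : σ.var .n = n) (hnS : n ≤ S) (hnn : σ.var .nn = n * n)
    (hN : σ.var .N = (3 * p + 4) ^ (p * p + 5 * p)) (hS : 1 ≤ S) :
    ∀ v, params v = true → σ.var v ≤ loopBound p * S ^ 2 := by
  have hX : 1 ≤ loopBound p := Nat.one_le_pow _ _ (by omega)
  have hS2 : S ≤ S ^ 2 := Nat.le_self_pow (by omega) S
  have h1 : ∀ a, a ≤ S ^ 2 → a ≤ loopBound p * S ^ 2 := fun a ha =>
    ha.trans (Nat.le_mul_of_pos_left _ hX)
  have h2 : ∀ a, a ≤ loopBound p → a ≤ loopBound p * S ^ 2 := fun a ha =>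
    ha.trans (Nat.le_mul_of_pos_right _ (by omega))
  have h3 : (3 * p + 4) ^ 2 ≤ loopBound p := Nat.pow_le_pow_right (by omega) (by omega)
  have h4 : (3 * p + 4) ^ (p * p + 5 * p) ≤ loopBound p :=
    Nat.pow_le_pow_right (by omega) (by omega)
  have h5 : p * p + 5 * p + (3 * p + 4) ≤ (3 * p + 4) ^ 2 := by nlinarith
  have h6 : n * n ≤ S ^ 2 := by rw [sq]; exact Nat.mul_le_mul hnS hnS
  intro v hv
  cases v <;> try simp [params] at hv
  · exact h1 _ (hL.trans hS2)
  · exact h2 _ (by rw [h.hp]; omega)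
  · exact h1 _ (by rw [hn]; omega)
  · exact h1 _ (by rw [hnn]; omega)
  · exact h2 _ (by rw [h.hk]; omega)
  · exact h2 _ (by rw [h.d]; omega)
  · exact h2 _ (by rw [h.cap]; omega)
  · exact h2 _ (by rw [h.B]; omega)
  · exact h2 _ (by rw [h.M]; omega)
  · exact h2 _ (by rw [hN]; omega)
  · exact h2 _ (by rw [h.p2]; omega)

/-- After the set-up no variable of `params` is assigned any more, so one bound for their values
serves all remaining loops. -/
theorem cost_mainS_le (J : List Bool × ℕ) : mainS.cost (initSt J) ≤
    mainS.bound (loopBound J.2 * ParameterizedProblem.size J ^ 2) := by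
  obtain ⟨hP, hc⟩ := prepared_run_setupS J
  have hS : J.1.length ≤ ParameterizedProblem.size J := by
    rw [ParameterizedProblem.size]
    omega
  have hb := params_le hP.toHasParams (hP.L.trans_le hS) hP.n ((onesCount_le _).trans hS) hP.nn
    hP.N (by rw [ParameterizedProblem.size]; omega)
  refine Stmt.cost_seq_le (hc _ ?_ ?_ ?_) (Stmt.cost_seq_le (Stmt.cost_le (b := params) rfl hb) ?_)
  · exact hP.L ▸ hb .L rfl
  · exact hP.B ▸ hb .B rfl
  · exact hP.M ▸ hb .M rfl
  refine Stmt.cost_seq_le (Stmt.cost_le (b := params) rfl fun v hv => ?_)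
    (cost_le_of_list [] rfl (by simp))
  rw [Stmt.run_var (Stmt.keeps_of_wf (b := params) rfl hv)]
  exact hb v hv

theorem Prepared.located (h : Prepared (I.encode, J.2) σ) : Located I σ where
  n := h.n.trans (onesCount_encode I)
  nn := h.nn.trans (by rw [onesCount_encode])
  adj u hu v hv := by rw [h.inp, initSt_inp]; exact I.bitAt_encode_adj hu hv
  pair u hu v hv := by rw [h.inp, initSt_inp]; exact I.bitAt_encode_pair hu hv

theorem ready_run_tableS {p : ℕ} (h : Prepared (I.encode, p) σ) (hk : I.k ≤ p) :
    Ready I p (tableS.run σ) := by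
  have hl : Located I σ := Prepared.located (J := (I.encode, p)) h
  have hv : ∀ x, tableS.keeps x = true → (tableS.run σ).var x = σ.var x := fun x hx =>
    Stmt.run_var hx σ
  have hkk : tailNumber I.encode - (tailNumber I.encode - p) = I.k := by
    rw [tailNumber_encode]
    omega
  exact
    { toLocated := hl.run rfl rfl rfl
      hp := (hv _ rfl).trans h.hp
      k := (hv _ rfl).trans (h.hk.trans hkk)
      k_le := hk
      d := (hv _ rfl).trans (h.d.trans (congrArg (p - ·) hkk))
      cap := (hv _ rfl).trans h.cap
      B := (hv _ rfl).trans h.B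
      M := (hv _ rfl).trans h.M
      N := (hv _ rfl).trans h.N
      p2 := (hv _ rfl).trans h.p2
      dist := h.cap ▸ run_tableS hl }

theorem run_resultS (σ : St) : (resultS.run σ).var .res = 1 ↔
    σ.var .ok ≠ 0 ∧ σ.var .yes ≠ 0 ∧ σ.var .early = 0 := by
  rw [resultS, Stmt.run, St.set_var, if_pos rfl, eval_and_eq_one, T_and, T_and, T_isz, T_var, T_var,
    T_var, not_not]

/-- For `k > p` the search runs with a truncated `k` and its outcome is meaningless; then the flag
`ok` is 0, in accordance with `p = k + dc(G) ≥ k`. -/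
theorem run_mainS_encode (I : TMSInstance) (p : ℕ) :
    (mainS.run (initSt (I.encode, p))).var .res = 1 ↔ I.IsYes ∧ p = I.k + I.G.distToCluster := by
  obtain ⟨hP, -⟩ := prepared_run_setupS (I.encode, p)
  set σ := setupS.run (initSt (I.encode, p)) with hσ
  have hrun : mainS.run (initSt (I.encode, p)) =
      resultS.run ((Stmt.loop .t .N tryS).run (tableS.run σ)) := rfl
  have hok : ((Stmt.loop .t .N tryS).run (tableS.run σ)).var .ok ≠ 0 ↔ I.k ≤ p := by
    rw [Stmt.run_var rfl, Stmt.run_var rfl, hP.ok]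
    simp only [tailNumber_encode, onesCount_encode]
    exact and_iff_right I.isFormat_encode
  rw [hrun, run_resultS, hok]
  by_cases hk : I.k ≤ p
  · obtain ⟨h1, h2⟩ := run_loop_tryS (ready_run_tableS hP hk)
      (fun j _ => by rw [Stmt.run_arr rfl, hP.g]; rfl)
      (by rw [Stmt.run_var rfl, hP.yes]) (by rw [Stmt.run_var rfl, hP.early])
    rw [← exists_succeeds_and_not_exists_succeedsEarly_iff hk, and_iff_right hk, h1, ← h2, not_not]
  · refine iff_of_false (fun h => hk h.1) fun h => hk ?_
    rw [h.2]
    exact Nat.le_add_right _ _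

theorem run_mainS (J : List Bool × ℕ) :
    (mainS.run (initSt J)).var .res = 1 ↔ J ∈ TMSBySolutionSizePlusDistToCluster := by
  constructor
  · intro h
    obtain ⟨hP, -⟩ := prepared_run_setupS J
    have h1 := ((run_resultS _).1 h).1
    rw [Stmt.run_var rfl, Stmt.run_var rfl] at h1
    obtain ⟨I, hI, -⟩ := exists_eq_encode (hP.ok.1 h1).1
    have hJ : J = (I.encode, J.2) := by rw [← hI]
    rw [hJ, run_mainS_encode] at h
    exact ⟨I, by rw [← h.2]; exact hJ, h.1⟩
  · rintro ⟨I, rfl, hI⟩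
    exact (run_mainS_encode I _).2 ⟨hI, rfl⟩

theorem computable_nat_pow : Computable₂ fun a b : ℕ => a ^ b := by
  have h : Primrec₂ fun a b : ℕ => a ^ b := by
    refine (Primrec.nat_rec (f := fun _ : ℕ => 1) (g := fun a q => q.2 * a) (.const 1)
      (Primrec.nat_mul.comp (Primrec.snd.comp Primrec.snd) Primrec.fst)).of_eq fun a b => ?_
    induction b with
    | zero => rfl
    | succ b ih => rw [pow_succ, ← ih]
  exact h.to_comp

theorem computable_loopBound : Computable loopBound := by
  have hm : ∀ {f g : ℕ → ℕ}, Primrec f → Primrec g → Primrec fun p => f p * g p :=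
    fun hf hg => Primrec.nat_mul.comp hf hg
  have ha : ∀ {f g : ℕ → ℕ}, Primrec f → Primrec g → Primrec fun p => f p + g p :=
    fun hf hg => Primrec.nat_add.comp hf hg
  have h1 : Primrec fun p : ℕ => 3 * p + 4 := ha (hm (.const 3) .id) (.const 4)
  have h2 : Primrec fun p : ℕ => p * p + 5 * p + 2 :=
    ha (ha (hm .id .id) (hm (.const 5) .id)) (.const 2)
  exact computable_nat_pow.comp h1.to_comp h2.to_comp

end Imp

/-- Terminal monitoring set is fixed-parameter tractable when parameterized by solution size plus
distance to cluster of the input graph. -/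
theorem theorem1 : TMSBySolutionSizePlusDistToCluster.IsFPT := by
  obtain ⟨C, D, h⟩ := Imp.mainS.polyBounded
  -- With `Q = loopBound p * size ^ 2`, the bound `C * Q ^ D` splits into the parameter part `C *
  -- loopBound p ^ D` and `size ^ (2 * D)`.
  refine Imp.isFPT_of_stmt Imp.mainS (f := fun p => C * Imp.loopBound p ^ D) ?_ (2 * D)
    (fun J => (Imp.cost_mainS_le J).trans ((h _ ?_).trans_eq ?_)) Imp.run_mainS
  · exact (Primrec.nat_mul.to_comp).comp (Computable.const C)
      (Imp.computable_nat_pow.comp Imp.computable_loopBound (Computable.const D))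
  · exact Nat.mul_pos (Nat.pow_pos (by omega))
      (Nat.pow_pos (by rw [ParameterizedProblem.size]; omega))
  · rw [mul_pow, ← pow_mul, mul_assoc]
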